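/- Let $\kappa$ be an algebraically closed field of characteristic $\neq 2$ and let $N\ge 0$. Let $\Omega$ be the $N\times N$ matrix with ones on the antidiagonal and zeros elsewhere, $G=O_N=\{g\in GL_N(\kappa)\mid g^\top\Omega g=\Omega\}$, and let $\mathfrak n$ be the set of nilpotent matrices $x$ with $x^\top\Omega+\Omega x=0$, on which $G$ acts by conjugation. Write $\mathcal O(x)$ for the $G$-orbit of $x\in\mathfrak n$; it is labelled by the partition $\pi$ of $N$ given by the Jordan block sizes of $x$, and the partitions which occur are the orthogonal ones, those in which every even part has even multiplicity. For $x,y\in\mathfrak n$, $\mathcal O(y)$ is 1-accessible from $\mathcal O(x)$ if there is a cocharacter $\lambda:\mathbb G_m\to G$ (a homomorphism of algebraic groups) such that $\lim_{t\to 0}\lambda(t)x\lambda(t)^{-1}$ exists (that is, $t\mapsto\lambda(t)x\lambda(t)^{-1}$ extends to a morphism on $\mathbb A^1$) and lies in $\mathcal O(y)$; $\mathcal O(y)$ is accessible from $\mathcal O(x)$ if there is a finite chain of 1-accessible steps in $\mathfrak n$ from $x$ to $y$. Consider the following moves on partitions of $N$. In each one the listed parts are replaced, all other parts (of any size) are unchanged,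 and a part $0$ stands for an absent part: 1. $[2m+1+2k,\,2m+1]\to[2m+1+k,\,2m+1+k]$, for $m\ge 0$, $k\ge 1$; 2. $[2n+1,m,m]\to[2n-1,m+1,m+1]$, for $m\ge 0$, $2n+1\ge m+2$; 3. $[n,n,2m-1]\to[n-1,n-1,2m+1]$, for $m\ge 1$, $n\ge 2m+1$; 4. $[n,n,m,m]\to[n-1,n-1,m+1,m+1]$, for $m\ge 0$, $n\ge m+2$. Then: (a) Accessibility is a partial order on the set of $G$-orbits in $\mathfrak n$. (b) If $x,y\in\mathfrak n$ have partitions $\pi_x,\pi_y$, then $\mathcal O(y)$ is accessible from $\mathcal O(x)$ if and only if $\pi_y$ is obtained from $\pi_x$ by a finite (possibly empty) sequence of moves of type 1–4. (c) If $\pi_y$ is obtained from $\pi_x$ by a move of type 5, $[2n+1,2m+1]\to[2n-1,2m+3]$ with $m\ge 0$ and $2n+1\ge(2m+1)+6$, all other parts being unchanged, and $\pi_x,\pi_y$ are adjacent in the dominance order of orthogonal partitions of $N$ (no orthogonal partition lies strictly between them), then $\mathcal O(y)$ is not accessible from $\mathcal O(x)$. -/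

import Mathlib

open scoped Polynomial LaurentPolynomial

namespace OrthAccess

variable {κ : Type*} [Field κ] {N : ℕ}

/-- The matrix with columns `e_N, …, e_1` (ones on the antidiagonal, zeros elsewhere). -/
def Omega (κ : Type*) [Field κ] (N : ℕ) : Matrix (Fin N) (Fin N) κ :=
  Matrix.of fun i j => if i = Fin.rev j then 1 else 0

/-- The orthogonal group `O_N(κ)`: the invertible matrices `g` with `gᵀ Ω g = Ω`. -/
def orthGroup (κ : Type*) [Field κ] (N : ℕ) : Subgroup (GL (Fin N) κ) where
  carrier := {g | (g : Matrix (Fin N) (Fin N) κ).transpose * Omega κ N * g = Omega κ N}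
  mul_mem' := by
    intro a b ha hb
    simp only [Set.mem_ofPred_eq, Units.val_mul, Matrix.transpose_mul] at ha hb ⊢
    calc _ = (b : Matrix (Fin N) (Fin N) κ).transpose *
          ((a : Matrix (Fin N) (Fin N) κ).transpose * Omega κ N * a) * b := by
            simp only [Matrix.mul_assoc]
      _ = _ := by rw [ha, hb]
  one_mem' := by simp
  inv_mem' := by
    intro a ha
    simp only [Set.mem_ofPred_eq] at ha ⊢
    have h1 : (a : Matrix (Fin N) (Fin N) κ) * (a⁻¹ : GL (Fin N) κ) = 1 := by
      rw [← Units.val_mul, mul_inv_cancel, Units.val_one]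
    have h2 : ((a⁻¹ : GL (Fin N) κ) : Matrix (Fin N) (Fin N) κ).transpose *
        (a : Matrix (Fin N) (Fin N) κ).transpose = 1 := by
      rw [← Matrix.transpose_mul, h1, Matrix.transpose_one]
    calc _ = ((a⁻¹ : GL (Fin N) κ) : Matrix (Fin N) (Fin N) κ).transpose *
          ((a : Matrix (Fin N) (Fin N) κ).transpose * Omega κ N * a) *
            (a⁻¹ : GL (Fin N) κ) := by rw [ha]
      _ = (((a⁻¹ : GL (Fin N) κ) : Matrix (Fin N) (Fin N) κ).transpose *
          (a : Matrix (Fin N) (Fin N) κ).transpose) * Omega κ N *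
            ((a : Matrix (Fin N) (Fin N) κ) * (a⁻¹ : GL (Fin N) κ)) := by
            simp only [Matrix.mul_assoc]
      _ = _ := by rw [h1, h2, Matrix.one_mul, Matrix.mul_one]

/-- The nilpotent elements of the Lie algebra `𝔬_N = {x | xᵀ Ω + Ω x = 0}`. -/
def nilCone (κ : Type*) [Field κ] (N : ℕ) : Set (Matrix (Fin N) (Fin N) κ) :=
  {x | x.transpose * Omega κ N + Omega κ N * x = 0 ∧ IsNilpotent x}

/-- The adjoint action of `GL_N` (hence of `O_N`): `g · x = g x g⁻¹`. -/
def conj (g : GL (Fin N) κ) (x : Matrix (Fin N) (Fin N) κ) : Matrix (Fin N) (Fin N) κ :=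
  (g : Matrix (Fin N) (Fin N) κ) * x * ((g⁻¹ : GL (Fin N) κ) : Matrix (Fin N) (Fin N) κ)

/-- The orbit `𝒪(x)` of `x` under `O_N(κ)`. -/
def orbit (x : Matrix (Fin N) (Fin N) κ) : Set (Matrix (Fin N) (Fin N) κ) :=
  {y | ∃ g ∈ orthGroup κ N, y = conj g x}

/-- A cocharacter of `O_N`: a homomorphism of algebraic groups `𝔾_m → O_N`, that is, a group
homomorphism `κˣ → O_N(κ)` whose matrix entries are regular functions on `𝔾_m`
(Laurent polynomials). -/
structure Cocharacter (κ : Type*) [Field κ] (N : ℕ) where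
  toHom : κˣ →* orthGroup κ N
  regular : ∃ P : Matrix (Fin N) (Fin N) κ[T;T⁻¹], ∀ (t : κˣ) (i j : Fin N),
    ((toHom t : GL (Fin N) κ) : Matrix (Fin N) (Fin N) κ) i j =
      LaurentPolynomial.eval₂ (RingHom.id κ) t (P i j)

/-- `lim_{t → 0} λ(t) · x` exists and equals `y`: the morphism `t ↦ λ(t) · x` on `𝔾_m` extends to
a morphism on the affine line (with polynomial entries) whose value at `0` is `y`. -/
def IsLimit (l : Cocharacter κ N) (x y : Matrix (Fin N) (Fin N) κ) : Prop :=
  ∃ Q : Matrix (Fin N) (Fin N) κ[X],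
    (∀ (t : κˣ) (i j : Fin N), conj (l.toHom t : GL (Fin N) κ) x i j = (Q i j).eval (t : κ)) ∧
    ∀ i j : Fin N, y i j = (Q i j).eval 0

/-- `𝒪(y)` is 1-accessible from `𝒪(x)`. -/
def OneAccessible (x y : nilCone κ N) : Prop :=
  ∃ l : Cocharacter κ N, ∃ z ∈ orbit (y : Matrix (Fin N) (Fin N) κ), IsLimit l x z

/-- `𝒪(y)` is accessible from `𝒪(x)`: there is a finite chain of 1-accessible steps in the
nilpotent cone from `x` to `y`. -/
def Accessible (x y : nilCone κ N) : Prop :=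
  Relation.ReflTransGen OneAccessible x y

/-- `x` has Jordan type `p`: there is a basis, made of one chain
`b_{i,r-1} ↦ ⋯ ↦ b_{i,1} ↦ b_{i,0} ↦ 0` of length `r` for each part `r` of `p` (with multiplicity),
that is, `x` is conjugate to the direct sum of nilpotent Jordan blocks whose sizes are the parts
of `p`. -/
def HasJordanType (x : Matrix (Fin N) (Fin N) κ) (p : N.Partition) : Prop :=
  ∃ (L : List ℕ) (b : Module.Basis (Σ i : Fin L.length, Fin (L.get i)) κ (Fin N → κ)),
    (L : Multiset ℕ) = p.parts ∧
    ∀ (i : Fin L.length) (j : ℕ) (hj : j < L.get i),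
      x.mulVec (b ⟨i, j, hj⟩) =
        if h : j = 0 then 0 else b ⟨i, j - 1, by omega⟩

/-- The moves of type 1–4, restricted to the parts which change; parts equal to `0` are allowed and
stand for absent parts. In `move1` the case `k = 1` is `[2m+1, 2m-1] → [2m, 2m]` (up to the
name of `m`). The inequalities say that the target is strictly lower in the dominance order. -/
inductive BasicMove : Multiset ℕ → Multiset ℕ → Prop
  | move1 (m k : ℕ) (hk : 1 ≤ k) :
      BasicMove {2 * m + 1 + 2 * k, 2 * m + 1} {2 * m + 1 + k, 2 * m + 1 + k}
  | move2 (n m : ℕ) (h : m + 2 ≤ 2 * n + 1) :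
      BasicMove {2 * n + 1, m, m} {2 * n - 1, m + 1, m + 1}
  | move3 (n m : ℕ) (hm : 1 ≤ m) (h : (2 * m - 1) + 2 ≤ n) :
      BasicMove {n, n, 2 * m - 1} {n - 1, n - 1, 2 * m + 1}
  | move4 (n m : ℕ) (h : m + 2 ≤ n) :
      BasicMove {n, n, m, m} {n - 1, n - 1, m + 1, m + 1}

/-- `q` arises from `p` by one move of type 1–4, the remaining parts being unchanged. -/
def Move (p q : N.Partition) : Prop :=
  ∃ s t rest : Multiset ℕ, BasicMove s t ∧
    p.parts = (s + rest).filter (0 < ·) ∧ q.parts = (t + rest).filter (0 < ·)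

/-- `q` arises from `p` by the move of type 5, `[2n+1, 2m+1] → [2n-1, 2m+3]`, the remaining parts
being unchanged, where `2n+1 ≥ (2m+1) + 6`. -/
def Move5 (p q : N.Partition) : Prop :=
  ∃ (n m : ℕ) (rest : Multiset ℕ), (2 * m + 1) + 6 ≤ 2 * n + 1 ∧
    p.parts = {2 * n + 1, 2 * m + 1} + rest ∧ q.parts = {2 * n - 1, 2 * m + 3} + rest

/-- The partitions labelling the nilpotent orbits of `O_N`: even parts have even multiplicity. -/
def IsOrthogonal (p : N.Partition) : Prop :=
  ∀ k : ℕ, Even k → Even (p.parts.count k)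

/-- The dominance order: for every `k`, the sum of the `k` largest parts of `q` is at most that
of `p`. -/
def Dominates (p q : N.Partition) : Prop :=
  ∀ k : ℕ, ((q.parts.sort (· ≥ ·)).take k).sum ≤ ((p.parts.sort (· ≥ ·)).take k).sum

/-- `p` lies strictly above `q` in the dominance order of the partitions labelling nilpotent
orthogonal orbits, with no such partition strictly in between. -/
def Adjacent (p q : N.Partition) : Prop :=
  IsOrthogonal p ∧ IsOrthogonal q ∧ p ≠ q ∧ Dominates p q ∧
    ∀ r : N.Partition, IsOrthogonal r → Dominates p r → Dominates r q → r = p ∨ r = q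

end OrthAccess

/-!
Nilpotent elements of the orthogonal Lie algebra are compared through the ranks of their powers: the
column lengths of the partition of `x` are the drops `rank (x ^ k) - rank (x ^ (k + 1))`
(`HasRanks`). Skewness makes the odd powers have even rank, so these partitions are orthogonal
(`HasRanks.isOrthogonal`), and they determine the orbit (`mem_orbit_of_rank_eq`): equal ranks give
an intertwiner through Jordan bases, and dividing it by a square root of the selfadjoint matrix
which measures its failure to be an isometry makes it orthogonal (`exists_isometry_mul_eq`).

**Limits give moves.** A cocharacter with `lim λ(t) x λ(t)⁻¹ = y` is a grading of the space,
compatible with the form, for which `x` has only nonnegative weights and `y` is its component of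
weight `0` (`exists_grading_of_isLimit`). The passage from `x` to `y` is cut into small steps: a
Jordan block of `y` in the space of highest weight spans an isotropic `x`-stable subspace `W`, and
`x` is replaced by its graded version for `0 ⊆ W ⊆ Wᗮ ⊆ V` (`Grading.exists_isotropic_step`,
`isotropic_step`). If `W` has dimension `b`, such a step never lowers the columns up to the `b`-th
and never raises the later ones (`rk_pow_of_cyclic_sub`), and `b` is a repeated part of the new
partition, because `W` and its dual each contribute a block. The combinatorial heart is
`Pivot.reflTransGen_move`: two orthogonal partitions in this relation are joined by moves of type
1–4. The repeated part `b` is essential, and it is what rules out moves of type 5.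

**Moves give limits.** For each move there is an explicit matrix on a space with a graded basis,
made of shifted chains and two additional entries of positive weight; dropping these entries is the
limit (`realizable_of_basicMove`). Unchanged parts are added as direct summands, and since all
nondegenerate symmetric forms over an algebraically closed field of characteristic not `2` are
equivalent, the model can be carried to the form `Ω` (`exists_limit_of_move`).

**Consequences.** Every move decreases the sum of the squares of the parts, so accessibility is
antisymmetric on orbits. Every move also descends in the dominance order, hence between adjacent
orthogonal partitions a sequence of moves consists of one move, and a move of type 5 is not a move
of type 1–4 (`Move5.not_move`).
-/

namespace OrthAccess

/-! ### Columns of partitions and moves -/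

/-- The number of elements of `s` greater than `k`; for a partition this is the length of its
`(k + 1)`-st column. -/
def cols (s : Multiset ℕ) (k : ℕ) : ℕ := s.countP (k < ·)

@[simp] lemma cols_zero (k : ℕ) : cols 0 k = 0 := by simp [cols]

lemma cols_cons (a : ℕ) (s : Multiset ℕ) (k : ℕ) :
    cols (a ::ₘ s) k = cols s k + if k < a then 1 else 0 := by
  simp [cols, Multiset.countP_cons]

lemma cols_insert (a : ℕ) (s : Multiset ℕ) (k : ℕ) :
    cols (insert a s) k = cols s k + if k < a then 1 else 0 := cols_cons a s k

lemma cols_singleton (a k : ℕ) : cols {a} k = if k < a then 1 else 0 := by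
  simpa using cols_cons a 0 k

lemma cols_add (s t : Multiset ℕ) (k : ℕ) : cols (s + t) k = cols s k + cols t k := by
  simp [cols]

lemma cols_filter_pos (s : Multiset ℕ) (k : ℕ) : cols (s.filter (0 < ·)) k = cols s k := by
  induction s using Multiset.induction with
  | empty => simp
  | cons a s ih =>
    by_cases h : 0 < a
    · rw [Multiset.filter_cons_of_pos _ h, cols_cons, cols_cons, ih]
    · rw [Multiset.filter_cons_of_neg _ h, cols_cons, ih, if_neg (by omega), add_zero]

lemma cols_eq_cols_succ_add_count (s : Multiset ℕ) (k : ℕ) :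
    cols s k = cols s (k + 1) + s.count (k + 1) := by
  induction s using Multiset.induction with
  | empty => simp
  | cons a s ih =>
    rw [cols_cons, cols_cons, Multiset.count_cons, ih]
    split_ifs <;> omega

lemma sum_cols (s : Multiset ℕ) (M : ℕ) (h : ∀ a ∈ s, a ≤ M) :
    ∑ k ∈ Finset.range M, cols s k = s.sum := by
  induction s using Multiset.induction with
  | empty => simp
  | cons a s ih =>
    simp only [cols_cons, Finset.sum_add_distrib, Multiset.sum_cons]
    rw [ih fun b hb => h b (Multiset.mem_cons_of_mem hb), add_comm]
    congr 1
    rw [Finset.sum_ite, Finset.sum_const_zero, add_zero, Finset.sum_const, smul_eq_mul, mul_one]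
    have : (Finset.range M).filter (· < a) = Finset.range a := by
      ext k
      have := h a (Multiset.mem_cons_self a s)
      simp only [Finset.mem_filter, Finset.mem_range]
      omega
    rw [this, Finset.card_range]

/-- A multiset of positive numbers is determined by its column lengths. -/
lemma eq_of_cols_eq {s t : Multiset ℕ} (hs : ∀ a ∈ s, 0 < a) (ht : ∀ a ∈ t, 0 < a)
    (h : ∀ k, cols s k = cols t k) : s = t := by
  ext a
  rcases a with _ | a
  · rw [Multiset.count_eq_zero.2 fun h0 => (hs 0 h0).ne rfl,
      Multiset.count_eq_zero.2 fun h0 => (ht 0 h0).ne rfl]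
  · have h1 := cols_eq_cols_succ_add_count s a
    have h2 := cols_eq_cols_succ_add_count t a
    have := h a
    have := h (a + 1)
    omega

lemma cols_parts_eq_zero {N : ℕ} (p : N.Partition) {k : ℕ} (hk : N ≤ k) :
    cols p.parts k = 0 := by
  rw [cols, Multiset.countP_eq_zero]
  intro a ha
  have := Multiset.le_sum_of_mem ha
  have := p.parts_sum
  omega

lemma sum_cols_parts {N : ℕ} (p : N.Partition) :
    ∑ k ∈ Finset.range N, cols p.parts k = N := by
  rw [sum_cols, p.parts_sum]
  intro a ha
  have := Multiset.le_sum_of_mem ha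
  have := p.parts_sum
  omega

lemma partition_eq_of_cols_eq {N : ℕ} {p q : N.Partition}
    (h : ∀ k, cols p.parts k = cols q.parts k) : p = q :=
  Nat.Partition.ext (eq_of_cols_eq (fun _ => p.parts_pos) (fun _ => q.parts_pos) h)

/-- The sum of the squares of the elements, a quantity which every move decreases. -/
def sumSq (s : Multiset ℕ) : ℕ := (s.map (· ^ 2)).sum

lemma sumSq_add (s t : Multiset ℕ) : sumSq (s + t) = sumSq s + sumSq t := by simp [sumSq]

lemma sumSq_filter_pos (s : Multiset ℕ) : sumSq (s.filter (0 < ·)) = sumSq s := by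
  induction s using Multiset.induction with
  | empty => simp
  | cons a s ih =>
    by_cases h : 0 < a
    · rw [Multiset.filter_cons_of_pos _ h]; simpa [sumSq] using ih
    · rw [Multiset.filter_cons_of_neg _ h, ih]
      obtain rfl : a = 0 := by omega
      simp [sumSq]

lemma count_filter_pos (s : Multiset ℕ) {k : ℕ} (hk : k ≠ 0) :
    (s.filter (0 < ·)).count k = s.count k :=
  Multiset.count_filter_of_pos (by omega)

lemma BasicMove.sum_eq {s t : Multiset ℕ} (h : BasicMove s t) : s.sum = t.sum := by
  cases h <;> simp <;> omega

lemma BasicMove.sumSq_lt {s t : Multiset ℕ} (h : BasicMove s t) : sumSq t < sumSq s := by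
  cases h with
  | move1 m k hk => simp [sumSq]; nlinarith
  | move2 n m h =>
    obtain ⟨n, rfl⟩ : ∃ n', n = n' + 1 := ⟨n - 1, by omega⟩
    simp [sumSq, show 2 * (n + 1) - 1 = 2 * n + 1 by omega]; nlinarith
  | move3 n m hm h =>
    obtain ⟨m, rfl⟩ : ∃ m', m = m' + 1 := ⟨m - 1, by omega⟩
    obtain ⟨n, rfl⟩ : ∃ n', n = n' + 1 := ⟨n - 1, by omega⟩
    have h' : 2 * m + 2 ≤ n := by omega
    simp [sumSq, show 2 * (m + 1) - 1 = 2 * m + 1 by omega]; nlinarith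
  | move4 n m h =>
    obtain ⟨n, rfl⟩ : ∃ n', n = n' + 1 := ⟨n - 1, by omega⟩
    simp [sumSq]; nlinarith

lemma BasicMove.even_count {s t : Multiset ℕ} (h : BasicMove s t) {k : ℕ} (hk : Even k) :
    Even (s.count k) ∧ Even (t.count k) := by
  rw [Nat.even_iff] at hk
  simp only [Nat.even_iff]
  cases h <;> simp only [Multiset.insert_eq_cons, Multiset.count_cons,
      Multiset.count_singleton] <;> constructor <;> split_ifs <;> omega

lemma Move.cols_add {N : ℕ} {p q : N.Partition} (h : Move p q) : ∃ s t, BasicMove s t ∧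
    ∀ k, cols q.parts k + cols s k = cols p.parts k + cols t k := by
  obtain ⟨s, t, rest, hm, hp, hq⟩ := h
  refine ⟨s, t, hm, fun k => ?_⟩
  rw [hp, hq, cols_filter_pos, cols_filter_pos, OrthAccess.cols_add, OrthAccess.cols_add]
  omega

lemma Move.sumSq_lt {N : ℕ} {p q : N.Partition} (h : Move p q) :
    sumSq q.parts < sumSq p.parts := by
  obtain ⟨s, t, rest, hm, hp, hq⟩ := h
  rw [hp, hq, sumSq_filter_pos, sumSq_filter_pos, sumSq_add, sumSq_add]
  have := hm.sumSq_lt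
  omega

lemma Move.isOrthogonal {N : ℕ} {p q : N.Partition} (h : Move p q) (hp : IsOrthogonal p) :
    IsOrthogonal q := by
  obtain ⟨s, t, rest, hm, hps, hqs⟩ := h
  intro k hk
  rcases eq_or_ne k 0 with rfl | h0
  · rw [Multiset.count_eq_zero.2 fun h0 => (q.parts_pos h0).ne rfl]; exact Even.zero
  have := hp k hk
  rw [hps, count_filter_pos _ h0, Multiset.count_add, Nat.even_add] at this
  rw [hqs, count_filter_pos _ h0, Multiset.count_add, Nat.even_add]
  simp only [hm.even_count hk, true_iff] at this ⊢
  exact this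

/-- A move is possible as soon as its positive source parts are parts of `p`; it changes the columns
by the difference of those of its target and its source. -/
lemma exists_move {N : ℕ} (p : N.Partition) {s t : Multiset ℕ} (h : BasicMove s t)
    (hs : s.filter (0 < ·) ≤ p.parts) : ∃ p', Move p p' ∧
      ∀ k, cols p'.parts k + cols s k = cols p.parts k + cols t k := by
  obtain ⟨rest, hr⟩ := Multiset.le_iff_exists_add.1 hs
  have hrest : rest.filter (0 < ·) = rest := Multiset.filter_eq_self.2 fun a ha =>
    p.parts_pos (by rw [hr]; exact Multiset.mem_add.2 (Or.inr ha))
  have hp : p.parts = (s + rest).filter (0 < ·) := by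
    rw [Multiset.filter_add, hrest, hr]
  have hsum : ((t + rest).filter (0 < ·)).sum = N := by
    have h0 : ∀ m : Multiset ℕ, (m.filter (0 < ·)).sum = m.sum := fun m => by
      induction m using Multiset.induction with
      | empty => simp
      | cons a m ih =>
        by_cases h : 0 < a
        · rw [Multiset.filter_cons_of_pos _ h]; simpa using ih
        · rw [Multiset.filter_cons_of_neg _ h, ih]
          obtain rfl : a = 0 := by omega
          simp
    have := p.parts_sum
    rw [hp, h0, Multiset.sum_add, h.sum_eq] at this
    rw [h0, Multiset.sum_add, this]
  let p' : N.Partition :=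
    { parts := (t + rest).filter (0 < ·)
      parts_pos := fun h => (Multiset.mem_filter.1 h).2
      parts_sum := hsum }
  refine ⟨p', ⟨s, t, rest, h, hp, rfl⟩, fun k => ?_⟩
  rw [show p'.parts = (t + rest).filter (0 < ·) from rfl, hp, cols_filter_pos, cols_filter_pos,
    cols_add, cols_add]
  omega

/-- The columns of `p` with index up to `b` are at most those of `q`, the later ones at least
those of `q`. For partitions of the same number, the passage from `p` to `q` then moves boxes from
columns beyond `b` to columns up to `b`. -/
def Pivot {N : ℕ} (b : ℕ) (p q : N.Partition) : Prop :=
  (∀ k < b, cols p.parts k ≤ cols q.parts k) ∧ ∀ k, b ≤ k → cols q.parts k ≤ cols p.parts k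

/-- Some move leads from `p` to a partition which still pivots to `q` at `b`. -/
def HasStep {N : ℕ} (b : ℕ) (p q : N.Partition) : Prop := ∃ p', Move p p' ∧ Pivot b p' q

/-! ### Moves preserving the pivot relation -/

section Steps

variable {N b : ℕ} {p q : N.Partition}

lemma filter_le_of_count {s t : Multiset ℕ} (h : ∀ a, a ≠ 0 → s.count a ≤ t.count a) :
    s.filter (0 < ·) ≤ t := by
  rw [Multiset.le_iff_count]
  intro a
  rcases eq_or_ne a 0 with rfl | ha
  · simp
  · rw [count_filter_pos _ ha]; exact h a ha

/-- A move of type 1 raises columns in an initial part of `[v, u)` and lowers those in the rest, by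
one each; so it is enough to have a strict inequality throughout `[v, u)`. -/
lemma Pivot.hasStep_move1 (h : Pivot b p q) {u v : ℕ} (hu : Odd u) (hv : Odd v) (hvu : v < u)
    (hup : u ∈ p.parts) (hvp : v ∈ p.parts)
    (hl : ∀ k, v ≤ k → k < u → k < b → cols p.parts k + 1 ≤ cols q.parts k)
    (hr : ∀ k, v ≤ k → k < u → b ≤ k → cols q.parts k + 1 ≤ cols p.parts k) :
    HasStep b p q := by
  obtain ⟨m, rfl⟩ := hv
  obtain ⟨m', rfl⟩ := hu
  obtain ⟨k, rfl⟩ : ∃ k, m' = m + k := ⟨m' - m, by omega⟩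
  rw [← Multiset.one_le_count_iff_mem] at hup hvp
  rw [show 2 * (m + k) + 1 = 2 * m + 1 + 2 * k by ring] at *
  obtain ⟨p', hp', hc⟩ := exists_move p (BasicMove.move1 m k (by omega)) (by
    apply filter_le_of_count
    intro a _
    simp only [Multiset.insert_eq_cons, Multiset.count_cons, Multiset.count_singleton]
    split_ifs with h1 h2 h2
    · omega
    · subst h1; omega
    · subst h2; omega
    · omega)
  refine ⟨p', hp', fun j hj => ?_, fun j hj => ?_⟩
  all_goals
    have h0 := hc j
    have h1 := h.1 j
    have h2 := h.2 j
    have h3 := hl j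
    have h4 := hr j
    simp only [cols_insert, cols_singleton] at h0
    split_ifs at h0 <;> omega

/-- A move of type 2 lowers the last two columns of the part `f` by one and raises the column which
follows a pair of parts `d` by two. -/
lemma Pivot.hasStep_move2 (h : Pivot b p q) {f d : ℕ} (hf : Odd f) (hdf : d + 2 ≤ f)
    (hfp : f ∈ p.parts) (hdp : d = 0 ∨ 2 ≤ p.parts.count d) (hfb : b + 1 ≤ f)
    (h1 : cols q.parts (f - 1) + 1 ≤ cols p.parts (f - 1))
    (h2 : b ≤ f - 2 → cols q.parts (f - 2) + 1 ≤ cols p.parts (f - 2))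
    (h3 : b ≤ d ∨ cols p.parts d + 2 ≤ cols q.parts d) : HasStep b p q := by
  obtain ⟨n, rfl⟩ := hf
  rw [← Multiset.one_le_count_iff_mem] at hfp
  obtain ⟨p', hp', hc⟩ := exists_move p (BasicMove.move2 n d (by omega)) (by
    apply filter_le_of_count
    intro a ha
    simp only [Multiset.insert_eq_cons, Multiset.count_cons, Multiset.count_singleton]
    split_ifs with h1 h2 h2
    · omega
    · subst h1; omega
    · subst h2; omega
    · omega)
  refine ⟨p', hp', fun j hj => ?_, fun j hj => ?_⟩
  all_goals
    have h0 := hc j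
    have h1' := h.1 j
    have h2' := h.2 j
    simp only [cols_insert, cols_singleton] at h0
    rcases eq_or_ne j (2 * n + 1 - 1) with rfl | hj1
    · split_ifs at h0 <;> omega
    rcases eq_or_ne j (2 * n + 1 - 2) with rfl | hj2
    · rcases eq_or_ne (2 * n + 1 - 2) d with rfl | hj3 <;> split_ifs at h0 <;> omega
    rcases eq_or_ne j d with rfl | hj3 <;> split_ifs at h0 <;> omega

/-- A move of type 3 raises the two columns which follow the part `e` by one and lowers the last
column of a pair of parts `d` by two. -/
lemma Pivot.hasStep_move3 (h : Pivot b p q) {e d : ℕ} (he : Odd e) (hed : e + 2 ≤ d)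
    (hep : e ∈ p.parts) (hdp : 2 ≤ p.parts.count d) (heb : e < b)
    (h1 : cols p.parts e + 1 ≤ cols q.parts e)
    (h2 : e + 1 < b → cols p.parts (e + 1) + 1 ≤ cols q.parts (e + 1))
    (h3 : d ≤ b ∨ cols q.parts (d - 1) + 2 ≤ cols p.parts (d - 1)) : HasStep b p q := by
  obtain ⟨n, rfl⟩ := he
  rw [← Multiset.one_le_count_iff_mem] at hep
  obtain ⟨p', hp', hc⟩ := exists_move p (BasicMove.move3 d (n + 1) (by omega) (by omega)) (by
    apply filter_le_of_count
    intro a ha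
    simp only [Multiset.insert_eq_cons, Multiset.count_cons, Multiset.count_singleton,
      show 2 * (n + 1) - 1 = 2 * n + 1 by omega]
    split_ifs with h1 h2 h2
    · omega
    · subst h1; omega
    · subst h2; omega
    · omega)
  refine ⟨p', hp', fun j hj => ?_, fun j hj => ?_⟩
  all_goals
    have h0 := hc j
    have h1' := h.1 j
    have h2' := h.2 j
    simp only [cols_insert, cols_singleton, show 2 * (n + 1) - 1 = 2 * n + 1 by omega] at h0
    rcases eq_or_ne j (2 * n + 1) with rfl | hj1
    · split_ifs at h0 <;> omega
    rcases eq_or_ne j (2 * n + 1 + 1) with rfl | hj2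
    · rcases eq_or_ne (2 * n + 1 + 1) (d - 1) with hd | hj3
      · rw [← hd] at h3
        split_ifs at h0 <;> omega
      · split_ifs at h0 <;> omega
    rcases eq_or_ne j (d - 1) with rfl | hj3 <;> split_ifs at h0 <;> omega

/-- A move of type 4 raises the column which follows a pair of parts `e` by two and lowers the last
column of a pair of parts `f` by two. -/
lemma Pivot.hasStep_move4 (h : Pivot b p q) {e f : ℕ} (hef : e + 2 ≤ f)
    (hep : e = 0 ∨ 2 ≤ p.parts.count e) (hfp : 2 ≤ p.parts.count f) (heb : e < b) (hfb : b < f)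
    (h1 : cols p.parts e + 2 ≤ cols q.parts e)
    (h2 : cols q.parts (f - 1) + 2 ≤ cols p.parts (f - 1)) : HasStep b p q := by
  obtain ⟨p', hp', hc⟩ := exists_move p (BasicMove.move4 f e (by omega)) (by
    apply filter_le_of_count
    intro a ha
    simp only [Multiset.insert_eq_cons, Multiset.count_cons, Multiset.count_singleton]
    split_ifs with h1 h2 h2
    · omega
    · subst h1; omega
    · subst h2; omega
    · omega)
  refine ⟨p', hp', fun j hj => ?_, fun j hj => ?_⟩
  all_goals
    have h0 := hc j
    have h1' := h.1 j
    have h2' := h.2 j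
    simp only [cols_insert, cols_singleton] at h0
    rcases eq_or_ne j e with rfl | hj1
    · split_ifs at h0 <;> omega
    rcases eq_or_ne j (f - 1) with rfl | hj3 <;> split_ifs at h0 <;> omega

end Steps

/-! ### Partitions with a pivot are joined by moves -/

section Pivot

variable {N b : ℕ} {p q : N.Partition}

lemma exists_greatest_below {S : ℕ → Prop} {x b : ℕ} (hx : S x) (hxb : x < b) :
    ∃ v, S v ∧ x ≤ v ∧ v < b ∧ ∀ w, S w → w < b → w ≤ v := by
  classical
  refine ⟨Nat.findGreatest S (b - 1), Nat.findGreatest_spec (m := x) (by omega) hx,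
    Nat.le_findGreatest (by omega) hx, ?_, fun w hw hwb => Nat.le_findGreatest (by omega) hw⟩
  have := Nat.findGreatest_le (P := S) (b - 1)
  omega

lemma exists_least_above {S : ℕ → Prop} {x b : ℕ} (hx : S x) (hxb : b < x) :
    ∃ v, S v ∧ v ≤ x ∧ b < v ∧ ∀ w, S w → b < w → v ≤ w := by
  classical
  have h : ∃ v, b < v ∧ S v := ⟨x, hxb, hx⟩
  exact ⟨Nat.find h, (Nat.find_spec h).2, Nat.find_min' h ⟨hxb, hx⟩, (Nat.find_spec h).1,
    fun w hw hwb => Nat.find_min' h ⟨hwb, hw⟩⟩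

/-- The number of parts of an orthogonal partition of `N` has the parity of `N`: the parts of each
even size come in pairs. -/
lemma IsOrthogonal.cols_zero_mod_two (hp : IsOrthogonal p) : cols p.parts 0 % 2 = N % 2 := by
  have h : ∀ n, (∑ k ∈ Finset.range (2 * n + 1), cols p.parts k) % 2 = cols p.parts 0 % 2 := by
    intro n
    induction n with
    | zero => simp
    | succ n ih =>
      rw [show 2 * (n + 1) + 1 = 2 * n + 2 + 1 by ring, Finset.sum_range_succ,
        Finset.sum_range_succ]
      have h1 : cols p.parts (2 * n + 1) = cols p.parts (2 * n + 2) + p.parts.count (2 * n + 2) :=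
        cols_eq_cols_succ_add_count p.parts (2 * n + 1)
      have h2 := hp (2 * n + 2) ⟨n + 1, by ring⟩
      rw [Nat.even_iff] at h2
      omega
  rw [← h N, sum_cols, p.parts_sum]
  intro a ha
  have := Multiset.le_sum_of_mem ha
  have := p.parts_sum
  omega

/-- A case in which two odd parts of `p` can be averaged. Put `D = cols q - cols p`, which jumps at
`k` by the difference of the multiplicities of `k` in `p` and `q`. The hypotheses say that strictly
between `e` and `f` it jumps upwards by at most one, and only at odd parts of `p`. At `b` it jumps
downwards, so `D (b - 1) ≥ 1` or `D b ≤ -1`; going from there to the odd parts of `p` nearest to `b`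
on either side, one finds two neighbouring odd parts of `p` between which `D` does not vanish. -/
lemma Pivot.hasStep_of_jumps (h : Pivot b p q) (hb : 2 ≤ q.parts.count b) {e f : ℕ}
    (he : Odd e) (hf : Odd f) (heb : e < b) (hbf : b < f) (hep : e ∈ p.parts) (hfp : f ∈ p.parts)
    (he1 : cols q.parts e = cols p.parts e + 1)
    (hf1 : cols p.parts (f - 1) = cols q.parts (f - 1) + 1)
    (hodd : ∀ k, e < k → k < f → Odd k → p.parts.count k ≤ 1)
    (heven : ∀ k, e < k → k < f → ¬ Odd k → p.parts.count k ≤ q.parts.count k)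
    (hbe : ¬ Odd b → p.parts.count b = 0) : HasStep b p q := by
  obtain ⟨D, hD⟩ : ∃ D : ℕ → ℤ, ∀ k, D k = (cols q.parts k : ℤ) - cols p.parts k :=
    ⟨_, fun _ => rfl⟩
  have hJ : ∀ k, D (k + 1) = D k + p.parts.count (k + 1) - q.parts.count (k + 1) := by
    intro k
    have h1 := cols_eq_cols_succ_add_count p.parts k
    have h2 := cols_eq_cols_succ_add_count q.parts k
    simp only [hD]
    omega
  have hDe : D e = 1 := by simp only [hD]; omega
  have hDf : D (f - 1) = -1 := by simp only [hD]; omega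
  have hneg : ∀ k, b ≤ k → D k ≤ 0 := fun k hk => by
    have := h.2 k hk; simp only [hD]; omega
  have hpos : ∀ k, k < b → 0 ≤ D k := fun k hk => by
    have := h.1 k hk; simp only [hD]; omega
  have hone : ∀ k, e < k → k < f → p.parts.count k ≤ q.parts.count k + 1 := by
    intro k h1 h2
    by_cases h3 : Odd k
    · have := hodd k h1 h2 h3; omega
    · have := heven k h1 h2 h3; omega
  -- on an interval without odd parts of `p` in its interior, `D` is antitone
  have hanti : ∀ x y, e ≤ x → y ≤ f → (∀ k, x < k → k < y → k ≠ b → Odd k → k ∉ p.parts) →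
      ∀ i j, x ≤ i → i ≤ j → j < y → D j ≤ D i := by
    intro x y hx hy hxy i j hi hij
    induction j, hij using Nat.le_induction with
    | base => intro _; exact le_rfl
    | succ j hij ih =>
      intro hj
      have h1 := ih (by omega)
      have h2 := hJ j
      have h3 : p.parts.count (j + 1) ≤ q.parts.count (j + 1) := by
        by_cases hjb : j + 1 = b
        · rw [hjb]
          have := hone b heb hbf
          by_cases hbo : Odd b
          · have := hodd b heb hbf hbo; omega
          · have := hbe hbo; omega
        by_cases hjo : Odd (j + 1)
        · rw [Multiset.count_eq_zero.2 (hxy _ (by omega) hj hjb hjo)]; omega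
        · exact heven _ (by omega) (by omega) hjo
      omega
  obtain ⟨u, ⟨huo, hup⟩, huf, hbu, humin⟩ :=
    exists_least_above (S := fun k => Odd k ∧ k ∈ p.parts) ⟨hf, hfp⟩ hbf
  obtain ⟨v, ⟨hvo, hvp⟩, hev, hvb, hvmax⟩ :=
    exists_greatest_below (S := fun k => Odd k ∧ k ∈ p.parts) ⟨he, hep⟩ heb
  have huv := hanti v u hev huf (by
    intro k h1 h2 h3 h4 h5
    rcases lt_or_gt_of_ne h3 with h6 | h6
    · have := hvmax k ⟨h4, h5⟩ h6; omega
    · have := humin k ⟨h4, h5⟩ h6; omega)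
  have hJb := hJ (b - 1)
  rw [show b - 1 + 1 = b by omega] at hJb
  have hmerge : ∀ x y, Odd x → Odd y → x < y → x ∈ p.parts → y ∈ p.parts →
      (∀ k, x ≤ k → k < y → k < b → 1 ≤ D k) → (∀ k, x ≤ k → k < y → b ≤ k → D k ≤ -1) →
      HasStep b p q := by
    intro x y hx hy hxy hxp hyp h1 h2
    refine h.hasStep_move1 hy hx hxy hyp hxp (fun k a1 a2 a3 => ?_) (fun k a1 a2 a3 => ?_)
    · have := h1 k a1 a2 a3; simp only [hD] at this; omega
    · have := h2 k a1 a2 a3; simp only [hD] at this; omega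
  have hcb : p.parts.count b ≤ 1 := by
    by_cases hbo : Odd b
    · exact hodd b heb hbf hbo
    · have := hbe hbo; omega
  by_cases hA : 1 ≤ D (b - 1)
  · by_cases hB : D b ≤ -1
    · refine hmerge v u hvo huo (by omega) hvp hup (fun k a1 a2 a3 => ?_) (fun k a1 a2 a3 => ?_)
      · have := huv k (b - 1) a1 (by omega) (by omega); omega
      · have := huv b k (by omega) a3 a2; omega
    · -- `D b = 0`: average two odd parts not exceeding `b`
      by_cases hbp : b ∈ p.parts
      · have hbo : Odd b := by
          by_contra hbo
          exact Multiset.count_eq_zero.1 (hbe hbo) hbp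
        refine hmerge v b hvo hbo hvb hvp hbp (fun k a1 a2 a3 => ?_) (fun k a1 a2 a3 => by omega)
        have := huv k (b - 1) a1 (by omega) (by omega); omega
      · have hb0 := Multiset.count_eq_zero.2 hbp
        have hDv := huv v (b - 1) le_rfl (by omega) (by omega)
        have hve : e < v := by
          rcases hev.lt_or_eq with h1 | h1
          · exact h1
          · rw [← h1] at hDv; omega
        obtain ⟨v', ⟨hvo', hvp'⟩, hev', hvb', hvmax'⟩ :=
          exists_greatest_below (S := fun k => Odd k ∧ k ∈ p.parts) ⟨he, hep⟩ hve
        refine hmerge v' v hvo' hvo hvb' hvp' hvp (fun k a1 a2 a3 => ?_)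
          (fun k a1 a2 a3 => by omega)
        have h1 := hanti v' v hev' (by omega) (by
          intro k h1 h2 h3 h4 h5
          have := hvmax' k ⟨h4, h5⟩ h2; omega) k (v - 1) a1 (by omega) (by omega)
        have h2 := hJ (v - 1)
        rw [show v - 1 + 1 = v by omega] at h2
        have := hone v hve (by omega)
        omega
  · -- `D (b - 1) = 0`: average two odd parts not smaller than `b`
    have := hpos (b - 1) (by omega)
    by_cases hbp : b ∈ p.parts
    · have hbo : Odd b := by
        by_contra hbo
        exact Multiset.count_eq_zero.1 (hbe hbo) hbp
      refine hmerge b u hbo huo hbu hbp hup (fun k a1 a2 a3 => by omega) (fun k a1 a2 a3 => ?_)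
      have := huv b k (by omega) a3 a2; omega
    · have hb0 := Multiset.count_eq_zero.2 hbp
      have hDu := huv b (u - 1) (by omega) (by omega) (by omega)
      have huf' : u < f := by
        rcases huf.lt_or_eq with h1 | h1
        · exact h1
        · rw [h1] at hDu; omega
      obtain ⟨u', ⟨huo', hup'⟩, huf'', hbu', humin'⟩ :=
        exists_least_above (S := fun k => Odd k ∧ k ∈ p.parts) ⟨hf, hfp⟩ huf'
      refine hmerge u u' huo huo' hbu' hup hup' (fun k a1 a2 a3 => by omega)
        (fun k a1 a2 a3 => ?_)
      have h1 := hanti u u' (by omega) huf'' (by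
        intro k h1 h2 h3 h4 h5
        have := humin' k ⟨h4, h5⟩ h1; omega) u k le_rfl a1 a2
      have h2 := hJ (u - 1)
      rw [show u - 1 + 1 = u by omega] at h2
      have := hone u (by omega) huf'
      omega

/-- Since `p` and `q` have the same sum, both kinds of strict inequality occur. -/
lemma Pivot.exists_ne (h : Pivot b p q) (hne : p ≠ q) :
    (∃ k, k < b ∧ cols p.parts k < cols q.parts k) ∧
      ∃ k, b ≤ k ∧ cols q.parts k < cols p.parts k := by
  have hs : ∑ k ∈ Finset.range N, cols p.parts k = ∑ k ∈ Finset.range N, cols q.parts k := by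
    rw [sum_cols_parts, sum_cols_parts]
  have key : ∀ p q : N.Partition, p ≠ q → ∑ k ∈ Finset.range N, cols p.parts k =
      ∑ k ∈ Finset.range N, cols q.parts k → ∃ k, cols p.parts k < cols q.parts k := by
    intro p q hne hs
    by_contra! hc
    have := (Finset.sum_eq_sum_iff_of_le fun k _ => hc k).1 hs.symm
    refine hne (partition_eq_of_cols_eq fun k => ?_)
    by_cases hk : k < N
    · exact (this k (Finset.mem_range.2 hk)).symm
    · rw [cols_parts_eq_zero p (by omega), cols_parts_eq_zero q (by omega)]
  obtain ⟨k, hk⟩ := key p q hne hs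
  obtain ⟨l, hl⟩ := key q p hne.symm hs.symm
  refine ⟨⟨k, ?_, hk⟩, l, ?_, hl⟩
  · by_contra hb; have := h.2 k (by omega); omega
  · by_contra hb; have := h.1 l (by omega); omega

set_option maxHeartbeats 1000000 in
/-- With `D = cols q - cols p`, let `e` be the first and `f - 1` the last index with `D ≠ 0`. Then
`p` contains `e` (unless `e = 0`) and `f`, as a pair if `|D| ≥ 2` there, while `|D| = 1` forces the
part to be odd, by orthogonality. If `|D| ≥ 2` at one of these indices, a move of type 2, 3 or 4
which involves `e` and `f` applies. Otherwise `e` and `f` are odd parts, and either one of them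
moves together with a pair of parts in between, by type 2 or 3, or there are so few such pairs that
`hasStep_of_jumps` applies; the one exception, `e = b - 1` and `f = b + 1`, is settled by averaging
`e` and `f`. -/
lemma Pivot.hasStep (hp : IsOrthogonal p) (hq : IsOrthogonal q) (h : Pivot b p q)
    (hb : 2 ≤ q.parts.count b) (hne : p ≠ q) : HasStep b p q := by
  obtain ⟨D, hD⟩ : ∃ D : ℕ → ℤ, ∀ k, D k = (cols q.parts k : ℤ) - cols p.parts k :=
    ⟨_, fun _ => rfl⟩
  have hJ : ∀ k, D (k + 1) = D k + p.parts.count (k + 1) - q.parts.count (k + 1) := by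
    intro k
    have h1 := cols_eq_cols_succ_add_count p.parts k
    have h2 := cols_eq_cols_succ_add_count q.parts k
    simp only [hD]
    omega
  have hev : ∀ k, k % 2 = 0 → p.parts.count k % 2 = 0 ∧ q.parts.count k % 2 = 0 := fun k hk =>
    ⟨Nat.even_iff.1 (hp k (Nat.even_iff.2 hk)), Nat.even_iff.1 (hq k (Nat.even_iff.2 hk))⟩
  have hneg : ∀ k, b ≤ k → D k ≤ 0 := fun k hk => by
    have := h.2 k hk; simp only [hD]; omega
  have hpos : ∀ k, k < b → 0 ≤ D k := fun k hk => by
    have := h.1 k hk; simp only [hD]; omega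
  obtain ⟨⟨k₁, hk₁, hk₁'⟩, k₂, hk₂, hk₂'⟩ := h.exists_ne hne
  -- `e` is the first and `f - 1` the last index with `D ≠ 0`
  obtain ⟨e, he, hek, hemin⟩ : ∃ e, D e ≠ 0 ∧ e ≤ k₁ ∧ ∀ w, D w ≠ 0 → e ≤ w := by
    classical
    have hex : ∃ k, D k ≠ 0 := ⟨k₁, by simp only [hD]; omega⟩
    exact ⟨Nat.find hex, Nat.find_spec hex, Nat.find_min' hex (by simp only [hD]; omega),
      fun w hw => Nat.find_min' hex hw⟩
  obtain ⟨f', hf, hkf, hfN, hfmax⟩ := exists_greatest_below (S := fun k => D k ≠ 0) (x := k₂)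
    (b := N + k₂ + 1) (by simp only [hD]; omega) (by omega)
  obtain ⟨f, hff, hf1⟩ : ∃ f, f' = f - 1 ∧ 1 ≤ f := ⟨f' + 1, by omega, by omega⟩
  subst hff
  have hDf0 : D f = 0 := by
    by_contra hc
    by_cases hfN' : f < N + k₂ + 1
    · have := hfmax f hc hfN'; omega
    · apply hc
      simp only [hD]
      rw [cols_parts_eq_zero p (by omega), cols_parts_eq_zero q (by omega)]; simp
  have hDe : 1 ≤ D e := by have := hpos e (by omega); omega
  have hDf : D (f - 1) ≤ -1 := by have := hneg (f - 1) (by omega); omega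
  have hJf := hJ (f - 1)
  rw [show f - 1 + 1 = f by omega, hDf0] at hJf
  have hJe : 1 ≤ e → D e = p.parts.count e - q.parts.count e := by
    intro he1
    have h1 : D (e - 1) = 0 := by
      by_contra hc; have := hemin _ hc; omega
    have := hJ (e - 1)
    rw [show e - 1 + 1 = e by omega, h1] at this
    omega
  have heo : D e % 2 = 1 → Odd e := by
    intro h1
    rw [Nat.odd_iff]
    by_contra h2
    rcases Nat.eq_zero_or_pos e with h3 | h3
    · have h4 := hp.cols_zero_mod_two
      have h5 := hq.cols_zero_mod_two
      simp only [h3, hD] at h1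
      omega
    · have := hJe h3
      have := hev e (by omega)
      omega
  have hfo : D (f - 1) % 2 = 1 → Odd f := by
    intro h1
    rw [Nat.odd_iff]
    by_contra h2
    have := hev f (by omega)
    omega
  have hep : 1 ≤ e → e ∈ p.parts := fun h1 => by
    rw [← Multiset.one_le_count_iff_mem]; have := hJe h1; omega
  have hfp : f ∈ p.parts := by
    rw [← Multiset.one_le_count_iff_mem]; omega
  have hf2 : D (f - 1) = -1 → b ≤ f - 2 → D (f - 2) ≤ -1 := by
    intro h1 h2
    have h3 := hfo (by omega)
    rw [Nat.odd_iff] at h3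
    have h4 := hJ (f - 2)
    rw [show f - 2 + 1 = f - 1 by omega] at h4
    have h5 := hev (f - 1) (by omega)
    have h6 := hneg (f - 2) h2
    omega
  have he2 : D e = 1 → e + 1 < b → 1 ≤ D (e + 1) := by
    intro h1 h2
    have h3 := heo (by omega)
    rw [Nat.odd_iff] at h3
    have h4 := hJ e
    have h5 := hev (e + 1) (by omega)
    have h6 := hpos (e + 1) h2
    omega
  have toNat1 : ∀ k (c : ℕ), (c : ℤ) ≤ D k → cols p.parts k + c ≤ cols q.parts k := by
    intro k c hc; simp only [hD] at hc; omega
  have toNat2 : ∀ k (c : ℕ), D k ≤ -(c : ℤ) → cols q.parts k + c ≤ cols p.parts k := by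
    intro k c hc; simp only [hD] at hc; omega
  have hpair : 2 ≤ D e → e = 0 ∨ 2 ≤ p.parts.count e := fun h1 => by
    rcases Nat.eq_zero_or_pos e with h3 | h3
    · exact Or.inl h3
    · have := hJe h3; right; omega
  by_cases hDe2 : 2 ≤ D e
  · by_cases hDf2 : D (f - 1) ≤ -2
    · exact h.hasStep_move4 (by omega) (hpair hDe2) (by omega) (by omega) (by omega)
        (toNat1 _ _ hDe2) (toNat2 _ _ hDf2)
    · exact h.hasStep_move2 (hfo (by omega)) (by omega) hfp (hpair hDe2) (by omega)
        (toNat2 _ _ (by push_cast; omega))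
        (fun h1 => toNat2 _ _ (hf2 (by omega) h1)) (Or.inr (toNat1 _ _ hDe2))
  have hDe1 : D e = 1 := by omega
  have heodd := heo (by omega)
  have hepos : 1 ≤ e := by rw [Nat.odd_iff] at heodd; omega
  by_cases hDf2 : D (f - 1) ≤ -2
  · exact h.hasStep_move3 heodd (by omega) (hep hepos) (by omega) (by omega)
      (toNat1 _ _ (by push_cast; omega)) (fun h1 => toNat1 _ _ (he2 hDe1 h1))
      (Or.inr (toNat2 _ _ hDf2))
  have hDf1 : D (f - 1) = -1 := by omega
  have hfodd := hfo (by omega)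
  -- both extreme values of `D` are `±1`; a pair of parts of `p` in between gives a move
  have move2 : ∀ d, d + 2 ≤ f → 2 ≤ p.parts.count d → (b ≤ d ∨ 2 ≤ D d) → HasStep b p q :=
    fun d h1 h2 h3 => h.hasStep_move2 hfodd h1 hfp (Or.inr h2) (by omega)
      (toNat2 _ _ (by push_cast; omega))
      (fun h1 => toNat2 _ _ (hf2 hDf1 h1)) (h3.imp id fun h4 => toNat1 _ _ h4)
  have move3 : ∀ d, e + 2 ≤ d → 2 ≤ p.parts.count d → (d ≤ b ∨ D (d - 1) ≤ -2) →
      HasStep b p q :=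
    fun d h1 h2 h3 => h.hasStep_move3 heodd h1 (hep hepos) h2 (by omega)
      (toNat1 _ _ (by push_cast; omega)) (fun h1 => toNat1 _ _ (he2 hDe1 h1))
      (h3.imp id fun h4 => toNat2 _ _ h4)
  by_contra hno
  have c2 : ∀ d, d + 2 ≤ f → (b ≤ d ∨ 2 ≤ D d) → p.parts.count d ≤ 1 := by
    intro d h1 h2; by_contra h3; exact hno (move2 d h1 (by omega) h2)
  have c3 : ∀ d, e + 2 ≤ d → (d ≤ b ∨ D (d - 1) ≤ -2) → p.parts.count d ≤ 1 := by
    intro d h1 h2; by_contra h3; exact hno (move3 d h1 (by omega) h2)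
  rw [Nat.odd_iff] at heodd hfodd
  refine hno (h.hasStep_of_jumps hb (Nat.odd_iff.2 heodd) (Nat.odd_iff.2 hfodd) (by omega)
    (by omega) (hep hepos) hfp (by simp only [hD] at hDe1; omega)
    (by simp only [hD] at hDf1; omega) ?_ ?_ ?_)
  · intro k h1 h2 h3
    rw [Nat.odd_iff] at h3
    rcases le_total b k with h4 | h4
    · exact c2 k (by omega) (Or.inl h4)
    · exact c3 k (by omega) (Or.inl h4)
  · intro k h1 h2 h3
    rw [Nat.odd_iff] at h3
    have h5 := hev k (by omega)
    have h6 := hJ (k - 1)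
    rw [show k - 1 + 1 = k by omega] at h6
    rcases le_total b k with h4 | h4
    · by_cases h7 : k + 2 ≤ f
      · have := c2 k h7 (Or.inl h4); omega
      · obtain rfl : k = f - 1 := by omega
        rcases h4.lt_or_eq with h8 | h8
        · by_contra h9
          have := c3 (f - 1) (by omega) (Or.inr (by omega))
          omega
        · have := hpos (f - 1 - 1) (by omega)
          omega
    · by_cases h7 : e + 2 ≤ k
      · have := c3 k h7 (Or.inl h4); omega
      · obtain rfl : k = e + 1 := by omega
        rw [Nat.add_sub_cancel] at h6
        by_contra h9
        rcases h4.lt_or_eq with h8 | h8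
        · have := c2 (e + 1) (by omega) (Or.inr (by omega))
          omega
        · have := hneg (e + 1) (by omega)
          omega
  · intro h3
    rw [Nat.odd_iff] at h3
    have h5 := hev b (by omega)
    by_cases h7 : b + 2 ≤ f
    · have := c2 b h7 (Or.inl le_rfl); omega
    · by_cases h8 : e + 2 ≤ b
      · have := c3 b h8 (Or.inl le_rfl); omega
      · exfalso
        exact hno (h.hasStep_move1 (Nat.odd_iff.2 hfodd) (Nat.odd_iff.2 heodd) (by omega) hfp
          (hep hepos)
          (fun k a1 a2 a3 => toNat1 _ 1 (by
            obtain rfl : k = e := by omega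
            push_cast; omega))
          (fun k a1 a2 a3 => toNat2 _ 1 (by
            obtain rfl : k = f - 1 := by omega
            push_cast; omega)))

/-- Combinatorial criterion: if `q` has a repeated part `b` and is obtained from `p` by moving boxes
from columns beyond `b` to columns up to `b`, then `q` is reached from `p` by moves. -/
theorem Pivot.reflTransGen_move (hp : IsOrthogonal p) (hq : IsOrthogonal q) (h : Pivot b p q)
    (hb : 2 ≤ q.parts.count b) : Relation.ReflTransGen Move p q := by
  induction hn : sumSq p.parts using Nat.strong_induction_on generalizing p with
  | _ n ih =>
    by_cases hne : p = q
    · rw [hne]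
    obtain ⟨p', hm, h'⟩ := h.hasStep hp hq hb hne
    exact Relation.ReflTransGen.head hm
      (ih _ (hn ▸ hm.sumSq_lt) (hm.isOrthogonal hp) h' rfl)

end Pivot

/-! ### Ranks and projections -/

section Projections

open Module

variable {κ V : Type*} [Field κ] [AddCommGroup V] [Module κ V]

/-- The rank of an endomorphism, as a natural number. -/
noncomputable def rk (f : Module.End κ V) : ℕ := finrank κ (LinearMap.range f)

lemma finrank_map_add_finrank_inf_ker [FiniteDimensional κ V] (g : Module.End κ V)
    (S : Submodule κ V) :
    finrank κ (S.map g) + finrank κ (S ⊓ LinearMap.ker g : Submodule κ V) = finrank κ S := by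
  have h := LinearMap.finrank_range_add_finrank_ker (g.domRestrict S)
  rw [LinearMap.range_domRestrict] at h
  rw [← h]
  congr 1
  have : (LinearMap.ker (g.domRestrict S)).map S.subtype = S ⊓ LinearMap.ker g := by
    ext w
    simp only [Submodule.mem_map, LinearMap.mem_ker, Submodule.mem_inf, Submodule.subtype_apply,
      LinearMap.domRestrict_apply]
    constructor
    · rintro ⟨a, ha, rfl⟩; exact ⟨a.2, ha⟩
    · rintro ⟨h1, h2⟩; exact ⟨⟨w, h1⟩, h2, rfl⟩
  rw [← this, LinearEquiv.finrank_eq (Submodule.equivMapOfInjective _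
    S.injective_subtype _)]

/-- Splitting the rank along an idempotent. -/
lemma rk_eq_add_of_idempotent [FiniteDimensional κ V] {E f : Module.End κ V} (hE : E * E = E) :
    rk f = rk ((1 - E) * f) +
      finrank κ (LinearMap.range f ⊓ LinearMap.range E : Submodule κ V) := by
  have h := finrank_map_add_finrank_inf_ker (1 - E) (LinearMap.range f)
  have hk : LinearMap.ker (1 - E) = LinearMap.range E := by
    ext w
    simp only [LinearMap.mem_ker, LinearMap.mem_range, LinearMap.sub_apply, Module.End.one_apply]
    constructor
    · intro h; exact ⟨w, (sub_eq_zero.1 h).symm⟩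
    · rintro ⟨a, rfl⟩; rw [← Module.End.mul_apply, hE, sub_self]
  rw [hk, ← LinearMap.range_comp] at h
  exact h.symm

lemma range_inf_range_of_commute {E f : Module.End κ V} (hE : E * E = E) (hc : E * f = f * E) :
    (LinearMap.range f ⊓ LinearMap.range E : Submodule κ V) = LinearMap.range (f * E) := by
  ext w
  constructor
  · rintro ⟨⟨a, rfl⟩, ⟨c, hc'⟩⟩
    refine ⟨a, ?_⟩
    rw [← hc, Module.End.mul_apply, ← hc', ← Module.End.mul_apply, hE]
  · rintro ⟨a, rfl⟩
    exact ⟨⟨E a, rfl⟩, ⟨f a, LinearMap.congr_fun hc a⟩⟩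

lemma rk_eq_add_of_commute [FiniteDimensional κ V] {E f : Module.End κ V} (hE : E * E = E)
    (hc : E * f = f * E) : rk f = rk ((1 - E) * f) + rk (f * E) := by
  rw [rk_eq_add_of_idempotent hE, range_inf_range_of_commute hE hc]; rfl

/-- Replacing `x` by the block diagonal `x₁` for an `x`-stable subspace `W = range E` on which `x`
is a single Jordan block of size `b` raises the columns up to `b` and lowers those beyond. The
reason is that `rank x ^ k - rank x₁ ^ k = dim (x ^ k V ∩ W) - dim (x ^ k W)`. -/
theorem rk_pow_of_cyclic_sub [FiniteDimensional κ V] {x x₁ E : Module.End κ V} {b : ℕ}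
    (hE : E * E = E) (hx : x * E = E * x * E) (hx₁ : x₁ = E * x * E + (1 - E) * x * (1 - E))
    (hcyc : ∀ k, rk (x ^ k * E) = b - k) (k : ℕ) :
    (k < b → rk (x ^ k) + rk (x₁ ^ (k + 1)) ≤ rk (x ^ (k + 1)) + rk (x₁ ^ k)) ∧
      (b ≤ k → rk (x ^ (k + 1)) + rk (x₁ ^ k) ≤ rk (x ^ k) + rk (x₁ ^ (k + 1))) := by
  have hE' : E * (1 - E) = 0 := by rw [mul_sub, mul_one, hE, sub_self]
  have hE'' : (1 - E) * E = 0 := by rw [sub_mul, one_mul, hE, sub_self]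
  have hF : (1 - E) * (1 - E) = 1 - E := by rw [mul_sub, mul_one, hE'', sub_zero]
  have e1 : E * x₁ = x₁ * E := by
    rw [hx₁, mul_add, add_mul, mul_assoc (1 - E) x, ← mul_assoc E (1 - E), hE',
      mul_assoc (1 - E), mul_assoc x, hE'', ← mul_assoc, ← mul_assoc, hE, mul_assoc _ E E, hE]
    simp
  have e1k : ∀ k, E * x₁ ^ k = x₁ ^ k * E := fun k =>
    ((show Commute E x₁ from e1).pow_right k).eq
  have e2 : x₁ * E = x * E := by
    rw [hx₁, add_mul, mul_assoc (E * x), hE, mul_assoc _ (1 - E) E, hE'', mul_zero, add_zero, hx]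
  have e3 : ∀ k, x₁ ^ k * E = x ^ k * E := by
    intro k
    induction k with
    | zero => simp
    | succ k ih =>
      have hx' : E * (x * E) = x * E := by rw [← mul_assoc]; exact hx.symm
      calc x₁ ^ (k + 1) * E = x₁ ^ k * (x * E) := by rw [pow_succ, mul_assoc, e2]
        _ = x₁ ^ k * E * (x * E) := by rw [mul_assoc, hx']
        _ = x ^ k * (E * (x * E)) := by rw [ih, mul_assoc]
        _ = x ^ (k + 1) * E := by rw [hx', ← mul_assoc, ← pow_succ]
  have e4 : (1 - E) * x = (1 - E) * x₁ := by
    rw [hx₁, mul_add, ← mul_assoc, ← mul_assoc, ← mul_assoc, ← mul_assoc, hE'', hF]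
    simp only [zero_mul, zero_add]
    rw [mul_sub, mul_one, mul_assoc _ x E, hx, ← mul_assoc, ← mul_assoc, hE'']
    simp
  have e5 : ∀ k, (1 - E) * x ^ k = (1 - E) * x₁ ^ k := by
    intro k
    have hcomm : (1 - E) * x₁ = x₁ * (1 - E) := by rw [sub_mul, mul_sub, e1]; simp
    induction k with
    | zero => simp
    | succ k ih =>
      calc (1 - E) * x ^ (k + 1) = (1 - E) * x₁ * x ^ k := by rw [pow_succ', ← mul_assoc, e4]
        _ = x₁ * ((1 - E) * x₁ ^ k) := by rw [hcomm, mul_assoc, ih]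
        _ = _ := by rw [← mul_assoc, ← hcomm, mul_assoc, ← pow_succ']
  set W := LinearMap.range E with hW
  set a : ℕ → ℕ := fun k => finrank κ (LinearMap.range (x ^ k) ⊓ W : Submodule κ V) with ha
  have hr : ∀ k, rk (x ^ k) = rk ((1 - E) * x₁ ^ k) + a k := fun k => by
    rw [rk_eq_add_of_idempotent hE, e5]
  have hr₁ : ∀ k, rk (x₁ ^ k) = rk ((1 - E) * x₁ ^ k) + (b - k) := fun k => by
    rw [rk_eq_add_of_commute hE (e1k k), e3, hcyc]
  have hanti : a (k + 1) ≤ a k := by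
    apply Submodule.finrank_mono
    refine inf_le_inf_right _ ?_
    rw [pow_succ]
    exact LinearMap.range_comp_le_range _ _
  have hstep : 1 ≤ b → a k ≤ a (k + 1) + 1 := by
    intro hb
    have h1 := finrank_map_add_finrank_inf_ker x (LinearMap.range (x ^ k) ⊓ W)
    have h2 := finrank_map_add_finrank_inf_ker x W
    have h3 : finrank κ W = b := by
      have := hcyc 0; rw [pow_zero, one_mul] at this; exact this
    have h4 : finrank κ (W.map x) = b - 1 := by
      have := hcyc 1
      rw [pow_one] at this
      rw [hW, ← LinearMap.range_comp]; exact this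
    have h5 : finrank κ ((LinearMap.range (x ^ k) ⊓ W).map x) ≤ a (k + 1) := by
      apply Submodule.finrank_mono
      rintro _ ⟨w, ⟨⟨c, rfl⟩, ⟨d, hd⟩⟩, rfl⟩
      refine ⟨⟨c, by rw [pow_succ']; rfl⟩, ⟨x (E d), ?_⟩⟩
      rw [← hd, ← Module.End.mul_apply, ← Module.End.mul_apply, ← Module.End.mul_apply, ← hx]
    have h6 : finrank κ ((LinearMap.range (x ^ k) ⊓ W) ⊓ LinearMap.ker x : Submodule κ V) ≤
        finrank κ (W ⊓ LinearMap.ker x : Submodule κ V) :=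
      Submodule.finrank_mono (inf_le_inf_right _ inf_le_right)
    simp only [ha] at *
    omega
  rw [hr, hr, hr₁, hr₁]
  constructor
  · intro hk
    have := hstep (by omega)
    omega
  · intro hk
    omega

lemma linearIndependent_pow_apply {y : Module.End κ V} {v : V} {b : ℕ} (h0 : (y ^ b) v = 0)
    (h1 : (y ^ (b - 1)) v ≠ 0) : LinearIndependent κ fun j : Fin b => (y ^ (j : ℕ)) v := by
  have hz : ∀ m, b ≤ m → (y ^ m) v = 0 := fun m hm => by
    obtain ⟨c, rfl⟩ := Nat.exists_eq_add_of_le' hm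
    rw [pow_add, Module.End.mul_apply, h0, map_zero]
  rw [Fintype.linearIndependent_iff]
  intro g hg
  have key : ∀ i : ℕ, ∀ hi : i < b, g ⟨i, hi⟩ = 0 := by
    intro i
    induction i using Nat.strong_induction_on with
    | _ i ih =>
      intro hi
      have h2 := congrArg (y ^ (b - 1 - i)) hg
      rw [map_sum, map_zero, Finset.sum_eq_single ⟨i, hi⟩] at h2
      · rw [map_smul, ← Module.End.mul_apply, ← pow_add] at h2
        simp only [show b - 1 - i + i = b - 1 by omega] at h2
        exact (smul_eq_zero.1 h2).resolve_right h1
      · intro j _ hj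
        rcases lt_trichotomy (j : ℕ) i with h | h | h
        · rw [show g j = 0 from ih j h j.2, zero_smul, map_zero]
        · exact absurd (Fin.ext h) hj
        · rw [map_smul, ← Module.End.mul_apply, ← pow_add, hz _ (by omega), smul_zero]
      · simp
  exact fun i => key i i.2

/-- A Jordan block of maximal size splits off: if `y` is nilpotent on the range of an idempotent `P`
commuting with it, then some nonzero idempotent `E` below `P` commutes with `y`, and `y` is a single
Jordan block, generated by a vector `v`, on the range of `E`. With `φ` a functional dual to
`y ^ (b - 1) v`, the projection is `u ↦ ∑ j, φ (y ^ (b - 1 - j) (P u)) • y ^ j v`. -/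
theorem exists_cyclic_projection {y P : Module.End κ V} (hP : P * P = P)
    (hc : y * P = P * y) (hne : P ≠ 0) (hnil : ∃ n, y ^ n * P = 0) :
    ∃ (b : ℕ) (E : Module.End κ V) (v : V), 1 ≤ b ∧ E * E = E ∧ P * E = E ∧ E * P = E ∧
      y * E = E * y ∧ (∀ k, rk (y ^ k * E) = b - k) ∧ (y ^ b) v = 0 ∧
      LinearMap.range E = Submodule.span κ (Set.range fun j : Fin b => (y ^ (j : ℕ)) v) := by
  classical
  obtain ⟨b, hb0, hbmin⟩ : ∃ b, y ^ b * P = 0 ∧ ∀ m < b, y ^ m * P ≠ 0 :=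
    ⟨Nat.find hnil, Nat.find_spec hnil, fun m hm => Nat.find_min hnil hm⟩
  have hb1 : 1 ≤ b := by
    by_contra h
    obtain rfl : b = 0 := by omega
    exact hne (by simpa using hb0)
  obtain ⟨u, hu⟩ : ∃ u, (y ^ (b - 1) * P) u ≠ 0 := by
    by_contra! h
    exact hbmin (b - 1) (by omega) (LinearMap.ext h)
  set v := P u with hv
  have hPv : P v = v := by rw [hv, ← Module.End.mul_apply, hP]
  have hcP : ∀ k, y ^ k * P = P * y ^ k := fun k =>
    ((show Commute y P from hc).pow_left k).eq
  have hz : ∀ m, b ≤ m → y ^ m * P = 0 := fun m hm => by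
    obtain ⟨c, rfl⟩ := Nat.exists_eq_add_of_le' hm
    rw [pow_add, mul_assoc, hb0, mul_zero]
  have hzv : ∀ m, b ≤ m → (y ^ m) v = 0 := fun m hm => by
    rw [hv, ← Module.End.mul_apply, hz m hm, LinearMap.zero_apply]
  have hli := linearIndependent_pow_apply (hzv b le_rfl) hu
  obtain ⟨φ, hφ⟩ := LinearMap.exists_extend ((Basis.span hli).coord ⟨b - 1, by omega⟩)
  have hφ' : ∀ m, m < b → φ ((y ^ m) v) = if m = b - 1 then 1 else 0 := by
    intro m hm
    have h2 : ((Basis.span hli ⟨m, hm⟩ : _) : V) = (y ^ m) v :=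
      congrArg Subtype.val (Basis.span_apply hli ⟨m, hm⟩)
    have h1 := LinearMap.congr_fun hφ (Basis.span hli ⟨m, hm⟩)
    rw [Basis.coord_apply, Basis.repr_self, Finsupp.single_apply] at h1
    rw [← h2]
    exact h1.trans (by simp)
  let E : Module.End κ V := ∑ j ∈ Finset.range b,
    LinearMap.smulRight (φ ∘ₗ (y ^ (b - 1 - j) * P)) ((y ^ j) v)
  have hEa : ∀ w, E w = ∑ j ∈ Finset.range b, φ ((y ^ (b - 1 - j)) (P w)) • (y ^ j) v := by
    intro w
    simp only [E, LinearMap.sum_apply, LinearMap.smulRight_apply, LinearMap.comp_apply,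
      Module.End.mul_apply]
  have hEv : ∀ i, i < b → E ((y ^ i) v) = (y ^ i) v := by
    intro i hi
    rw [hEa, ← Module.End.mul_apply P, ← hcP, Module.End.mul_apply, hPv,
      Finset.sum_eq_single i]
    · rw [← Module.End.mul_apply, ← pow_add, show b - 1 - i + i = b - 1 by omega,
        hφ' _ (by omega), if_pos rfl, one_smul]
    · intro j hj hji
      rw [Finset.mem_range] at hj
      rw [← Module.End.mul_apply, ← pow_add]
      rcases lt_or_gt_of_ne hji with h | h
      · rw [hzv _ (by omega), map_zero, zero_smul]
      · rw [hφ' _ (by omega), if_neg (by omega), zero_smul]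
    · intro h; exact absurd (Finset.mem_range.2 hi) h
  have hmem : ∀ w, E w ∈ Submodule.span κ (Set.range fun j : Fin b => (y ^ (j : ℕ)) v) := by
    intro w
    rw [hEa]
    refine Submodule.sum_mem _ fun j hj => Submodule.smul_mem _ _ (Submodule.subset_span ?_)
    exact ⟨⟨j, Finset.mem_range.1 hj⟩, rfl⟩
  have hid : ∀ w ∈ Submodule.span κ (Set.range fun j : Fin b => (y ^ (j : ℕ)) v), E w = w := by
    intro w hw
    induction hw using Submodule.span_induction with
    | mem w hw => obtain ⟨j, rfl⟩ := hw; exact hEv j j.2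
    | zero => exact map_zero _
    | add a c _ _ h1 h2 => rw [map_add, h1, h2]
    | smul a w _ h => rw [map_smul, h]
  have hrange : LinearMap.range E =
      Submodule.span κ (Set.range fun j : Fin b => (y ^ (j : ℕ)) v) := by
    apply le_antisymm
    · rintro _ ⟨w, rfl⟩; exact hmem w
    · intro w hw; exact ⟨w, hid w hw⟩
  refine ⟨b, E, v, hb1, LinearMap.ext fun w => hid _ (hmem w), LinearMap.ext fun w => ?_,
    LinearMap.ext fun w => ?_, LinearMap.ext fun w => ?_, fun k => ?_, hzv b le_rfl, hrange⟩
  · rw [Module.End.mul_apply, hEa, map_sum]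
    refine Finset.sum_congr rfl fun j _ => ?_
    rw [map_smul, ← Module.End.mul_apply P, ← hcP, Module.End.mul_apply, hPv]
  · rw [Module.End.mul_apply, hEa, hEa, ← Module.End.mul_apply P, hP]
  · rw [Module.End.mul_apply, Module.End.mul_apply, hEa, hEa, map_sum]
    obtain ⟨c, rfl⟩ : ∃ c, b = c + 1 := ⟨b - 1, by omega⟩
    rw [Finset.sum_range_succ, Finset.sum_range_succ']
    have h1 : y ((φ ((y ^ (c + 1 - 1 - c)) (P w))) • (y ^ c) v) = 0 := by
      rw [map_smul, ← Module.End.mul_apply y, ← pow_succ', hzv _ le_rfl, smul_zero]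
    have h2 : φ ((y ^ (c + 1 - 1 - 0)) (P (y w))) • (y ^ 0) v = 0 := by
      have : (y ^ (c + 1 - 1 - 0)) (P (y w)) = 0 := by
        rw [← Module.End.mul_apply P, ← hc, ← Module.End.mul_apply, ← mul_assoc, ← pow_succ,
          hz _ (by omega), LinearMap.zero_apply]
      rw [this, map_zero, zero_smul]
    rw [h1, h2, add_zero, add_zero]
    refine Finset.sum_congr rfl fun j hj => ?_
    rw [Finset.mem_range] at hj
    rw [map_smul, ← Module.End.mul_apply y, ← pow_succ', ← Module.End.mul_apply P y, ← hc,
      Module.End.mul_apply y P, ← Module.End.mul_apply _ y, ← pow_succ,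
      show c + 1 - 1 - (j + 1) + 1 = c + 1 - 1 - j by omega]
  · have h1 : LinearMap.range (y ^ k * E) =
        Submodule.span κ (Set.range fun j : Fin (b - k) => (y ^ (k + (j : ℕ))) v) := by
      rw [show y ^ k * E = (y ^ k) ∘ₗ E from rfl, LinearMap.range_comp, hrange,
        Submodule.map_span]
      apply le_antisymm
      · rw [Submodule.span_le]
        rintro _ ⟨_, ⟨j, rfl⟩, rfl⟩
        simp only [SetLike.mem_coe]
        rw [← Module.End.mul_apply, ← pow_add]
        by_cases h : k + j < b
        · exact Submodule.subset_span ⟨⟨j, by omega⟩, rfl⟩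
        · rw [hzv _ (by omega)]; exact Submodule.zero_mem _
      · rw [Submodule.span_le]
        rintro _ ⟨j, rfl⟩
        apply Submodule.subset_span
        refine ⟨_, ⟨⟨j, by omega⟩, rfl⟩, ?_⟩
        rw [← Module.End.mul_apply, ← pow_add]
    have h2 : LinearIndependent κ fun j : Fin (b - k) => (y ^ (k + (j : ℕ))) v :=
      hli.comp (fun j : Fin (b - k) => (⟨k + j, by omega⟩ : Fin b)) fun i j hij => by
        simp only [Fin.mk.injEq] at hij; exact Fin.ext (by omega)
    rw [rk, h1, finrank_span_eq_card h2, Fintype.card_fin]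

end Projections

/-! ### Ranks of matrices -/

section MatrixRank

open Matrix

variable {κ : Type*} [Field κ] {n : Type*} [Fintype n] [DecidableEq n]

lemma rank_eq_rk (A : Matrix n n κ) : A.rank = rk (Matrix.toLinAlgEquiv' A) := rfl

lemma rank_eq_zero_iff (A : Matrix n n κ) : A.rank = 0 ↔ A = 0 := by
  constructor
  · intro h
    rw [rank_eq_rk, rk, Submodule.finrank_eq_zero, LinearMap.range_eq_bot] at h
    exact (map_eq_zero_iff _ (Matrix.toLinAlgEquiv' (R := κ) (n := n)).injective).1 h
  · rintro rfl; exact Matrix.rank_zero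

lemma rank_eq_add_of_commute {E f : Matrix n n κ} (hE : E * E = E) (hc : E * f = f * E) :
    f.rank = ((1 - E) * f).rank + (f * E).rank := by
  have := rk_eq_add_of_commute (E := Matrix.toLinAlgEquiv' E) (f := Matrix.toLinAlgEquiv' f)
    (by rw [← map_mul, hE]) (by rw [← map_mul, hc, map_mul])
  rw [← map_mul, ← map_one (Matrix.toLinAlgEquiv' (R := κ) (n := n)), ← map_sub, ← map_mul] at this
  exact this

/-- The matrix form of `rk_pow_of_cyclic_sub`. -/
theorem rank_pow_of_cyclic_sub {x x₁ E : Matrix n n κ} {b : ℕ} (hE : E * E = E)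
    (hx : x * E = E * x * E) (hx₁ : x₁ = E * x * E + (1 - E) * x * (1 - E))
    (hcyc : ∀ k, (x ^ k * E).rank = b - k) (k : ℕ) :
    (k < b → (x ^ k).rank + (x₁ ^ (k + 1)).rank ≤ (x ^ (k + 1)).rank + (x₁ ^ k).rank) ∧
      (b ≤ k → (x ^ (k + 1)).rank + (x₁ ^ k).rank ≤ (x ^ k).rank + (x₁ ^ (k + 1)).rank) := by
  have := rk_pow_of_cyclic_sub (E := Matrix.toLinAlgEquiv' E) (x := Matrix.toLinAlgEquiv' x)
    (x₁ := Matrix.toLinAlgEquiv' x₁) (b := b)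
    (by rw [← map_mul, hE]) (by rw [← map_mul, hx, map_mul, map_mul])
    (by rw [hx₁]; simp only [map_add, map_mul, map_sub, map_one])
    (fun k => by rw [← map_pow, ← map_mul]; exact hcyc k) k
  simp only [← map_pow] at this
  exact this

/-- Frobenius' rank inequality. -/
lemma rank_frobenius (A B C : Matrix n n κ) :
    (A * B).rank + (B * C).rank ≤ (A * B * C).rank + B.rank := by
  have h1 := finrank_map_add_finrank_inf_ker (Matrix.toLinAlgEquiv' A)
    (LinearMap.range (Matrix.toLinAlgEquiv' B))
  have h2 := finrank_map_add_finrank_inf_ker (Matrix.toLinAlgEquiv' A)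
    (LinearMap.range (Matrix.toLinAlgEquiv' (B * C)))
  have h3 := Submodule.finrank_mono (inf_le_inf_right (LinearMap.ker (Matrix.toLinAlgEquiv' A))
    (show LinearMap.range (Matrix.toLinAlgEquiv' (B * C)) ≤
      LinearMap.range (Matrix.toLinAlgEquiv' B) by
        rw [map_mul]; exact LinearMap.range_comp_le_range _ _))
  rw [← LinearMap.range_comp] at h1 h2
  have e1 : (Matrix.toLinAlgEquiv' A : Module.End κ (n → κ)) ∘ₗ Matrix.toLinAlgEquiv' B =
    Matrix.toLinAlgEquiv' (A * B) := (map_mul _ _ _).symm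
  have e2 : (Matrix.toLinAlgEquiv' A : Module.End κ (n → κ)) ∘ₗ Matrix.toLinAlgEquiv' (B * C) =
    Matrix.toLinAlgEquiv' (A * B * C) := by rw [mul_assoc]; exact (map_mul _ _ _).symm
  rw [e1] at h1
  rw [e2] at h2
  simp only [rank_eq_rk, rk]
  omega

/-- The drops of the ranks of successive powers do not increase. -/
lemma rank_pow_convex {x E : Matrix n n κ} (hc : x * E = E * x) (k : ℕ) :
    2 * (x ^ (k + 1) * E).rank ≤ (x ^ (k + 2) * E).rank + (x ^ k * E).rank := by
  have h := rank_frobenius x (x ^ k * E) x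
  have e1 : x * (x ^ k * E) = x ^ (k + 1) * E := by rw [pow_succ', mul_assoc]
  have e2 : x ^ k * E * x = x ^ (k + 1) * E := by rw [mul_assoc, ← hc, ← mul_assoc, ← pow_succ]
  have e3 : x * (x ^ k * E) * x = x ^ (k + 2) * E := by
    rw [mul_assoc, e2, ← mul_assoc, ← pow_succ']
  rw [e3, e1, e2] at h
  omega

/-- A skew-symmetric matrix has even rank: a congruent matrix has an invertible skew-symmetric block
of that size and zeros elsewhere. -/
theorem even_rank_of_skew (h2 : (2 : κ) ≠ 0) {A : Matrix n n κ} (hA : Aᵀ = -A) : Even A.rank := by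
  obtain ⟨r, V, U, e, hr, hV, hU, hVU⟩ : ∃ (r : ℕ) (V U : Matrix n n κ)
      (e : n ≃ Fin r ⊕ Fin (Fintype.card n - r)), A.rank = r ∧ IsUnit V ∧ IsUnit U ∧
        V * A * U = (fromBlocks 1 0 0 0).submatrix e e := by
    obtain ⟨V, U, e, h⟩ := Matrix.exists_rank_normal_form A
    exact ⟨_, V, U, e, rfl, h⟩
  rw [hr]
  have hVdet := (Matrix.isUnit_iff_isUnit_det V).1 hV
  set S := V * A * Vᵀ with hS
  have hST : Sᵀ = -S := by
    simp only [hS, transpose_mul, transpose_transpose, hA, mul_assoc, Matrix.neg_mul,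
      Matrix.mul_neg]
  have hSr : S.rank = r := by
    rw [hS, Matrix.rank_mul_eq_left_of_isUnit_det _ _ (by rwa [det_transpose]),
      Matrix.rank_mul_eq_right_of_isUnit_det _ _ hVdet, hr]
  have hrow : ∀ i j, (e i).isRight → S i j = 0 := by
    intro i j hi
    obtain ⟨W, hW⟩ := hU.exists_right_inv
    have : S = V * A * U * (W * Vᵀ) := by
      rw [hS, mul_assoc (V * A), ← mul_assoc U, hW, one_mul]
    rw [this, hVU, Matrix.mul_apply]
    refine Finset.sum_eq_zero fun k _ => ?_
    rw [submatrix_apply]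
    obtain ⟨c, hc⟩ := Sum.isRight_iff.1 hi
    rw [hc]
    rcases e k with d | d <;> simp
  have hcol : ∀ i j, (e j).isRight → S i j = 0 := by
    intro i j hj
    have := congrFun (congrFun hST j) i
    rw [transpose_apply, Matrix.neg_apply, hrow j i hj, neg_zero] at this
    exact this
  set C : Matrix (Fin r) (Fin r) κ := S.submatrix (e.symm ∘ Sum.inl) (e.symm ∘ Sum.inl) with hC
  have hCT : Cᵀ = -C := by
    ext i j
    simpa [hC] using congrFun (congrFun hST (e.symm (Sum.inl i))) (e.symm (Sum.inl j))
  let G : Matrix n (Fin r) κ := Matrix.of fun i j => if e i = Sum.inl j then 1 else 0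
  have hSG : S = G * C * Gᵀ := by
    ext i j
    rw [Matrix.mul_apply]
    simp only [Matrix.mul_apply, transpose_apply, G, Matrix.of_apply, ite_mul, one_mul, zero_mul,
      mul_ite, mul_one, mul_zero]
    rcases hi : e i with c | c
    · rcases hj : e j with d | d
      · have h1 : e.symm (Sum.inl c) = i := by rw [← hi, Equiv.symm_apply_apply]
        have h2 : e.symm (Sum.inl d) = j := by rw [← hj, Equiv.symm_apply_apply]
        simp [hC, h1, h2]
      · simp [hcol i j (by simp [hj])]
    · simp [hrow i j (by simp [hi])]
  have hCr : C.rank = r := by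
    apply le_antisymm
    · simpa using Matrix.rank_le_card_width C
    · have h1 : (G * C * Gᵀ).rank ≤ C.rank :=
        (Matrix.rank_mul_le_left _ _).trans (Matrix.rank_mul_le_right _ _)
      rw [← hSG, hSr] at h1
      exact h1
  have hCdet : C.det ≠ 0 := by
    have hsurj : Function.Surjective C.mulVec := by
      have : LinearMap.range C.mulVecLin = ⊤ := by
        apply Submodule.eq_top_of_finrank_eq
        rw [Module.finrank_fin_fun]
        exact hCr
      exact LinearMap.range_eq_top.1 this
    exact ((Matrix.isUnit_iff_isUnit_det C).1 (Matrix.mulVec_surjective_iff_isUnit.1 hsurj)).ne_zero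
  by_contra hodd
  rw [Nat.not_even_iff_odd] at hodd
  have h3 : C.det = -C.det := by
    conv_lhs => rw [← det_transpose, hCT, det_neg, Fintype.card_fin, hodd.neg_one_pow]
    ring
  have h4 : (2 : κ) * C.det = 0 := by linear_combination h3
  exact (mul_ne_zero h2 hCdet) h4

end MatrixRank

/-! ### Ranks of powers of skew matrices -/

section Types

open Matrix

variable {κ : Type*} [Field κ] {N : ℕ}

/-- `x` has the ranks of a nilpotent matrix whose Jordan blocks have the parts of `p` as sizes: the
`k`-th column of `p` is the drop of the rank from `x ^ k` to `x ^ (k + 1)`. -/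
def HasRanks (x : Matrix (Fin N) (Fin N) κ) (p : N.Partition) : Prop :=
  ∀ k, (x ^ k).rank = (x ^ (k + 1)).rank + cols p.parts k

lemma cols_replicate (m a k : ℕ) :
    cols (Multiset.replicate m a) k = if k < a then m else 0 := by
  induction m with
  | zero => simp
  | succ m ih =>
    rw [Multiset.replicate_succ, cols_cons, ih]
    split_ifs <;> rfl

/-- Every antitone sequence which is eventually zero is the sequence of columns of a multiset, that
of its conjugate partition. -/
lemma exists_multiset_of_antitone (C : ℕ → ℕ) (hC : ∀ k, C (k + 1) ≤ C k) {n : ℕ}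
    (hn : ∀ k, n ≤ k → C k = 0) : ∃ s : Multiset ℕ, (∀ a ∈ s, 0 < a ∧ a ≤ n) ∧
      ∀ k, cols s k = C k := by
  induction n generalizing C with
  | zero => exact ⟨0, by simp, fun k => by simp [hn k (Nat.zero_le k)]⟩
  | succ n ih =>
    have hanti : ∀ k, k ≤ n → C n ≤ C k := fun k hk =>
      Nat.decreasingInduction (motive := fun j _ => C n ≤ C j)
        (fun j _ h => h.trans (hC j)) le_rfl hk
    obtain ⟨s, hs, hsC⟩ := ih (fun k => C k - if k ≤ n then C n else 0) (fun k => by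
      have := hC k
      have := hanti k
      have := hn (k + 1)
      split_ifs with h1 h2 h2
      · omega
      · omega
      · obtain rfl : k = n := by omega
        omega
      · omega) (fun k hk => by
      split_ifs with h
      · obtain rfl : k = n := by omega
        omega
      · rw [hn k (by omega)])
    refine ⟨s + Multiset.replicate (C n) (n + 1), fun a ha => ?_, fun k => ?_⟩
    · rcases Multiset.mem_add.1 ha with h | h
      · have := hs a h; omega
      · rw [Multiset.eq_of_mem_replicate h]; omega
    · rw [cols_add, hsC, cols_replicate]
      have := hanti k
      have := hn k
      split_ifs <;> omega

lemma exists_hasRanks {x : Matrix (Fin N) (Fin N) κ} (hx : IsNilpotent x) :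
    ∃ p : N.Partition, HasRanks x p := by
  obtain ⟨n, hn⟩ := hx
  have hz : ∀ k, n ≤ k → (x ^ k).rank = 0 := fun k hk => by
    rw [pow_eq_zero_of_le hk hn, Matrix.rank_zero]
  have hanti : ∀ k, (x ^ (k + 1)).rank ≤ (x ^ k).rank := fun k => by
    rw [pow_succ]; exact Matrix.rank_mul_le_left _ _
  obtain ⟨s, hs, hsC⟩ := exists_multiset_of_antitone
    (fun k => (x ^ k).rank - (x ^ (k + 1)).rank) (fun k => by
      have := rank_pow_convex (x := x) (E := 1) (by simp) k
      have := hanti k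
      have := hanti (k + 1)
      simp only [mul_one] at *
      rw [show k + 1 + 1 = k + 2 from rfl] at *
      omega) (n := n) (fun k hk => by
      have := hz k hk
      omega)
  have hsum : ∀ m, ∑ k ∈ Finset.range m, cols s k + (x ^ m).rank = N := by
    intro m
    induction m with
    | zero => simp [Matrix.rank_one]
    | succ m ih =>
      have := hanti m
      rw [Finset.sum_range_succ, hsC]
      omega
  refine ⟨⟨s, fun h => (hs _ h).1, ?_⟩, fun k => ?_⟩
  · rw [← sum_cols s n fun a ha => (hs a ha).2]
    have := hsum n
    rw [hz n le_rfl] at this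
    omega
  · have := hanti k
    rw [hsC]
    omega

lemma HasRanks.unique {x : Matrix (Fin N) (Fin N) κ} {p q : N.Partition} (hp : HasRanks x p)
    (hq : HasRanks x q) : p = q :=
  partition_eq_of_cols_eq fun k => by have := hp k; have := hq k; omega

lemma HasRanks.rank_eq {x y : Matrix (Fin N) (Fin N) κ} {p : N.Partition} (hx : HasRanks x p)
    (hy : HasRanks y p) (k : ℕ) : (x ^ k).rank = (y ^ k).rank := by
  induction k with
  | zero => simp
  | succ k ih => have := hx k; have := hy k; omega

lemma HasRanks.congr {x y : Matrix (Fin N) (Fin N) κ} {p : N.Partition} (hx : HasRanks x p)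
    (h : ∀ k, (x ^ k).rank = (y ^ k).rank) : HasRanks y p := fun k => by
  rw [← h, ← h]; exact hx k

lemma Omega_transpose : (Omega κ N)ᵀ = Omega κ N := by
  ext i j
  simp only [Omega, transpose_apply, Matrix.of_apply]
  have : (j = Fin.rev i) ↔ (i = Fin.rev j) := by
    constructor <;> (rintro rfl; simp)
  simp [this]

lemma Omega_mul_self : Omega κ N * Omega κ N = 1 := by
  ext i j
  rw [Matrix.mul_apply, Finset.sum_eq_single (Fin.rev i)]
  · simp only [Omega, Matrix.of_apply, Fin.rev_rev, if_true, one_mul, Matrix.one_apply]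
    simp only [Fin.rev_inj]
  · intro k _ hk
    simp only [Omega, Matrix.of_apply]
    rw [if_neg, zero_mul]
    rintro rfl
    simp at hk
  · simp

/-- The adjoint of a matrix for the symmetric bilinear form with Gram matrix `Ω`. -/
def adj (A : Matrix (Fin N) (Fin N) κ) : Matrix (Fin N) (Fin N) κ := Omega κ N * Aᵀ * Omega κ N

lemma adj_mul (A B : Matrix (Fin N) (Fin N) κ) : adj (A * B) = adj B * adj A := by
  have h : Omega κ N * Bᵀ * Omega κ N * (Omega κ N * Aᵀ * Omega κ N) =
      Omega κ N * Bᵀ * (Omega κ N * Omega κ N) * Aᵀ * Omega κ N := by simp only [mul_assoc]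
  rw [adj, adj, adj, h, Omega_mul_self, transpose_mul, mul_one, ← mul_assoc]

lemma adj_add (A B : Matrix (Fin N) (Fin N) κ) : adj (A + B) = adj A + adj B := by
  simp [adj, mul_add, add_mul]

lemma adj_sub (A B : Matrix (Fin N) (Fin N) κ) : adj (A - B) = adj A - adj B := by
  simp [adj, mul_sub, sub_mul]

lemma adj_one : adj (1 : Matrix (Fin N) (Fin N) κ) = 1 := by simp [adj, Omega_mul_self]

lemma adj_zero : adj (0 : Matrix (Fin N) (Fin N) κ) = 0 := by simp [adj]

lemma adj_adj (A : Matrix (Fin N) (Fin N) κ) : adj (adj A) = A := by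
  have h : Omega κ N * (Omega κ N * A * Omega κ N) * Omega κ N =
      (Omega κ N * Omega κ N) * A * (Omega κ N * Omega κ N) := by simp only [mul_assoc]
  simp only [adj, transpose_mul, transpose_transpose, Omega_transpose]
  rw [← mul_assoc (Omega κ N) A, h, Omega_mul_self, one_mul, mul_one]

lemma adj_pow (A : Matrix (Fin N) (Fin N) κ) (k : ℕ) : adj (A ^ k) = adj A ^ k := by
  induction k with
  | zero => simp [adj_one]
  | succ k ih => rw [pow_succ, adj_mul, ih, pow_succ']

lemma isUnit_Omega_det : IsUnit (Omega κ N).det :=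
  (Matrix.isUnit_iff_isUnit_det _).1 (IsUnit.of_mul_eq_one _ Omega_mul_self)

lemma rank_adj (A : Matrix (Fin N) (Fin N) κ) : (adj A).rank = A.rank := by
  rw [adj, Matrix.rank_mul_eq_left_of_isUnit_det _ _ isUnit_Omega_det,
    Matrix.rank_mul_eq_right_of_isUnit_det _ _ isUnit_Omega_det, rank_transpose]

lemma mem_nilCone_iff {x : Matrix (Fin N) (Fin N) κ} :
    x ∈ nilCone κ N ↔ adj x = -x ∧ IsNilpotent x := by
  refine and_congr ?_ Iff.rfl
  rw [add_eq_zero_iff_eq_neg]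
  constructor
  · intro h
    rw [adj, mul_assoc, h, mul_neg, ← mul_assoc, Omega_mul_self, one_mul]
  · intro h
    rw [← Matrix.mul_neg, ← h, adj, ← mul_assoc, ← mul_assoc, Omega_mul_self, one_mul]

lemma even_rank_pow (h2 : (2 : κ) ≠ 0) {x : Matrix (Fin N) (Fin N) κ} (hx : adj x = -x) {k : ℕ}
    (hk : Odd k) : Even (x ^ k).rank := by
  have h : (Omega κ N * x ^ k).rank = (x ^ k).rank :=
    Matrix.rank_mul_eq_right_of_isUnit_det _ _ isUnit_Omega_det
  rw [← h]
  apply even_rank_of_skew h2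
  have h1 : adj (x ^ k) = -x ^ k := by rw [adj_pow, hx, hk.neg_pow]
  rw [transpose_mul, Omega_transpose, ← Matrix.mul_neg, ← h1, adj, ← mul_assoc, ← mul_assoc,
    Omega_mul_self, one_mul]

lemma HasRanks.isOrthogonal (h2 : (2 : κ) ≠ 0) {x : Matrix (Fin N) (Fin N) κ} {p : N.Partition}
    (hp : HasRanks x p) (hx : adj x = -x) : IsOrthogonal p := by
  intro k hk
  rcases k with _ | k
  · rw [Multiset.count_eq_zero.2 fun h0 => (p.parts_pos h0).ne rfl]; exact Even.zero
  have hk' : Odd k := by rw [Nat.even_add_one, Nat.not_even_iff_odd] at hk; exact hk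
  have h3 := even_rank_pow h2 hx hk'
  have h4 := even_rank_pow h2 hx (show Odd (k + 2) by
    rw [Nat.odd_add]; simp [hk'])
  have h5 := hp k
  have h6 := hp (k + 1)
  have h7 := cols_eq_cols_succ_add_count p.parts k
  rw [Nat.even_iff] at *
  rw [show k + 1 + 1 = k + 2 from rfl] at h6
  omega

end Types

/-! ### Degeneration along an isotropic Jordan block -/

section Degeneration

open Matrix

variable {κ : Type*} [Field κ] {N : ℕ}

/-- Passing to the associated graded of `0 ⊆ W ⊆ Wᗮ ⊆ V`, where `W = range E` is an isotropic
`x`-stable subspace on which `x` is a single Jordan block, changes the partition by a sequence of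
moves. It is done in two steps, the
splittings of `W` and of the quotient by `Wᗮ`, each of which shifts columns across the pivot `b`. -/
theorem isotropic_step (h2 : (2 : κ) ≠ 0) {x x' E R : Matrix (Fin N) (Fin N) κ} {b : ℕ}
    (hx : adj x = -x) (hE : E * E = E) (hEF : E * adj E = 0) (hFE : adj E * E = 0)
    (hxE : x * E = E * x * E) (hcyc : ∀ k, (x ^ k * E).rank = b - k) (hb : 1 ≤ b)
    (hR : R = 1 - E - adj E) (hx' : x' = E * x * E + R * x * R + adj E * x * adj E) :
    adj x' = -x' ∧ (IsNilpotent x → IsNilpotent x') ∧ ∀ p q : N.Partition, HasRanks x p →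
      HasRanks x' q → Relation.ReflTransGen Move p q := by
  set F := adj E with hF
  have hFF : F * F = F := by rw [hF, ← adj_mul, hE]
  have hFx : F * x = F * x * F := by
    have := congrArg adj hxE
    rw [adj_mul, adj_mul, adj_mul, hx, ← hF] at this
    simp only [mul_neg, neg_mul, neg_inj] at this
    rw [mul_assoc, ← this]
  have hER : E * R = 0 := by rw [hR, mul_sub, mul_sub, hE, hEF]; simp
  have hRE : R * E = 0 := by rw [hR, sub_mul, sub_mul, hE, hFE]; simp
  have hFR : F * R = 0 := by rw [hR, mul_sub, mul_sub, hFF, hFE]; simp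
  have hRF : R * F = 0 := by rw [hR, sub_mul, sub_mul, hFF, hEF]; simp
  have hRR : R * R = R := by
    nth_rw 1 [hR]
    rw [sub_mul, sub_mul, hER, hFR]; simp
  have hadjR : adj R = R := by
    rw [hR, adj_sub, adj_sub, adj_one, ← hF, hF, adj_adj]; abel
  have h1E : 1 - E = R + F := by rw [hR]; abel
  have h1F : 1 - F = R + E := by rw [hR]; abel
  have assoc : ∀ {A B C : Matrix (Fin N) (Fin N) κ}, A * B = C → ∀ z, A * (B * z) = C * z :=
    fun h z => by rw [← mul_assoc, h]
  have hxE' : x * E = E * (x * E) := by rw [← mul_assoc]; exact hxE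
  have hFx_assoc : F * x = F * (x * F) := by rw [← mul_assoc]; exact hFx
  have hFxE : F * (x * E) = 0 := by rw [hxE', assoc hFE, zero_mul]
  have hRxE : R * (x * E) = 0 := by rw [hxE', assoc hRE, zero_mul]
  have hFxR : F * (x * R) = 0 := by rw [← mul_assoc, hFx, mul_assoc, hFR, mul_zero]
  set x₁ := E * x * E + (1 - E) * x * (1 - E) with hx₁
  have hx₁' : x₁ = E * (x * E) + R * (x * R) + R * (x * F) + F * (x * F) := by
    rw [hx₁, h1E]
    simp only [mul_add, add_mul, mul_assoc, hFxR]
    abel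
  have hFx₁ : F * x₁ = F * (x * F) := by
    rw [hx₁']
    simp only [mul_add, assoc hFE, assoc hFR, assoc hFF, zero_mul, zero_add]
  have hx'₁ : x' = F * x₁ * F + (1 - F) * x₁ * (1 - F) := by
    rw [hx', h1F, hx₁']
    simp only [mul_add, add_mul, mul_assoc, assoc hFE, assoc hFR, assoc hFF, assoc hER, assoc hRE,
      assoc hRR, assoc hRF, assoc hE, assoc hEF, hFE, hFR, hFF, hER, hRE, hRR, hE,
      mul_zero, zero_mul, add_zero, zero_add]
    abel
  -- the second step is the transpose of a step of the first kind
  have hFcyc : ∀ k, (F * x ^ k).rank = b - k := by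
    intro k
    rw [← hcyc k, ← rank_adj (x ^ k * E), adj_mul, adj_pow, hx, ← hF]
    rcases Nat.even_or_odd k with h | h
    · rw [h.neg_pow]
    · rw [h.neg_pow, mul_neg, rank_eq_rk (-_), map_neg, rk, LinearMap.range_neg]
      rfl
  have hcyc' : ∀ k, (x₁ᵀ ^ k * Fᵀ).rank = b - k := by
    intro k
    have h1 : F * x₁ ^ k = F * x ^ k := by
      induction k with
      | zero => simp
      | succ k ih =>
        rw [pow_succ', ← mul_assoc, hFx₁, ← mul_assoc, mul_assoc, ih, ← mul_assoc, ← hFx, pow_succ',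
          mul_assoc]
    rw [← Matrix.transpose_pow, ← Matrix.transpose_mul, rank_transpose, h1, hFcyc]
  have s1 := rank_pow_of_cyclic_sub hE hxE hx₁ hcyc
  have s2 := rank_pow_of_cyclic_sub (x := x₁ᵀ) (x₁ := x'ᵀ) (E := Fᵀ) (b := b)
    (by rw [← transpose_mul, hFF])
    (by
      rw [← transpose_mul, ← transpose_mul, ← transpose_mul, hFx₁, ← mul_assoc F x₁, hFx₁,
        mul_assoc, mul_assoc, hFF])
    (by
      rw [hx'₁]
      simp only [transpose_add, transpose_mul, transpose_sub, transpose_one, mul_assoc]) hcyc'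
  simp only [← transpose_pow, rank_transpose] at s2
  have hEx' : E * x' = x' * E := by
    rw [hx']
    simp only [mul_add, add_mul, mul_assoc, assoc hER, assoc hE, assoc hEF, hFE, hRE, hE, mul_zero,
      zero_mul, add_zero]
  have hEx'' : E * x' = x * E := by
    rw [hx']
    simp only [mul_add, mul_assoc, assoc hER, assoc hEF, zero_mul, add_zero, ← hxE']
  have hFx' : F * x' = x' * F := by
    rw [hx']
    simp only [mul_add, add_mul, mul_assoc, assoc hFR, assoc hFF, assoc hFE, hEF, hRF, hFF,
      mul_zero, zero_mul, add_zero, zero_add]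
  have hxk : ∀ k, x' ^ k * E = x ^ k * E := by
    intro k
    induction k with
    | zero => simp
    | succ k ih =>
      rw [pow_succ, mul_assoc, ← hEx', hEx'', hxE', ← mul_assoc, ih, mul_assoc, ← hxE',
        ← mul_assoc, ← pow_succ]
  have hFx'' : F * x' = F * x := by
    rw [hx']
    simp only [mul_add, mul_assoc, assoc hFR, assoc hFF, assoc hFE, zero_mul, zero_add, ← hFx_assoc]
  have hFxk : ∀ k, F * x' ^ k = F * x ^ k := by
    intro k
    induction k with
    | zero => simp
    | succ k ih =>
      rw [pow_succ', ← mul_assoc, hFx'', hFx, mul_assoc, ih, ← mul_assoc, ← hFx, pow_succ',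
        mul_assoc]
  have hRx' : R * x' = x' * R := by
    rw [hx']
    simp only [mul_add, add_mul, mul_assoc, assoc hRR, assoc hRE, assoc hRF, hER, hRR, hFR,
      mul_zero, zero_mul, add_zero, zero_add]
  have hRxk : ∀ k, x' ^ k * R = R * x ^ k * R := by
    have hxR : x * R = E * (x * R) + R * (x * R) := by
      conv_lhs => rw [← one_mul (x * R), show (1 : Matrix (Fin N) (Fin N) κ) = E + R + F by
        rw [hR]; abel, add_mul, add_mul, hFxR, add_zero]
    have hRxE : ∀ k, R * (x ^ k * E) = 0 := by
      intro k
      induction k with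
      | zero => simp [hRE]
      | succ k ih => rw [pow_succ, mul_assoc, hxE', ← mul_assoc (x ^ k), ← mul_assoc, ih, zero_mul]
    intro k
    induction k with
    | zero => simp [hRR]
    | succ k ih =>
      have hx'R : x' * R = R * (R * (x * R)) := by
        rw [hx', assoc hRR]
        simp only [add_mul, mul_assoc, hER, hRR, hFR, mul_zero, add_zero, zero_add]
      have h1 : R * (x ^ k * (E * (x * R))) = 0 := by
        rw [← mul_assoc (x ^ k) E, ← mul_assoc R (x ^ k * E), hRxE, zero_mul]
      calc x' ^ (k + 1) * R = x' ^ k * R * (R * (x * R)) := by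
            rw [pow_succ, mul_assoc, hx'R, mul_assoc]
        _ = R * (x ^ k * (E * (x * R) + R * (x * R))) := by
            rw [ih, mul_add, mul_add, h1, zero_add, mul_assoc, mul_assoc, assoc hRR]
        _ = R * x ^ (k + 1) * R := by
            rw [← hxR, pow_succ, ← mul_assoc (x ^ k) x R, ← mul_assoc]
  have hadj : adj x' = -x' := by
    rw [hx', adj_add, adj_add, adj_mul, adj_mul, adj_mul, adj_mul, adj_mul, adj_mul, hadjR, hx,
      ← hF, hF, adj_adj, ← hF]
    simp only [mul_neg, neg_mul, mul_assoc]
    abel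
  refine ⟨hadj, ?_, ?_⟩
  · rintro ⟨n, hn⟩
    refine ⟨n, ?_⟩
    have h1 : x' ^ n = x' ^ n * E + x' ^ n * R + F * x' ^ n := by
      have hc : F * x' ^ n = x' ^ n * F := ((show Commute F x' from hFx').pow_right n).eq
      rw [hc, ← mul_add, ← mul_add, hR, show E + (1 - E - F) + F = 1 by abel, mul_one]
    rw [h1, hxk, hRxk, hFxk, hn]
    simp
  · intro p q hp hq
    have hpo := hp.isOrthogonal h2 hx
    have hqo := hq.isOrthogonal h2 hadj
    have hpiv : Pivot b p q := by
      constructor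
      · intro k hk
        have h3 := (s1 k).1 hk
        have h4 := (s2 k).1 hk
        have h5 := hp k
        have h6 := hq k
        omega
      · intro k hk
        have h3 := (s1 k).2 hk
        have h4 := (s2 k).2 hk
        have h5 := hp k
        have h6 := hq k
        omega
    refine hpiv.reflTransGen_move hpo hqo ?_
    -- `range E` and `range F` contribute two blocks of size `b` to `x'`
    have hrank : ∀ k, (x' ^ k).rank = (x' ^ k * R).rank + (b - k) + (b - k) := by
      intro k
      have hcE : E * x' ^ k = x' ^ k * E := ((show Commute E x' from hEx').pow_right k).eq
      have hcF : F * x' ^ k = x' ^ k * F := ((show Commute F x' from hFx').pow_right k).eq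
      have hcR : R * x' ^ k = x' ^ k * R := ((show Commute R x' from hRx').pow_right k).eq
      rw [rank_eq_add_of_commute hE hcE, hxk, hcyc, rank_eq_add_of_commute (f := (1 - E) * x' ^ k)
        hFF, h1E, ← mul_assoc (1 - F), h1F]
      · have e1 : (R + E) * (R + F) = R := by
          simp only [add_mul, mul_add, hRR, hRF, hER, hEF, add_zero]
        have e2 : (R + F) * x' ^ k * F = F * x' ^ k := by
          rw [mul_assoc, ← hcF, ← mul_assoc, add_mul, hRF, hFF, zero_add]
        rw [e1, e2, hcR, hFxk, hFcyc]
      · rw [h1E, ← mul_assoc, mul_assoc (R + F), ← hcF, ← mul_assoc, mul_add,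
          add_mul R F F, hFR, hRF]
    have h3 := rank_pow_convex hRx'.symm (b - 1)
    have h4 := hrank (b - 1)
    have h5 := hrank b
    have h6 := hrank (b + 1)
    have h7 := hq (b - 1)
    have h8 := hq b
    have h9 := cols_eq_cols_succ_add_count q.parts (b - 1)
    rw [show b - 1 + 2 = b + 1 by omega] at h3
    rw [show b - 1 + 1 = b by omega] at *
    omega

end Degeneration

/-! ### Gradings -/

section Grading

open Matrix

variable {κ : Type*} [Field κ] {N : ℕ}

lemma exists_cyclic_projection_matrix {y P : Matrix (Fin N) (Fin N) κ} (hP : P * P = P)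
    (hc : y * P = P * y) (hne : P ≠ 0) (hnil : IsNilpotent y) :
    ∃ (b : ℕ) (E : Matrix (Fin N) (Fin N) κ), 1 ≤ b ∧ E * E = E ∧ P * E = E ∧ E * P = E ∧
      y * E = E * y ∧ ∀ k, (y ^ k * E).rank = b - k := by
  set φ := Matrix.toLinAlgEquiv' (R := κ) (n := Fin N) with hφ
  obtain ⟨n, hn⟩ := hnil
  obtain ⟨b, E, v, hb, h1, h2, h3, h4, h5, -, -⟩ := exists_cyclic_projection (y := φ y) (P := φ P)
    (by rw [← map_mul, hP]) (by rw [← map_mul, hc, map_mul])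
    (by rwa [Ne, map_eq_zero_iff _ φ.injective])
    ⟨n, by rw [← map_pow, ← map_mul, hn, zero_mul, map_zero]⟩
  obtain ⟨E, rfl⟩ := φ.surjective E
  simp only [← map_mul, ← map_pow, φ.injective.eq_iff] at h1 h2 h3 h4 h5
  exact ⟨b, E, hb, h1, h2, h3, h4, h5⟩

/-- A grading of `κ ^ N` with projections `P n`, compatible with the bilinear form (the pieces of
weights `m` and `n` are orthogonal unless `m + n = 0`), for which `x` has only components of
nonnegative weight, and for which the component of weight `0` of `x` is `y`. -/
structure Grading (x y : Matrix (Fin N) (Fin N) κ) (P : ℤ → Matrix (Fin N) (Fin N) κ)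
    (S : Finset ℤ) : Prop where
  mul : ∀ m n, P m * P n = if m = n then P m else 0
  sum : ∑ n ∈ S, P n = 1
  support : ∀ n, n ∉ S → P n = 0
  adj_eq : ∀ n, adj (P n) = P (-n)
  upper : ∀ m n, m < n → P m * x * P n = 0
  diag : ∀ n, P n * x * P n = P n * y
  comm : ∀ n, y * P n = P n * y

lemma rank_lt_of_idempotents {P Q : Matrix (Fin N) (Fin N) κ} (hP : P * P = P)
    (hQ : Q ≠ 0) (hPQ : P * Q = 0) (hQP : Q * P = 0) : P.rank < (P + Q).rank := by
  have hc : P * (P + Q) = (P + Q) * P := by rw [mul_add, add_mul, hPQ, hQP]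
  rw [rank_eq_add_of_commute hP hc, add_mul, hQP, hP, add_zero]
  have h1 : (1 - P) * (P + Q) = Q := by
    rw [sub_mul, one_mul, mul_add, hP, hPQ]; abel
  rw [h1]
  have := (rank_eq_zero_iff Q).not.2 hQ
  omega

/-- Splitting off a single Jordan block `range E` of the piece of highest weight, and its dual in
the piece of lowest weight, is an isotropic step; afterwards both may be given weight `0`. -/
lemma Grading.exists_isotropic_step {x y : Matrix (Fin N) (Fin N) κ}
    {P : ℤ → Matrix (Fin N) (Fin N) κ} {S : Finset ℤ} (hy : adj y = -y)
    (hyn : IsNilpotent y) (G : Grading x y P S) {n : ℤ} (hn : n ≠ 0) (hPn : P n ≠ 0) :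
    ∃ (x' E R : Matrix (Fin N) (Fin N) κ) (b : ℕ) (P' : ℤ → Matrix (Fin N) (Fin N) κ),
      (E * E = E ∧ E * adj E = 0 ∧ adj E * E = 0 ∧ x * E = E * x * E ∧
      (∀ k, (x ^ k * E).rank = b - k) ∧ 1 ≤ b ∧ R = 1 - E - adj E ∧
      x' = E * x * E + R * x * R + adj E * x * adj E) ∧
      Grading x' y P' (insert 0 S) ∧ (P 0).rank < (P' 0).rank := by
  classical
  -- the highest weight `a`
  obtain ⟨a, ha, hPa, hmax⟩ : ∃ a, 0 < a ∧ P a ≠ 0 ∧ ∀ m, a < m → P m = 0 := by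
    have hex : (S.filter fun m => P m ≠ 0 ∧ 0 < m).Nonempty := by
      rcases lt_or_gt_of_ne hn with h | h
      · have h1 : P (-n) ≠ 0 := by
          rw [← G.adj_eq]
          intro h0
          apply hPn
          rw [← adj_adj (P n), h0, adj_zero]
        refine ⟨-n, Finset.mem_filter.2 ⟨?_, h1, by omega⟩⟩
        by_contra h2
        exact h1 (G.support _ h2)
      · refine ⟨n, Finset.mem_filter.2 ⟨?_, hPn, h⟩⟩
        by_contra h2
        exact hPn (G.support _ h2)
    obtain ⟨a, ha, hmax⟩ := Finset.exists_max_image _ id hex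
    rw [Finset.mem_filter] at ha
    refine ⟨a, ha.2.2, ha.2.1, fun m hm => ?_⟩
    by_contra h
    have h1 : m ∈ S := by
      by_contra h2
      exact h (G.support _ h2)
    have := hmax m (Finset.mem_filter.2 ⟨h1, h, by omega⟩)
    simp only [id] at this
    omega
  have hPP : ∀ m, P m * P m = P m := fun m => by rw [G.mul, if_pos rfl]
  have hPP' : ∀ {m k}, m ≠ k → P m * P k = 0 := fun h => by rw [G.mul, if_neg h]
  obtain ⟨b, E, hb, hE, hPE, hEP, hyE, hcyc⟩ :=
    exists_cyclic_projection_matrix (hPP a) (G.comm a) hPa hyn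
  set F := adj E with hF
  have hFF : F * F = F := by rw [hF, ← adj_mul, hE]
  have hFP : F * P (-a) = F := by rw [← G.adj_eq, hF, ← adj_mul, hPE]
  have hPF : P (-a) * F = F := by rw [← G.adj_eq, hF, ← adj_mul, hEP]
  have hyF : y * F = F * y := by
    have := congrArg adj hyE
    rw [adj_mul, adj_mul, hy, ← hF, mul_neg, neg_mul, neg_inj] at this
    exact this.symm
  have hPmE : ∀ m, P m * E = if m = a then E else 0 := fun m => by
    rw [← hPE, ← mul_assoc, G.mul]; split_ifs with h
    · rw [h]
    · rw [zero_mul]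
  have hEPm : ∀ m, E * P m = if m = a then E else 0 := fun m => by
    rw [← hEP, mul_assoc, G.mul]
    by_cases h : m = a
    · rw [if_pos h.symm, if_pos h]
    · rw [if_neg (Ne.symm h), if_neg h, mul_zero]
  have hPmF : ∀ m, P m * F = if m = -a then F else 0 := fun m => by
    rw [← hPF, ← mul_assoc, G.mul]; split_ifs with h
    · rw [h]
    · rw [zero_mul]
  have hFPm : ∀ m, F * P m = if m = -a then F else 0 := fun m => by
    rw [← hFP, mul_assoc, G.mul]
    by_cases h : m = -a
    · rw [if_pos h.symm, if_pos h]
    · rw [if_neg (Ne.symm h), if_neg h, mul_zero]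
  have hEF : E * F = 0 := by rw [← hEP, mul_assoc, hPmF, if_neg (by omega), mul_zero]
  have hFE : F * E = 0 := by rw [← hFP, mul_assoc, hPmE, if_neg (by omega), mul_zero]
  -- `x` preserves the piece of highest weight, where it agrees with `y`
  have hxPa : x * P a = P a * y := by
    rw [← one_mul (x * P a), ← G.sum, Finset.sum_mul, Finset.sum_eq_single a]
    · rw [← mul_assoc, G.diag]
    · intro m _ hm
      rcases lt_or_gt_of_ne hm with h | h
      · rw [← mul_assoc, G.upper m a h]
      · rw [hmax m h, zero_mul]
    · intro h; rw [G.support a h, zero_mul]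
  have hxE : x * E = y * E := by
    rw [← hPE, ← mul_assoc, hxPa, ← G.comm, mul_assoc]
  have hxE' : x * E = E * x * E := by rw [mul_assoc, hxE, hyE, ← mul_assoc, hE]
  have hxk : ∀ k, x ^ k * E = y ^ k * E := by
    intro k
    induction k with
    | zero => simp
    | succ k ih =>
      rw [pow_succ, mul_assoc, hxE, hyE, ← mul_assoc, ih, mul_assoc, ← hyE, ← mul_assoc, pow_succ]
  set R := 1 - E - F with hR
  have hER : E * R = 0 := by rw [hR, mul_sub, mul_sub, hE, hEF]; simp
  have hRE : R * E = 0 := by rw [hR, sub_mul, sub_mul, hE, hFE]; simp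
  have hFR : F * R = 0 := by rw [hR, mul_sub, mul_sub, hFF, hFE]; simp
  have hRF : R * F = 0 := by rw [hR, sub_mul, sub_mul, hFF, hEF]; simp
  have hRR : R * R = R := by
    nth_rw 1 [hR]
    rw [sub_mul, sub_mul, hER, hFR]; simp
  have hadjR : adj R = R := by
    rw [hR, adj_sub, adj_sub, adj_one, ← hF, hF, adj_adj]; abel
  have hRP : ∀ m, R * P m = P m * R := by
    intro m
    rw [hR, sub_mul, sub_mul, mul_sub, mul_sub, hPmE, hEPm, hPmF, hFPm]; simp
  have hyR : y * R = R * y := by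
    rw [hR, sub_mul, sub_mul, mul_sub, mul_sub, hyE, hyF]; simp
  have hRP0 : R * P 0 = P 0 := by
    rw [hR, sub_mul, sub_mul, hEPm, hFPm, if_neg (by omega), if_neg (by omega)]; simp
  set x' := E * x * E + R * x * R + F * x * F with hx'
  have assoc : ∀ {A B C : Matrix (Fin N) (Fin N) κ}, A * B = C → ∀ z, A * (B * z) = C * z :=
    fun h z => by rw [← mul_assoc, h]
  have hFxF : F * (x * F) = F * y := by
    have hFx : F * x = F * y := by
      have h1 : P (-a) * x = P (-a) * y := by
        rw [← mul_one (P (-a) * x), ← G.sum, Finset.mul_sum, Finset.sum_eq_single (-a)]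
        · rw [G.diag]
        · intro m _ hm
          rcases lt_or_gt_of_ne hm with h | h
          · have : P m = 0 := by
              rw [← adj_adj (P m), G.adj_eq, hmax (-m) (by omega), adj_zero]
            rw [this, mul_zero]
          · exact G.upper _ _ h
        · intro h; rw [G.support _ h, mul_zero]
      rw [← hFP, mul_assoc, h1, ← mul_assoc]
    rw [← mul_assoc, hFx, mul_assoc, hyF, ← mul_assoc, hFF]
  have hExE : E * (x * E) = E * y := by rw [hxE, hyE, ← mul_assoc, hE]
  let P' : ℤ → Matrix (Fin N) (Fin N) κ := fun m => R * P m + if m = 0 then E + F else 0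
  have hP'0 : P' 0 = P 0 + (E + F) := by simp [P', hRP0]
  have hP'mul : ∀ m, P' m = R * P m + if m = 0 then E + F else 0 := fun _ => rfl
  have hRPR : ∀ m k, R * P m * (R * P k) = R * (P m * P k) := fun m k => by
    rw [hRP m, mul_assoc, ← mul_assoc R R, hRR, ← mul_assoc, ← hRP, mul_assoc]
  have hRx'R : ∀ m k, R * P m * x' * (R * P k) = R * (P m * x * P k) * R := fun m k => by
    rw [hx', hRP m]
    simp only [mul_add, mul_assoc, assoc hRE, assoc hRF, assoc hRR, zero_mul, mul_zero, zero_add,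
      add_zero]
    rw [hRP k, ← mul_assoc (P m) R, ← hRP, mul_assoc]
  have c1 : ∀ m, R * P m * (E + F) = 0 := fun m => by
    rw [hRP, mul_assoc, mul_add, hRE, hRF, add_zero, mul_zero]
  have c2 : ∀ m, (E + F) * (R * P m) = 0 := fun m => by
    rw [← mul_assoc, add_mul, hER, hFR, add_zero, zero_mul]
  have c3 : (E + F) * (E + F) = E + F := by
    rw [add_mul, mul_add, mul_add, hE, hEF, hFE, hFF]; simp
  have c4 : ∀ m, R * P m * x' * (E + F) = 0 := fun m => by
    rw [hx', hRP]
    simp only [mul_add, add_mul, mul_assoc, assoc hRE, assoc hRF, assoc hRR, hRE, hRF,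
      zero_mul, mul_zero, add_zero]
  have c5 : ∀ m, (E + F) * x' * (R * P m) = 0 := fun m => by
    rw [hx']
    simp only [mul_add, add_mul, mul_assoc, assoc hER, assoc hE, assoc hFF, assoc hEF,
      assoc hFR, assoc hFE, zero_mul, mul_zero, add_zero]
  have c6 : (E + F) * x' * (E + F) = (E + F) * y := by
    rw [hx']
    simp only [mul_add, add_mul, mul_assoc, assoc hER, assoc hE, assoc hFF, assoc hEF,
      assoc hFR, assoc hFE, zero_mul, add_zero, zero_add, hExE, hFxF]
    simp only [hyE, hyF, assoc hE, assoc hFE, assoc hEF, assoc hFF, zero_mul, add_zero, zero_add]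
  have hsplit : ∀ A B C D : Matrix (Fin N) (Fin N) κ, (A + B) * x' * (C + D) =
      A * x' * C + A * x' * D + B * x' * C + B * x' * D := fun A B C D => by noncomm_ring
  refine ⟨x', E, R, b, P', ⟨hE, hEF, hFE, hxE', fun k => by rw [hxk, hcyc], hb, rfl, rfl⟩,
    ⟨?_, ?_, ?_, ?_, ?_, ?_, ?_⟩, ?_⟩
  · intro m k
    have h1 := hRPR m k
    rw [G.mul] at h1
    by_cases hm : m = 0 <;> by_cases hk : k = 0
    · subst hm hk
      rw [if_pos rfl] at h1 ⊢
      rw [hP'mul, if_pos rfl, add_mul, mul_add (R * P 0), mul_add (E + F), h1, c1, c2, c3,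
        add_zero, zero_add]
    · subst hm
      rw [if_neg (Ne.symm hk)] at h1 ⊢
      rw [hP'mul, hP'mul, if_pos rfl, if_neg hk, add_zero, add_mul, h1, c2, mul_zero, add_zero]
    · subst hk
      rw [if_neg hm] at h1 ⊢
      rw [hP'mul, hP'mul, if_pos rfl, if_neg hm, add_zero, mul_add, h1, c1, mul_zero, add_zero]
    · rw [hP'mul, hP'mul, if_neg hm, if_neg hk, add_zero, add_zero, h1]
      split_ifs <;> simp
  · simp only [hP'mul, Finset.sum_add_distrib, ← Finset.mul_sum]
    have h1 : ∑ m ∈ insert 0 S, P m = 1 := by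
      rw [← G.sum]
      refine (Finset.sum_subset (Finset.subset_insert _ _) fun m _ hm => G.support m hm).symm
    rw [h1, Finset.sum_ite_eq' (insert 0 S) (0 : ℤ), if_pos (Finset.mem_insert_self _ _), hR]
    simp
  · intro m hm
    rw [Finset.mem_insert, not_or] at hm
    rw [hP'mul, G.support m hm.2, if_neg hm.1]; simp
  · intro m
    rw [hP'mul, hP'mul, adj_add, adj_mul, hadjR, G.adj_eq, hRP]
    congr 1
    by_cases hm : m = 0
    · rw [if_pos hm, if_pos (by omega), adj_add, ← hF, hF, adj_adj, add_comm]
    · rw [if_neg hm, if_neg (by omega), adj_zero]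
  · intro m k hmk
    have h1 := hRx'R m k
    rw [G.upper m k hmk, mul_zero, zero_mul] at h1
    rw [hP'mul, hP'mul, hsplit, h1]
    by_cases hm : m = 0
    · rw [if_pos hm, if_neg (by omega : ¬ k = 0), c5]; simp
    · rw [if_neg hm]
      by_cases hk : k = 0
      · rw [if_pos hk, c4]; simp
      · rw [if_neg hk]; simp
  · intro m
    have h1 : R * P m * x' * (R * P m) = R * P m * y := by
      rw [hRx'R, G.diag, mul_assoc R, mul_assoc (P m), hyR, ← mul_assoc (P m), ← hRP,
        mul_assoc R (P m), assoc hRR, ← mul_assoc]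
    rw [hP'mul, hsplit, h1]
    by_cases hm : m = 0
    · rw [if_pos hm, c4, c5, c6]; simp [add_mul]
    · rw [if_neg hm]; simp
  · intro m
    rw [hP'mul, mul_add, add_mul, ← mul_assoc, hyR, mul_assoc, G.comm, ← mul_assoc]
    split_ifs
    · rw [mul_add, add_mul, hyE, hyF]
    · simp
  · rw [hP'0]
    apply rank_lt_of_idempotents (hPP 0)
    · intro h0
      have : (E + F) * E = 0 := by rw [h0, zero_mul]
      rw [add_mul, hE, hFE, add_zero] at this
      have h1 := hcyc 0
      rw [this, mul_zero, Matrix.rank_zero] at h1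
      omega
    · rw [mul_add, hPmE, hPmF, if_neg (by omega), if_neg (by omega), add_zero]
    · rw [add_mul, hEPm, hFPm, if_neg (by omega), if_neg (by omega), add_zero]

/-- Taking the component of weight `0` changes the partition by a sequence of moves: isotropic steps
enlarge the piece of weight `0` until it is the whole space. -/
theorem Grading.reflTransGen_move (h2 : (2 : κ) ≠ 0) {x y : Matrix (Fin N) (Fin N) κ}
    {P : ℤ → Matrix (Fin N) (Fin N) κ} {S : Finset ℤ} (hx : adj x = -x)
    (hxn : IsNilpotent x) (hy : adj y = -y) (hyn : IsNilpotent y) (G : Grading x y P S)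
    {p q : N.Partition} (hp : HasRanks x p) (hq : HasRanks y q) :
    Relation.ReflTransGen Move p q := by
  induction hr : N - (P 0).rank using Nat.strong_induction_on generalizing x P S p with
  | _ r ih =>
    by_cases h : ∃ n, n ≠ 0 ∧ P n ≠ 0
    · obtain ⟨n, hn, hPn⟩ := h
      obtain ⟨x', E, R, b, P', ⟨h1, h2', h3, h4, h5, h6, h7, h8⟩, G', hlt⟩ :=
        G.exists_isotropic_step hy hyn hn hPn
      obtain ⟨k1, k2, k3⟩ := isotropic_step h2 hx h1 h2' h3 h4 h5 h6 h7 h8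
      obtain ⟨p', hp'⟩ := exists_hasRanks (k2 hxn)
      have hle : (P' 0).rank ≤ N := by simpa using Matrix.rank_le_card_width (P' 0)
      exact (k3 p p' hp hp').trans (ih _ (by omega) k1 (k2 hxn) G' hp' rfl)
    · push Not at h
      have hP0 : P 0 = 1 := by
        rw [← G.sum]
        by_cases h0 : (0 : ℤ) ∈ S
        · rw [Finset.sum_eq_single_of_mem 0 h0 fun m _ hm => h m hm]
        · rw [Finset.sum_eq_zero fun m hm => h m (by rintro rfl; exact h0 hm), G.support 0 h0]
      have hxy : x = y := by
        have := G.diag 0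
        rwa [hP0, one_mul, one_mul, mul_one] at this
      subst hxy
      rw [hp.unique hq]

end Grading

/-! ### Jordan bases -/

section Jordan

open Module

variable {κ V : Type*} [Field κ] [AddCommGroup V] [Module κ V]

/-- The vectors `w a` generate `V` under `f`, and the Jordan chain of `w a` has length `ℓ a`. Since
the lengths add up to the dimension, the chains then form a Jordan basis, without any need to check
linear independence. -/
structure Generators (f : End κ V) {α : Type*} [Fintype α] (ℓ : α → ℕ) (w : α → V) : Prop where
  pow_eq_zero : ∀ a, (f ^ ℓ a) (w a) = 0
  sum_eq : ∑ a, ℓ a = finrank κ V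
  eq_top : ∀ S : Submodule κ V, (∀ v ∈ S, f v ∈ S) → (∀ a, w a ∈ S) → S = ⊤

/-- The basis `b` consists of Jordan chains of lengths `ℓ a` of `f`. -/
def IsJordanBasis (f : End κ V) {α : Type*} {ℓ : α → ℕ} (b : Basis (Σ a, Fin (ℓ a)) κ V) : Prop :=
  ∀ (a : α) (j : ℕ) (hj : j < ℓ a),
    f (b ⟨a, j, hj⟩) = if _h : j = 0 then 0 else b ⟨a, j - 1, by omega⟩

lemma Generators.exists_isJordanBasis [FiniteDimensional κ V] {f : End κ V} {α : Type*} [Fintype α]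
    {ℓ : α → ℕ} {w : α → V} (h : Generators f ℓ w) :
    ∃ b : Basis (Σ a, Fin (ℓ a)) κ V, IsJordanBasis f b := by
  set v : (Σ a, Fin (ℓ a)) → V := fun i => (f ^ (ℓ i.1 - 1 - i.2)) (w i.1) with hv
  have hstep : ∀ (a : α) (j : ℕ) (hj : j < ℓ a),
      f (v ⟨a, j, hj⟩) = if _h : j = 0 then 0 else v ⟨a, j - 1, by omega⟩ := by
    intro a j hj
    have h1 : f (v ⟨a, j, hj⟩) = (f ^ (ℓ a - 1 - j + 1)) (w a) := by
      rw [pow_succ', End.mul_apply]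
    rw [h1]
    split_ifs with h0
    · subst h0
      rw [show ℓ a - 1 - 0 + 1 = ℓ a by omega, h.pow_eq_zero]
    · rw [show ℓ a - 1 - j + 1 = ℓ a - 1 - (j - 1) by omega]
  have htop : ⊤ ≤ Submodule.span κ (Set.range v) := by
    rw [top_le_iff]
    refine h.eq_top _ (fun x hx => ?_) fun a => ?_
    · have h2 : Submodule.span κ (Set.range v) ≤ (Submodule.span κ (Set.range v)).comap f := by
        rw [Submodule.span_le]
        rintro _ ⟨⟨a, j, hj⟩, rfl⟩
        change f (v ⟨a, j, hj⟩) ∈ Submodule.span κ (Set.range v)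
        rw [hstep]
        split_ifs
        · exact Submodule.zero_mem _
        · exact Submodule.subset_span ⟨_, rfl⟩
      exact h2 hx
    · rcases Nat.eq_zero_or_pos (ℓ a) with h0 | h0
      · have := h.pow_eq_zero a
        rw [h0, pow_zero, End.one_apply] at this
        rw [this]; exact Submodule.zero_mem _
      · refine Submodule.subset_span ⟨⟨a, ℓ a - 1, by omega⟩, ?_⟩
        simp [hv]
  refine ⟨basisOfTopLeSpanOfCardEqFinrank v htop ?_, ?_⟩
  · simp [h.sum_eq]
  · intro a j hj
    simp only [coe_basisOfTopLeSpanOfCardEqFinrank]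
    exact hstep a j hj

lemma IsJordanBasis.pow_apply {f : End κ V} {α : Type*} {ℓ : α → ℕ}
    {b : Basis (Σ a, Fin (ℓ a)) κ V} (h : IsJordanBasis f b) (k : ℕ) (a : α) (j : ℕ)
    (hj : j < ℓ a) : (f ^ k) (b ⟨a, j, hj⟩) = if _h : j < k then 0 else b ⟨a, j - k, by omega⟩ := by
  induction k with
  | zero => simp
  | succ k ih =>
    rw [pow_succ', End.mul_apply, ih]
    by_cases h1 : j < k
    · rw [dif_pos h1, dif_pos (by omega), map_zero]
    · rw [dif_neg h1, h]
      by_cases h2 : j < k + 1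
      · rw [dif_pos (by omega), dif_pos h2]
      · rw [dif_neg (by omega), dif_neg h2]
        rfl

lemma IsJordanBasis.rk_pow {f : End κ V} {α : Type*} [Fintype α] {ℓ : α → ℕ}
    {b : Basis (Σ a, Fin (ℓ a)) κ V} (h : IsJordanBasis f b) (k : ℕ) :
    rk (f ^ k) = ∑ a, (ℓ a - k) := by
  set c : (Σ a, Fin (ℓ a - k)) → V := fun i => b ⟨i.1, i.2, by have := i.2.2; omega⟩ with hc
  have hli : LinearIndependent κ c := by
    refine b.linearIndependent.comp
      (fun i : (Σ a, Fin (ℓ a - k)) => (⟨i.1, i.2, by have := i.2.2; omega⟩ : Σ a, Fin (ℓ a))) ?_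
    rintro ⟨a, j, hj⟩ ⟨a', j', hj'⟩ hij
    simp only [Sigma.mk.injEq] at hij
    obtain ⟨rfl, hij⟩ := hij
    simp only [heq_eq_eq, Fin.mk.injEq] at hij
    subst hij
    rfl
  have hr : LinearMap.range (f ^ k) = Submodule.span κ (Set.range c) := by
    rw [LinearMap.range_eq_map, ← b.span_eq, Submodule.map_span]
    apply le_antisymm
    · rw [Submodule.span_le]
      rintro _ ⟨_, ⟨⟨a, j, hj⟩, rfl⟩, rfl⟩
      rw [h.pow_apply]
      split_ifs with h1
      · exact Submodule.zero_mem _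
      · exact Submodule.subset_span ⟨⟨a, j - k, by omega⟩, rfl⟩
    · rw [Submodule.span_le]
      rintro _ ⟨⟨a, j, hj⟩, rfl⟩
      refine Submodule.subset_span ⟨b ⟨a, j + k, by omega⟩, ⟨_, rfl⟩, ?_⟩
      rw [h.pow_apply, dif_neg (by omega)]
      simp [hc]
  rw [rk, hr, finrank_span_eq_card hli]
  simp

lemma Generators.rk_pow [FiniteDimensional κ V] {f : End κ V} {α : Type*} [Fintype α] {ℓ : α → ℕ}
    {w : α → V} (h : Generators f ℓ w) (k : ℕ) : rk (f ^ k) = ∑ a, (ℓ a - k) := by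
  obtain ⟨b, hb⟩ := h.exists_isJordanBasis
  exact hb.rk_pow k

lemma sum_list_sub (L : List ℕ) (k : ℕ) :
    (L.map (· - k)).sum = (L.map (· - (k + 1))).sum + cols (L : Multiset ℕ) k := by
  induction L with
  | nil => simp
  | cons a L ih =>
    rw [List.map_cons, List.map_cons, List.sum_cons, List.sum_cons, ih, ← Multiset.cons_coe,
      cols_cons]
    split_ifs <;> omega

/-- Splitting off cyclic summands one after the other: a nilpotent endomorphism of the range of a
commuting projection has a list of generators `a.2`, of chain lengths `a.1`. -/
lemma exists_list_generators [FiniteDimensional κ V] {f : End κ V} (hf : IsNilpotent f) (r : ℕ)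
    (P : End κ V) (hP : P * P = P) (hc : f * P = P * f) (hr : rk P = r) :
    ∃ L : List (ℕ × V), (∀ a ∈ L, 0 < a.1 ∧ (f ^ a.1) a.2 = 0) ∧ (L.map Prod.fst).sum = r ∧
      ∀ S : Submodule κ V, (∀ v ∈ S, f v ∈ S) → (∀ a ∈ L, a.2 ∈ S) → LinearMap.range P ≤ S := by
  induction r using Nat.strong_induction_on generalizing P with
  | _ r ih =>
    by_cases h0 : P = 0
    · subst h0
      refine ⟨[], by simp, ?_, fun S _ _ => ?_⟩
      · rw [← hr, rk, LinearMap.range_zero, finrank_bot]; rfl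
      · rw [LinearMap.range_zero]; exact bot_le
    obtain ⟨n, hn⟩ := hf
    obtain ⟨b, E, v, hb, hE, hPE, hEP, hfE, hrk, hv, hrange⟩ :=
      exists_cyclic_projection hP hc h0 ⟨n, by rw [hn, zero_mul]⟩
    have hrE : rk E = b := by simpa using hrk 0
    have hPr : rk P = rk (P - E) + b := by
      rw [rk_eq_add_of_commute hE (hEP.trans hPE.symm), hPE, hrE, sub_mul, one_mul, hEP]
    obtain ⟨L, h1, h2, h3⟩ := ih (rk (P - E)) (by omega) (P - E)
      (by rw [sub_mul, mul_sub, mul_sub, hP, hPE, hEP, hE]; abel)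
      (by rw [mul_sub, sub_mul, hc, hfE]) rfl
    refine ⟨(b, v) :: L, ?_, ?_, fun S hS hL => ?_⟩
    · rintro a ha
      rcases List.mem_cons.1 ha with rfl | ha
      · exact ⟨hb, hv⟩
      · exact h1 a ha
    · rw [List.map_cons, List.sum_cons, h2]; omega
    · have hpow : ∀ k, (f ^ k) v ∈ S := fun k => by
        induction k with
        | zero => simpa using hL _ List.mem_cons_self
        | succ k ih => rw [pow_succ', End.mul_apply]; exact hS _ ih
      have hES : LinearMap.range E ≤ S := by
        rw [hrange, Submodule.span_le]
        rintro _ ⟨j, rfl⟩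
        exact hpow j
      rintro _ ⟨u, rfl⟩
      have h4 : P u = (P - E) u + E u := by simp
      rw [h4]
      exact S.add_mem (h3 S hS (fun a ha => hL a (List.mem_cons_of_mem _ ha)) ⟨u, rfl⟩)
        (hES ⟨u, rfl⟩)

lemma generators_of_list [FiniteDimensional κ V] {f : End κ V} {L : List (ℕ × V)}
    (h1 : ∀ a ∈ L, (f ^ a.1) a.2 = 0) (h2 : (L.map Prod.fst).sum = finrank κ V)
    (h3 : ∀ S : Submodule κ V, (∀ v ∈ S, f v ∈ S) → (∀ a ∈ L, a.2 ∈ S) → S = ⊤) :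
    Generators f (fun i : Fin L.length => (L.get i).1) (fun i => (L.get i).2) where
  pow_eq_zero i := h1 _ (L.get_mem i)
  sum_eq := by
    rw [← h2, ← List.sum_ofFn]
    congr 1
    apply List.ext_getElem <;> simp
  eq_top S hS hw := h3 S hS fun a ha => by
    obtain ⟨i, rfl⟩ := List.mem_iff_get.1 ha
    exact hw i

lemma list_rk_pow [FiniteDimensional κ V] {f : End κ V} {L : List (ℕ × V)}
    (h1 : ∀ a ∈ L, (f ^ a.1) a.2 = 0) (h2 : (L.map Prod.fst).sum = finrank κ V)
    (h3 : ∀ S : Submodule κ V, (∀ v ∈ S, f v ∈ S) → (∀ a ∈ L, a.2 ∈ S) → S = ⊤) (k : ℕ) :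
    rk (f ^ k) = rk (f ^ (k + 1)) + cols (L.map Prod.fst : Multiset ℕ) k := by
  have key : ∀ k, rk (f ^ k) = ((L.map Prod.fst).map (· - k)).sum := fun k => by
    rw [(generators_of_list h1 h2 h3).rk_pow, ← List.sum_ofFn]
    congr 1
    apply List.ext_getElem <;> simp
  rw [key, key, sum_list_sub]

/-- Nilpotent endomorphisms whose powers have equal ranks are conjugate. -/
theorem exists_intertwiner [FiniteDimensional κ V] {f g : End κ V} (hf : IsNilpotent f)
    (hg : IsNilpotent g) (h : ∀ k, rk (f ^ k) = rk (g ^ k)) :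
    ∃ e : V ≃ₗ[κ] V, ∀ v, e (f v) = g (e v) := by
  have htop : ∀ {f : End κ V}, IsNilpotent f → ∃ L : List (ℕ × V),
      (∀ a ∈ L, 0 < a.1) ∧ (∀ a ∈ L, (f ^ a.1) a.2 = 0) ∧
      (L.map Prod.fst).sum = finrank κ V ∧
      ∀ S : Submodule κ V, (∀ v ∈ S, f v ∈ S) → (∀ a ∈ L, a.2 ∈ S) → S = ⊤ := by
    intro f hf
    obtain ⟨L, h1, h2, h3⟩ := exists_list_generators hf _ 1 (one_mul 1) (by simp) rfl
    refine ⟨L, fun a ha => (h1 a ha).1, fun a ha => (h1 a ha).2, ?_, fun S hS hL => ?_⟩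
    · rw [h2, rk, show (1 : End κ V) = LinearMap.id from rfl, LinearMap.range_id, finrank_top]
    · have := h3 S hS hL
      rwa [show (1 : End κ V) = LinearMap.id from rfl, LinearMap.range_id, top_le_iff] at this
  obtain ⟨L, p1, h1, h2, h3⟩ := htop hf
  obtain ⟨M, q1, k1, k2, k3⟩ := htop hg
  have hLM : (L.map Prod.fst : Multiset ℕ) = (M.map Prod.fst : Multiset ℕ) := by
    apply eq_of_cols_eq
    · simpa using fun a b hab => p1 _ hab
    · simpa using fun a b hab => q1 _ hab
    · intro k
      have e1 := list_rk_pow h1 h2 h3 k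
      have e2 := list_rk_pow k1 k2 k3 k
      rw [h, h] at e1
      omega
  -- reorder the generators of `g` so that their lengths match those of `f`
  obtain ⟨M', hM', hperm⟩ : ∃ M', List.Forall₂ (fun (n : ℕ) (a : ℕ × V) => n = a.1)
      (L.map Prod.fst) M' ∧ List.Perm M' M :=
    List.perm_comp_forall₂ (Multiset.coe_eq_coe.1 hLM)
      (by rw [List.forall₂_map_left_iff]; exact List.forall₂_same.2 fun _ _ => rfl)
  rw [List.forall₂_map_left_iff, List.forall₂_iff_get] at hM'
  obtain ⟨hlen, hget⟩ := hM'
  obtain ⟨b, hb⟩ := (generators_of_list h1 h2 h3).exists_isJordanBasis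
  have G : Generators g (fun i : Fin L.length => (L.get i).1)
      (fun i => (M'.get (Fin.cast hlen i)).2) := by
    have G' := generators_of_list (f := g) (L := M') (fun a ha => k1 a (hperm.subset ha))
      (by rw [← k2]; exact (hperm.map _).sum_eq)
      (fun S hS hw => k3 S hS fun a ha => hw a (hperm.symm.subset ha))
    have hl : ∀ i : Fin L.length, (L.get i).1 = (M'.get (Fin.cast hlen i)).1 := fun i =>
      hget i i.2 (hlen ▸ i.2)
    refine ⟨fun i => ?_, ?_, fun S hS hw => ?_⟩
    · simp only [hl]
      exact G'.pow_eq_zero _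
    · simp only [hl]
      rw [← G'.sum_eq]
      exact (finCongr hlen).sum_comp fun i => (M'.get i).1
    · refine G'.eq_top S hS fun i => ?_
      have := hw (Fin.cast hlen.symm i)
      simpa using this
  obtain ⟨c, hc⟩ := G.exists_isJordanBasis
  refine ⟨b.equiv c (Equiv.refl _), fun v => ?_⟩
  have : (b.equiv c (Equiv.refl _)).toLinearMap ∘ₗ f =
      g ∘ₗ (b.equiv c (Equiv.refl _)).toLinearMap := by
    refine b.ext fun ⟨a, j, hj⟩ => ?_
    simp only [LinearMap.comp_apply, LinearEquiv.coe_coe, Basis.equiv_apply, Equiv.refl_apply]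
    rw [hb, hc]
    split_ifs
    · rw [map_zero]
    · rw [Basis.equiv_apply]; rfl
  exact LinearMap.congr_fun this v

open Matrix

/-- The matrix form of `exists_intertwiner`. -/
theorem exists_isUnit_mul_eq {n : Type*} [Fintype n] [DecidableEq n] {x y : Matrix n n κ}
    (hx : IsNilpotent x) (hy : IsNilpotent y) (h : ∀ k, (x ^ k).rank = (y ^ k).rank) :
    ∃ g : (Matrix n n κ)ˣ, (g : Matrix n n κ) * x = y * g := by
  set φ := Matrix.toLinAlgEquiv' (R := κ) (n := n) with hφ
  obtain ⟨e, he⟩ := exists_intertwiner (f := φ x) (g := φ y) (hx.map φ) (hy.map φ)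
    (fun k => by rw [← map_pow, ← map_pow]; exact h k)
  set a := φ.symm e.toLinearMap
  set b := φ.symm e.symm.toLinearMap
  refine ⟨⟨a, b, ?_, ?_⟩, ?_⟩
  · apply φ.injective
    refine LinearMap.ext fun v => ?_
    simp [a, b, map_mul]
  · apply φ.injective
    refine LinearMap.ext fun v => ?_
    simp [a, b, map_mul]
  · apply φ.injective
    simp only [a, map_mul, AlgEquiv.apply_symm_apply]
    exact LinearMap.ext he

/-- The ranks of the powers of `x` are those of a direct sum of nilpotent Jordan blocks whose sizes
form the multiset `s`. This is `HasRanks` for arbitrary index types and multisets; elements `0` of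
`s` are irrelevant. -/
def RankType {n : Type*} [Fintype n] [DecidableEq n] (x : Matrix n n κ) (s : Multiset ℕ) : Prop :=
  ∀ k, (x ^ k).rank = (x ^ (k + 1)).rank + cols s k

lemma rankType_of_generators {n : Type*} [Fintype n] [DecidableEq n] {x : Matrix n n κ}
    {L : List (ℕ × (n → κ))} (h1 : ∀ a ∈ L, (x ^ a.1) *ᵥ a.2 = 0)
    (h2 : (L.map Prod.fst).sum = Fintype.card n)
    (h3 : ∀ S : Submodule κ (n → κ), (∀ v ∈ S, x *ᵥ v ∈ S) → (∀ a ∈ L, a.2 ∈ S) → S = ⊤) :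
    RankType x (L.map Prod.fst : Multiset ℕ) := fun k => by
  rw [rank_eq_rk, rank_eq_rk, map_pow, map_pow]
  apply list_rk_pow
  · intro a ha
    rw [← map_pow]
    exact h1 a ha
  · rw [h2, finrank_fintype_fun_eq_card]
  · exact h3

lemma HasJordanType.hasRanks {N : ℕ} {x : Matrix (Fin N) (Fin N) κ} {p : N.Partition}
    (h : HasJordanType x p) : HasRanks x p := by
  obtain ⟨L, b, hL, hb⟩ := h
  have hb' : IsJordanBasis (Matrix.toLinAlgEquiv' x) b := hb
  have key : ∀ k, (x ^ k).rank = (L.map (· - k)).sum := fun k => by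
    rw [rank_eq_rk, map_pow, hb'.rk_pow, ← List.sum_ofFn]
    congr 1
    apply List.ext_getElem <;> simp
  intro k
  rw [key, key, sum_list_sub, hL]

end Jordan

/-! ### Square roots and isometries -/

section Transport

open Matrix

variable {κ : Type*} [Field κ] {n : Type*} [Fintype n] [DecidableEq n]

/-- A split monic polynomial divides a power of every polynomial which vanishes at its roots. -/
lemma dvd_pow_card_roots {p q : κ[X]} (hp : p.Monic) (hs : p.Splits)
    (h : ∀ a ∈ p.roots, q.eval a = 0) : p ∣ q ^ p.roots.card := by
  have key : ∀ s : Multiset κ, (∀ a ∈ s, q.eval a = 0) →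
      (s.map fun a => Polynomial.X - Polynomial.C a).prod ∣ q ^ s.card := by
    intro s hs
    induction s using Multiset.induction with
    | empty => simp
    | cons a s ih =>
      rw [Multiset.map_cons, Multiset.prod_cons, Multiset.card_cons, pow_succ']
      exact mul_dvd_mul (Polynomial.dvd_iff_isRoot.2 (hs a (Multiset.mem_cons_self a s)))
        (ih fun c hc => hs c (Multiset.mem_cons_of_mem hc))
  have := key p.roots h
  rwa [← hs.eq_prod_roots_of_monic hp] at this

/-- An invertible matrix has a square root which is a polynomial in it. By interpolation there is a
polynomial `f` with `f(a) ^ 2 = a` for every eigenvalue `a`; then `f(A) ^ 2 - A` is nilpotent, and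
Newton's method in the commutative ring `κ[A]` improves `f(A)` to a square root. -/
theorem exists_aeval_sq_eq [IsAlgClosed κ] (h2 : (2 : κ) ≠ 0) {A : Matrix n n κ} (hA : IsUnit A) :
    ∃ f : κ[X], Polynomial.aeval A f * Polynomial.aeval A f = A := by
  classical
  set R := Algebra.adjoin κ {A} with hR
  have : IsMulCommutative R := Algebra.isMulCommutative_adjoin κ (by simp +contextual)
  set a : R := ⟨A, Algebra.self_mem_adjoin_singleton κ A⟩ with ha
  have hval : ∀ f : κ[X], ((Polynomial.aeval a f : R) : Matrix n n κ) = Polynomial.aeval A f :=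
    fun f => by
      have := Polynomial.aeval_algHom_apply R.val a f
      exact this.symm
  set p := A.charpoly with hp
  have hpa : Polynomial.aeval a p = 0 := by
    apply Subtype.ext
    rw [hval, hp, Matrix.aeval_self_charpoly]; rfl
  have hp0 : p.eval 0 ≠ 0 := by
    rw [hp, Matrix.eval_charpoly]
    simp only [map_zero, zero_sub, Matrix.det_neg]
    refine mul_ne_zero (pow_ne_zero _ (by simp)) ?_
    exact ((Matrix.isUnit_iff_isUnit_det A).1 hA).ne_zero
  have hua : IsUnit a := by
    have h1 : a * Polynomial.aeval a p.divX = -algebraMap κ R (p.eval 0) := by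
      have h3 := congrArg (Polynomial.aeval a) p.X_mul_divX_add
      rw [hpa, map_add, map_mul, Polynomial.aeval_X, Polynomial.aeval_C,
        Polynomial.coeff_zero_eq_eval_zero] at h3
      exact eq_neg_of_add_eq_zero_left h3
    refine isUnit_of_mul_isUnit_left (y := Polynomial.aeval a p.divX) ?_
    rw [h1]
    exact (((isUnit_iff_ne_zero.2 hp0).map (algebraMap κ R))).neg
  choose r hr using fun c : κ => IsAlgClosed.exists_pow_nat_eq c (n := 2) (by norm_num)
  set f := Lagrange.interpolate p.roots.toFinset id r with hf
  have hfa : ∀ c ∈ p.roots, f.eval c = r c := fun c hc =>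
    Lagrange.eval_interpolate_at_node (v := id) r (Function.injective_id.injOn)
      (Multiset.mem_toFinset.2 hc)
  set y : R := Polynomial.aeval a f with hy
  have hnil : IsNilpotent (y ^ 2 - a) := by
    obtain ⟨c, hc⟩ := dvd_pow_card_roots (q := f ^ 2 - Polynomial.X) (Matrix.charpoly_monic A)
      (IsAlgClosed.splits p) (fun c hc => by
        rw [Polynomial.eval_sub, Polynomial.eval_pow, hfa c hc, hr, Polynomial.eval_X, sub_self])
    have h3 := congrArg (Polynomial.aeval a) hc
    rw [map_mul, ← hp, hpa, zero_mul, map_pow, map_sub, map_pow, Polynomial.aeval_X] at h3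
    exact ⟨_, h3⟩
  have huy : IsUnit y := by
    have h1 : IsUnit (a + (y ^ 2 - a)) := hnil.isUnit_add_left_of_commute hua (Commute.all _ _)
    rw [add_sub_cancel] at h1
    exact (isUnit_pow_iff two_ne_zero).1 h1
  obtain ⟨c, ⟨-, hc⟩, -⟩ := Polynomial.existsUnique_nilpotent_sub_and_aeval_eq_zero
    (P := (Polynomial.X ^ 2 - Polynomial.C a : R[X])) (x := y)
    (by rw [map_sub, map_pow, Polynomial.aeval_X, Polynomial.aeval_C]; exact hnil) (by
      have h1 : (2 : R) = algebraMap κ R 2 := (map_ofNat (algebraMap κ R) 2).symm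
      have h3 : IsUnit (2 * y) := by
        rw [h1]; exact ((isUnit_iff_ne_zero.2 h2).map _).mul huy
      simpa [Polynomial.derivative_X_pow, one_add_one_eq_two] using h3)
  have hc' : c * c = a := by
    rw [map_sub, map_pow, Polynomial.aeval_X, Polynomial.aeval_C, sub_eq_zero, sq] at hc
    exact hc
  obtain ⟨g, hg⟩ : (c : Matrix n n κ) ∈ (Polynomial.aeval A).range := by
    rw [← Algebra.adjoin_singleton_eq_range_aeval κ A]
    exact c.2
  refine ⟨g, ?_⟩
  have hg' : Polynomial.aeval A g = c := hg
  rw [hg']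
  exact congrArg Subtype.val hc'

/-- If `h` intertwines `x₁` and `x₂`, which are skew for the symmetric forms `B₁` and `B₂`, then `h`
may be corrected to an isometry with the same property: it is divided by the square root of
`B₁⁻¹ hᵀ B₂ h`, which is `B₁`-selfadjoint and commutes with `x₁`. -/
theorem exists_isometry_mul_eq [IsAlgClosed κ] (h2 : (2 : κ) ≠ 0) {B₁ B₂ x₁ x₂ : Matrix n n κ}
    (u₁ : IsUnit B₁) (u₂ : IsUnit B₂) (s₁ : B₁ᵀ = B₁) (s₂ : B₂ᵀ = B₂)
    (hx₁ : x₁ᵀ * B₁ = -(B₁ * x₁)) (hx₂ : x₂ᵀ * B₂ = -(B₂ * x₂)) (h : (Matrix n n κ)ˣ)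
    (hh : (h : Matrix n n κ) * x₁ = x₂ * h) :
    ∃ g : (Matrix n n κ)ˣ, (g : Matrix n n κ)ᵀ * B₂ * g = B₁ ∧ (g : Matrix n n κ) * x₁ = x₂ * g := by
  obtain ⟨b, rfl⟩ := u₁
  set H : Matrix n n κ := (h : Matrix n n κ) with hH
  set A : Matrix n n κ := (b⁻¹ : (Matrix n n κ)ˣ) * (Hᵀ * B₂ * H) with hA
  have hbA : (b : Matrix n n κ) * A = Hᵀ * B₂ * H := by
    rw [hA, ← mul_assoc, Units.mul_inv, one_mul]
  have hAb : Aᵀ * (b : Matrix n n κ) = b * A := by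
    have h1 := congrArg Matrix.transpose hbA
    rw [transpose_mul, s₁] at h1
    rw [h1, hbA]
    simp only [transpose_mul, transpose_transpose, s₂, mul_assoc]
  have hHT : IsUnit Hᵀ := (Matrix.isUnit_transpose H).2 h.isUnit
  have huA : IsUnit A := (b⁻¹).isUnit.mul ((hHT.mul u₂).mul h.isUnit)
  have hcomm : A * x₁ = x₁ * A := by
    apply b.isUnit.mul_left_cancel
    have h1 := congrArg Matrix.transpose hh
    rw [transpose_mul, transpose_mul] at h1
    calc (b : Matrix n n κ) * (A * x₁) = Hᵀ * B₂ * (H * x₁) := by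
          rw [← mul_assoc, hbA, mul_assoc]
      _ = -(-(Hᵀ * (B₂ * x₂) * H)) := by rw [hh]; simp only [mul_assoc, neg_neg]
      _ = -(Hᵀ * x₂ᵀ * B₂ * H) := by
          rw [mul_assoc Hᵀ x₂ᵀ, hx₂]; simp only [mul_neg, neg_mul]
      _ = -(x₁ᵀ * (b * A)) := by rw [← h1, hbA]; simp only [mul_assoc]
      _ = b * (x₁ * A) := by rw [← mul_assoc, hx₁, neg_mul, neg_neg, mul_assoc]
  obtain ⟨f, hf⟩ := exists_aeval_sq_eq h2 huA
  set C := Polynomial.aeval A f with hC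
  clear_value A
  have hCx : C * x₁ = x₁ * C := by
    have h1 : Commute x₁ A := hcomm.symm
    have h3 : Commute x₁ C := by
      rw [hC, Polynomial.aeval_eq_sum_range]
      exact Commute.sum_right _ _ _ fun i _ => (h1.pow_right i).smul_right _
    exact h3.symm.eq
  have hCb : Cᵀ * (b : Matrix n n κ) = b * C := by
    have h1 : ∀ k, (A ^ k)ᵀ * (b : Matrix n n κ) = (b : Matrix n n κ) * A ^ k := fun k => by
      induction k with
      | zero => simp
      | succ k ih =>
        rw [pow_succ, transpose_mul, mul_assoc, ih, ← mul_assoc, hAb, mul_assoc, ← pow_succ',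
          pow_succ]
    rw [hC, Polynomial.aeval_eq_sum_range, transpose_sum, Finset.sum_mul, Finset.mul_sum]
    refine Finset.sum_congr rfl fun k _ => ?_
    rw [transpose_smul, smul_mul_assoc, mul_smul_comm, h1]
  have huC : IsUnit C := by
    rw [← hf] at huA
    rw [Matrix.isUnit_iff_isUnit_det] at huA ⊢
    rw [det_mul] at huA
    exact isUnit_of_mul_isUnit_left huA
  obtain ⟨c, hc⟩ := huC
  have hcc : C * ((c⁻¹ : (Matrix n n κ)ˣ) : Matrix n n κ) = 1 := by rw [← hc, Units.mul_inv]
  have hcc' : ((c⁻¹ : (Matrix n n κ)ˣ) : Matrix n n κ)ᵀ * Cᵀ = 1 := by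
    rw [← transpose_mul, hcc, transpose_one]
  refine ⟨h * c⁻¹, ?_, ?_⟩
  · rw [Units.val_mul, ← hH, transpose_mul]
    calc _ = ((c⁻¹ : (Matrix n n κ)ˣ) : Matrix n n κ)ᵀ * (Hᵀ * B₂ * H) *
          ((c⁻¹ : (Matrix n n κ)ˣ) : Matrix n n κ) := by simp only [mul_assoc]
      _ = ((c⁻¹ : (Matrix n n κ)ˣ) : Matrix n n κ)ᵀ * (b * C) *
          (C * ((c⁻¹ : (Matrix n n κ)ˣ) : Matrix n n κ)) := by
          rw [← hbA, ← hf]; simp only [mul_assoc]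
      _ = b := by rw [hcc, mul_one, ← hCb, ← mul_assoc, hcc', one_mul]
  · have h3 : ((c⁻¹ : (Matrix n n κ)ˣ) : Matrix n n κ) * x₁ = x₁ * (c⁻¹ : (Matrix n n κ)ˣ) := by
      rw [Units.inv_mul_eq_iff_eq_mul, ← mul_assoc, hc, hCx, mul_assoc, hcc, mul_one]
    rw [Units.val_mul, ← hH, mul_assoc, h3, ← mul_assoc, hh, mul_assoc]

/-- Skew nilpotent matrices whose powers have equal ranks lie in one orbit. -/
theorem mem_orbit_of_rank_eq [IsAlgClosed κ] (h2 : (2 : κ) ≠ 0) {N : ℕ}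
    {x y : Matrix (Fin N) (Fin N) κ} (hx : x ∈ nilCone κ N) (hy : y ∈ nilCone κ N)
    (h : ∀ k, (x ^ k).rank = (y ^ k).rank) : y ∈ orbit x := by
  obtain ⟨e, he⟩ := exists_isUnit_mul_eq hx.2 hy.2 h
  have hu : IsUnit (Omega κ N) := IsUnit.of_mul_eq_one _ Omega_mul_self
  obtain ⟨g, hg, hgx⟩ := exists_isometry_mul_eq h2 hu hu Omega_transpose Omega_transpose
    (eq_neg_of_add_eq_zero_left hx.1) (eq_neg_of_add_eq_zero_left hy.1) e he
  refine ⟨g, hg, ?_⟩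
  rw [conj, hgx, mul_assoc, ← Units.val_mul, mul_inv_cancel, Units.val_one, mul_one]

end Transport

/-! ### Graded models of degenerations -/

section Models

open Matrix

variable {κ : Type*} [Field κ]

lemma rank_fromBlocks_zero {m n : Type*} [Fintype m] [Fintype n] [DecidableEq m] [DecidableEq n]
    (A : Matrix m m κ) (D : Matrix n n κ) : (fromBlocks A 0 0 D).rank = A.rank + D.rank := by
  have h := rank_eq_add_of_commute (E := fromBlocks (0 : Matrix m m κ) 0 0 (1 : Matrix n n κ))
    (f := fromBlocks A 0 0 D) (by simp [fromBlocks_multiply]) (by simp [fromBlocks_multiply])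
  have e1 : (1 - fromBlocks (0 : Matrix m m κ) 0 0 (1 : Matrix n n κ)) * fromBlocks A 0 0 D =
      fromBlocks A 0 0 0 := by
    rw [← fromBlocks_one, sub_eq_add_neg, fromBlocks_neg, fromBlocks_add]
    simp [fromBlocks_multiply]
  have e2 : (fromBlocks A 0 0 D) * fromBlocks (0 : Matrix m m κ) 0 0 (1 : Matrix n n κ) =
      fromBlocks 0 0 0 D := by simp [fromBlocks_multiply]
  have hA : (fromBlocks A 0 0 (0 : Matrix n n κ)).rank = A.rank := by
    apply le_antisymm
    · have : fromBlocks A 0 0 (0 : Matrix n n κ) =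
          (fromRows 1 0 : Matrix (m ⊕ n) m κ) * A * (fromCols 1 0 : Matrix m (m ⊕ n) κ) := by
        rw [fromRows_mul]
        ext (i | i) (j | j) <;> simp
      rw [this]
      exact (rank_mul_le_left _ _).trans (rank_mul_le_right _ _)
    · have : A = (fromCols 1 0 : Matrix m (m ⊕ n) κ) * fromBlocks A 0 0 (0 : Matrix n n κ) *
          (fromRows 1 0 : Matrix (m ⊕ n) m κ) := by
        simp [fromCols_mul_fromBlocks, fromCols_mul_fromRows]
      conv_lhs => rw [this]
      exact (rank_mul_le_left _ _).trans (rank_mul_le_right _ _)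
  have hD : (fromBlocks (0 : Matrix m m κ) 0 0 D).rank = D.rank := by
    apply le_antisymm
    · have : fromBlocks (0 : Matrix m m κ) 0 0 D =
          (fromRows 0 1 : Matrix (m ⊕ n) n κ) * D * (fromCols 0 1 : Matrix n (m ⊕ n) κ) := by
        rw [fromRows_mul]
        ext (i | i) (j | j) <;> simp
      rw [this]
      exact (rank_mul_le_left _ _).trans (rank_mul_le_right _ _)
    · have : D = (fromCols 0 1 : Matrix n (m ⊕ n) κ) * fromBlocks (0 : Matrix m m κ) 0 0 D *
          (fromRows 0 1 : Matrix (m ⊕ n) n κ) := by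
        simp [fromCols_mul_fromBlocks, fromCols_mul_fromRows]
      conv_lhs => rw [this]
      exact (rank_mul_le_left _ _).trans (rank_mul_le_right _ _)
  rw [h, e1, e2, hA, hD]

lemma RankType.fromBlocks {m n : Type*} [Fintype m] [Fintype n] [DecidableEq m] [DecidableEq n]
    {A : Matrix m m κ} {D : Matrix n n κ} {s t : Multiset ℕ} (hA : RankType A s)
    (hD : RankType D t) : RankType (fromBlocks A 0 0 D) (s + t) := fun k => by
  rw [fromBlocks_diagonal_pow, fromBlocks_diagonal_pow, rank_fromBlocks_zero, rank_fromBlocks_zero,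
    hA k, hD k, cols_add]
  omega

lemma RankType.neg_transpose {n : Type*} [Fintype n] [DecidableEq n]
    {A : Matrix n n κ} {s : Multiset ℕ} (hA : RankType A s) : RankType (-Aᵀ) s := by
  have h1 : ∀ k, ((-Aᵀ) ^ k).rank = (A ^ k).rank := fun k => by
    rw [neg_pow Aᵀ k, ← transpose_pow]
    have h2 : IsUnit (((-1 : Matrix n n κ) ^ k).det) := by
      rw [det_pow]
      exact ((Matrix.isUnit_iff_isUnit_det _).1 (isUnit_one (M := Matrix n n κ)).neg).pow k
    rw [rank_mul_eq_right_of_isUnit_det _ _ h2, rank_transpose]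
  intro k
  rw [h1, h1]
  exact hA k

lemma RankType.reindex {m n : Type*} [Fintype m] [Fintype n] [DecidableEq m] [DecidableEq n]
    {A : Matrix m m κ} {s : Multiset ℕ} (hA : RankType A s) (e : m ≃ n) :
    RankType (A.submatrix e.symm e.symm) s := fun k => by
  have h : ∀ k, (A.submatrix e.symm e.symm) ^ k = (A ^ k).submatrix e.symm e.symm := fun k =>
    (map_pow (Matrix.reindexAlgEquiv κ κ e) A k).symm
  rw [h, h, rank_submatrix, rank_submatrix]
  exact hA k

/-- A skew matrix `x` for the symmetric form `B`, of Jordan type `s`, together with a grading by the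
weights `wt` of the coordinates which is compatible with `B` and for which `x` has nonnegative
weights and component of weight zero `z`, of Jordan type `t`. The cocharacter which acts by the
weights then moves `x` to the limit `z`. -/
structure IsModel {ι : Type} [Fintype ι] [DecidableEq ι] (B x z : Matrix ι ι κ) (wt : ι → ℤ)
    (s t : Multiset ℕ) : Prop where
  transpose_eq : Bᵀ = B
  isUnit : IsUnit B
  skew : xᵀ * B = -(B * x)
  form_wt : ∀ i j, B i j ≠ 0 → wt i + wt j = 0
  upper : ∀ i j, x i j ≠ 0 → wt j ≤ wt i
  limit : ∀ i j, z i j = if wt i = wt j then x i j else 0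
  rankType : RankType x s
  rankType_limit : RankType z t
  card_eq : Fintype.card ι = s.sum

/-- Some model over `κ` has type `s` and a limit of type `t`. -/
def Realizable (κ : Type*) [Field κ] (s t : Multiset ℕ) : Prop :=
  ∃ (ι : Type) (_ : Fintype ι) (_ : DecidableEq ι) (B x z : Matrix ι ι κ) (wt : ι → ℤ),
    IsModel B x z wt s t

lemma Realizable.zero : Realizable κ 0 0 :=
  ⟨Fin 0, inferInstance, inferInstance, 1, 0, 0, 0,
    { transpose_eq := by simp
      isUnit := isUnit_one
      skew := by simp
      form_wt := fun i => i.elim0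
      upper := fun i => i.elim0
      limit := fun i => i.elim0
      rankType := fun k => by simp [Subsingleton.elim _ (0 : Matrix (Fin 0) (Fin 0) κ)]
      rankType_limit := fun k => by simp [Subsingleton.elim _ (0 : Matrix (Fin 0) (Fin 0) κ)]
      card_eq := by simp }⟩

lemma Realizable.add {s t s' t' : Multiset ℕ} (h : Realizable κ s t) (h' : Realizable κ s' t') :
    Realizable κ (s + s') (t + t') := by
  obtain ⟨ι, _, _, B, x, z, wt, M⟩ := h
  obtain ⟨ι', _, _, B', x', z', wt', M'⟩ := h'
  refine ⟨ι ⊕ ι', inferInstance, inferInstance, fromBlocks B 0 0 B', fromBlocks x 0 0 x',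
    fromBlocks z 0 0 z', Sum.elim wt wt', ?_, ?_, ?_, ?_, ?_, ?_, M.rankType.fromBlocks M'.rankType,
    M.rankType_limit.fromBlocks M'.rankType_limit, ?_⟩
  · simp [fromBlocks_transpose, M.transpose_eq, M'.transpose_eq]
  · rw [Matrix.isUnit_iff_isUnit_det, det_fromBlocks_zero₂₁]
    exact ((Matrix.isUnit_iff_isUnit_det _).1 M.isUnit).mul
      ((Matrix.isUnit_iff_isUnit_det _).1 M'.isUnit)
  · simp [fromBlocks_transpose, fromBlocks_multiply, fromBlocks_neg, M.skew, M'.skew]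
  · rintro (i | i) (j | j) hij <;> simp at hij ⊢
    · exact M.form_wt i j hij
    · exact M'.form_wt i j hij
  · rintro (i | i) (j | j) hij <;> simp at hij ⊢
    · exact M.upper i j hij
    · exact M'.upper i j hij
  · rintro (i | i) (j | j)
    · exact M.limit i j
    · exact (ite_self _).symm
    · exact (ite_self _).symm
    · exact M'.limit i j
  · rw [Fintype.card_sum, M.card_eq, M'.card_eq, Multiset.sum_add]

/-- The hyperbolic double `x ⊕ -xᵀ` of an arbitrary graded matrix. -/
lemma Realizable.double {ι : Type} [Fintype ι] [DecidableEq ι] {x z : Matrix ι ι κ} {wt : ι → ℤ}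
    {s t : Multiset ℕ} (upper : ∀ i j, x i j ≠ 0 → wt j ≤ wt i)
    (limit : ∀ i j, z i j = if wt i = wt j then x i j else 0) (hx : RankType x s)
    (hz : RankType z t) (hc : Fintype.card ι = s.sum) : Realizable κ (s + s) (t + t) := by
  refine ⟨ι ⊕ ι, inferInstance, inferInstance, fromBlocks 0 1 1 0, fromBlocks x 0 0 (-xᵀ),
    fromBlocks z 0 0 (-zᵀ), Sum.elim wt fun i => -wt i, ?_, ?_, ?_, ?_, ?_, ?_,
    hx.fromBlocks hx.neg_transpose, hz.fromBlocks hz.neg_transpose, ?_⟩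
  · simp [fromBlocks_transpose]
  · exact IsUnit.of_mul_eq_one (fromBlocks 0 1 1 0) (by simp [fromBlocks_multiply])
  · simp [fromBlocks_transpose, fromBlocks_multiply, fromBlocks_neg]
  · rintro (i | i) (j | j) hij <;> simp [Matrix.one_apply] at hij ⊢ <;> subst hij <;> simp
  · rintro (i | i) (j | j) hij <;> simp at hij ⊢
    · exact upper i j hij
    · exact upper j i hij
  · rintro (i | i) (j | j)
    · exact limit i j
    · exact (ite_self _).symm
    · exact (ite_self _).symm
    · change -z j i = if -wt i = -wt j then -x j i else 0
      rw [limit j i]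
      by_cases h : wt i = wt j
      · rw [if_pos h.symm, if_pos (by rw [h])]
      · rw [if_neg (Ne.symm h), if_neg (by simpa using h), neg_zero]
  · rw [Fintype.card_sum, hc, Multiset.sum_add]

/-- The form which pairs the basis vectors according to the involution `τ`, with signs `σ`, is
symmetric and invertible, and an entrywise criterion for a matrix to be skew with respect to it. -/
lemma signedPerm_form {ι : Type} [Fintype ι] [DecidableEq ι] {τ : ι → ι} {σ : ι → κ}
    (hτ : ∀ i, τ (τ i) = i) (hσ : ∀ i, σ (τ i) = σ i) (hσ' : ∀ i, σ i * σ i = 1)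
    {x : Matrix ι ι κ} (hx : ∀ i j, σ j * x (τ j) i + σ i * x (τ i) j = 0) :
    (Matrix.of fun i j => if j = τ i then σ i else 0)ᵀ =
      (Matrix.of fun i j => if j = τ i then σ i else 0) ∧
    IsUnit (Matrix.of fun i j => if j = τ i then σ i else 0) ∧
    xᵀ * (Matrix.of fun i j => if j = τ i then σ i else 0) =
      -((Matrix.of fun i j => if j = τ i then σ i else 0) * x) := by
  have hτ' : ∀ i j, j = τ i ↔ i = τ j := fun i j => by
    constructor <;> (rintro rfl; rw [hτ])
  refine ⟨?_, IsUnit.of_mul_eq_one (Matrix.of fun i j => if j = τ i then σ i else 0) ?_, ?_⟩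
  · ext i j
    simp only [transpose_apply, Matrix.of_apply]
    by_cases h : j = τ i
    · rw [if_pos h, if_pos ((hτ' i j).1 h), h, hσ]
    · rw [if_neg h, if_neg fun h' => h ((hτ' i j).2 h')]
  · ext i j
    rw [Matrix.mul_apply, Finset.sum_eq_single (τ i)]
    · simp only [Matrix.of_apply, if_true, hτ, hσ, mul_ite, hσ', mul_zero, Matrix.one_apply]
      simp only [eq_comm]
    · intro k _ hk
      simp [hk]
    · simp
  · ext i j
    rw [Matrix.neg_apply, Matrix.mul_apply, Matrix.mul_apply]
    simp only [Matrix.of_apply, transpose_apply, mul_ite, mul_zero, ite_mul, zero_mul,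
      Finset.sum_ite_eq', Finset.mem_univ, if_true]
    rw [Finset.sum_congr rfl fun k _ => by rw [if_congr (hτ' k j) rfl rfl]]
    rw [Finset.sum_ite_eq', if_pos (Finset.mem_univ _), hσ, mul_comm]
    exact eq_neg_of_add_eq_zero_left (hx i j)

end Models

/-! ### Chain matrices -/

section Chains

open Matrix

variable {κ : Type*} [Field κ]

/-- The sign `(-1) ^ i`. -/
def sgn (κ : Type*) [Field κ] (i : ℕ) : κ := if i % 2 = 0 then 1 else -1

lemma sgn_mul_self (i : ℕ) : sgn κ i * sgn κ i = 1 := by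
  unfold sgn; split_ifs <;> simp

/-- The chain matrix: on the basis `e_0, …, e_{a-1}`, `f_0, …, f_{a-1}`, `u_0, …, u_{t-1}` it maps
each vector to the one before it, except that `ε e_α` is added to the image of `u_β` and, to remain
skew, `ε u_{t-1-β}` is added to the image of `f_{a-1-α}`. -/
def chainMatrix (a t α β : ℕ) (ε : κ) :
    Matrix (Fin a ⊕ Fin a ⊕ Fin t) (Fin a ⊕ Fin a ⊕ Fin t) κ :=
  Matrix.of fun i j => match i, j with
    | Sum.inl i, Sum.inl j => if (i : ℕ) + 1 = j then 1 else 0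
    | Sum.inr (Sum.inl i), Sum.inr (Sum.inl j) => if (i : ℕ) + 1 = j then 1 else 0
    | Sum.inr (Sum.inr i), Sum.inr (Sum.inr j) => if (i : ℕ) + 1 = j then 1 else 0
    | Sum.inl i, Sum.inr (Sum.inr j) => if (i : ℕ) = α ∧ (j : ℕ) = β then ε else 0
    | Sum.inr (Sum.inr i), Sum.inr (Sum.inl j) =>
      if (i : ℕ) + β + 1 = t ∧ (j : ℕ) + α + 1 = a then ε else 0
    | _, _ => 0

/-- The pairing `e_i ↔ f_{a-1-i}`, `u_i ↔ u_{t-1-i}` of the basis vectors. -/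
def chainDual (a t : ℕ) : Fin a ⊕ Fin a ⊕ Fin t → Fin a ⊕ Fin a ⊕ Fin t
  | Sum.inl i => Sum.inr (Sum.inl i.rev)
  | Sum.inr (Sum.inl i) => Sum.inl i.rev
  | Sum.inr (Sum.inr i) => Sum.inr (Sum.inr i.rev)

/-- The signs of the pairing; `γ` is the sign on the piece spanned by the `u_i`. -/
def chainSign (a t γ : ℕ) : Fin a ⊕ Fin a ⊕ Fin t → κ
  | Sum.inl i => sgn κ i
  | Sum.inr (Sum.inl i) => sgn κ (a - 1 - i)
  | Sum.inr (Sum.inr i) => sgn κ (γ + i)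

lemma chainDual_chainDual (a t : ℕ) (i) : chainDual a t (chainDual a t i) = i := by
  rcases i with i | i | i <;> simp [chainDual]

lemma chainSign_chainDual {a t : ℕ} (γ : ℕ) (ht : Odd t) (i) :
    chainSign (κ := κ) a t γ (chainDual a t i) = chainSign a t γ i := by
  rcases i with i | i | i
  · simp only [chainDual, chainSign, Fin.val_rev]
    congr 1; have := i.2; omega
  · simp only [chainDual, chainSign, Fin.val_rev]
    congr 1; omega
  · simp only [chainDual, chainSign, Fin.val_rev, sgn]
    obtain ⟨r, rfl⟩ := ht
    have := i.2
    rw [if_congr (show (γ + (2 * r + 1 - (i + 1))) % 2 = 0 ↔ (γ + i) % 2 = 0 by omega) rfl rfl]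

lemma chainMatrix_skew {a t α β : ℕ} (ht : Odd t) (ε : κ) (i j) :
    chainSign a t (α + β + 1) j * chainMatrix a t α β ε (chainDual a t j) i +
      chainSign a t (α + β + 1) i * chainMatrix a t α β ε (chainDual a t i) j = 0 := by
  obtain ⟨r, rfl⟩ := ht
  rcases i with i | i | i <;> rcases j with j | j | j <;>
    simp only [chainSign, chainDual, chainMatrix, Matrix.of_apply, Fin.val_rev, sgn, mul_zero,
      add_zero] <;>
    have hi := i.2 <;> have hj := j.2 <;> split_ifs <;>
    first | (exfalso; omega) | simp

/-- The weights `1`, `-1`, `0` on the `e_i`, `f_i`, `u_i`. -/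
def chainWeight (a t : ℕ) : Fin a ⊕ Fin a ⊕ Fin t → ℤ
  | Sum.inl _ => 1
  | Sum.inr (Sum.inl _) => -1
  | Sum.inr (Sum.inr _) => 0

/-- For every choice of `α` and `β` the chain matrices with `ε = 1` and `ε = 0` form a model,
graded by `chainWeight`. -/
lemma realizable_chainMatrix {a t : ℕ} (ht : Odd t) (α β : ℕ) {s s' : Multiset ℕ}
    (hs : RankType (chainMatrix a t α β (1 : κ)) s)
    (hs' : RankType (chainMatrix a t α β (0 : κ)) s') (hc : s.sum = a + a + t) :
    Realizable κ s s' := by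
  obtain ⟨h1, h2, h3⟩ := signedPerm_form (chainDual_chainDual a t)
    (chainSign_chainDual (κ := κ) (α + β + 1) ht)
    (fun i => by rcases i with i | i | i <;> exact sgn_mul_self _)
    (chainMatrix_skew (α := α) (β := β) ht (1 : κ))
  refine ⟨_, inferInstance, inferInstance, _, chainMatrix a t α β (1 : κ),
    chainMatrix a t α β (0 : κ), chainWeight a t, h1, h2, h3, ?_, ?_, ?_, hs, hs', ?_⟩
  · intro i j hij
    have hj : j = chainDual a t i := by
      by_contra h
      simp [h] at hij
    subst hj
    rcases i with i | i | i <;> simp [chainDual, chainWeight]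
  · rintro (i | i | i) (j | j | j) hij <;> simp [chainWeight, chainMatrix] at hij ⊢
  · rintro (i | i | i) (j | j | j) <;> simp [chainWeight, chainMatrix]
  · simp [hc]; omega

variable {ι : Type} [DecidableEq ι]

/-- The basis vectors indexed by `c`, numbered from `1`, with `0` before the first, so that a
nilpotent Jordan block maps `chain κ c (i + 1)` to `chain κ c i`. Numbers greater than `a` have
value `0`. -/
def chain (κ : Type*) [Field κ] {a : ℕ} (c : Fin a → ι) : ℕ → ι → κ
  | 0 => 0
  | i + 1 => if h : i < a then Pi.single (c ⟨i, h⟩) 1 else 0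

lemma chain_zero {a : ℕ} (c : Fin a → ι) : chain κ c 0 = 0 := rfl

lemma chain_succ {a : ℕ} (c : Fin a → ι) {i : ℕ} (h : i < a) :
    chain κ c (i + 1) = Pi.single (c ⟨i, h⟩) 1 := dif_pos h

lemma chain_apply {a : ℕ} {c : Fin a → ι} (hc : Function.Injective c) (i : ℕ) (k : Fin a) :
    chain κ c i (c k) = if (k : ℕ) + 1 = i then 1 else 0 := by
  rcases i with _ | i
  · simp [chain]
  · by_cases h : i < a
    · simp [chain_succ c h, Pi.single_apply, hc.eq_iff, Fin.ext_iff]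
    · have := k.2
      rw [chain, dif_neg h, if_neg (by omega)]; rfl

lemma chain_apply_of_ne {a : ℕ} {c : Fin a → ι} {j : ι} (hc : ∀ k, c k ≠ j) (i : ℕ) :
    chain κ c i j = 0 := by
  rcases i with _ | i
  · rfl
  · rw [chain]
    split_ifs
    · rw [Pi.single_apply, if_neg (hc _).symm]
    · rfl

lemma chainMatrix_mulVec (a t α β : ℕ) (ε : κ) :
    (∀ i < a, chainMatrix a t α β ε *ᵥ chain κ Sum.inl (i + 1) = chain κ Sum.inl i) ∧
    (∀ i < a, chainMatrix a t α β ε *ᵥ chain κ (Sum.inr ∘ Sum.inl) (i + 1) =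
      chain κ (Sum.inr ∘ Sum.inl) i +
        if i + α + 1 = a then ε • chain κ (Sum.inr ∘ Sum.inr) (t - β) else 0) ∧
    (∀ i < t, chainMatrix a t α β ε *ᵥ chain κ (Sum.inr ∘ Sum.inr) (i + 1) =
      chain κ (Sum.inr ∘ Sum.inr) i + if i = β then ε • chain κ Sum.inl (α + 1) else 0) := by
  have j1 : Function.Injective (Sum.inl : Fin a → Fin a ⊕ Fin a ⊕ Fin t) := Sum.inl_injective
  have j2 : Function.Injective (Sum.inr ∘ Sum.inl : Fin a → Fin a ⊕ Fin a ⊕ Fin t) :=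
    Sum.inr_injective.comp Sum.inl_injective
  have j3 : Function.Injective (Sum.inr ∘ Sum.inr : Fin t → Fin a ⊕ Fin a ⊕ Fin t) :=
    Sum.inr_injective.comp Sum.inr_injective
  have n12 : ∀ i k, chain κ (Sum.inl : Fin a → Fin a ⊕ Fin a ⊕ Fin t) i (Sum.inr k) = 0 :=
    fun i k => chain_apply_of_ne (by simp) i
  have n21 : ∀ i k, chain κ (Sum.inr ∘ Sum.inl : Fin a → Fin a ⊕ Fin a ⊕ Fin t) i
    (Sum.inl k) = 0 := fun i k => chain_apply_of_ne (by simp) i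
  have n23 : ∀ i k, chain κ (Sum.inr ∘ Sum.inl : Fin a → Fin a ⊕ Fin a ⊕ Fin t) i
    (Sum.inr (Sum.inr k)) = 0 := fun i k => chain_apply_of_ne (by simp) i
  have n31 : ∀ i k, chain κ (Sum.inr ∘ Sum.inr : Fin t → Fin a ⊕ Fin a ⊕ Fin t) i
    (Sum.inl k) = 0 := fun i k => chain_apply_of_ne (by simp) i
  have n32 : ∀ i k, chain κ (Sum.inr ∘ Sum.inr : Fin t → Fin a ⊕ Fin a ⊕ Fin t) i
    (Sum.inr (Sum.inl k)) = 0 := fun i k => chain_apply_of_ne (by simp) i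
  have e1 := fun i k => chain_apply (κ := κ) j1 i k
  have e2 : ∀ i k, chain κ (Sum.inr ∘ Sum.inl : Fin a → Fin a ⊕ Fin a ⊕ Fin t) i
    (Sum.inr (Sum.inl k)) = _ := fun i k => chain_apply (κ := κ) j2 i k
  have e3 : ∀ i k, chain κ (Sum.inr ∘ Sum.inr : Fin t → Fin a ⊕ Fin a ⊕ Fin t) i
    (Sum.inr (Sum.inr k)) = _ := fun i k => chain_apply (κ := κ) j3 i k
  refine ⟨fun i hi => ?_, fun i hi => ?_, fun i hi => ?_⟩
  all_goals
    rw [chain_succ _ hi, mulVec_single_one]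
    funext k
    rcases k with k | k | k
  · simp [chainMatrix, e1]
  · simp [chainMatrix, n12]
  · simp [chainMatrix, n12]
  · split_ifs <;> simp [chainMatrix, n21, n31]
  · split_ifs <;> simp [chainMatrix, e2, n32]
  · by_cases h : i + α + 1 = a
    · have hk := k.2
      by_cases h' : (k : ℕ) + β + 1 = t
      · simp [chainMatrix, n23, e3, h, h', show (k : ℕ) + 1 = t - β by omega]
      · simp [chainMatrix, n23, e3, h, h', show ¬ (k : ℕ) + 1 = t - β by omega]
    · simp [chainMatrix, n23, h]
  · by_cases h : i = β
    · by_cases h' : (k : ℕ) = α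
      · simp [chainMatrix, n31, e1, h, h']
      · simp [chainMatrix, n31, e1, h, h']
    · simp [chainMatrix, n31, h]
  · split_ifs <;> simp [chainMatrix, n32, n12]
  · split_ifs <;> simp [chainMatrix, e3, n12]

/-- The matrix which shifts the chains `e_0, …, e_{a-1}` and `f_0, …, f_{b-1}`, except that
`ε e_{d j - 1}` is added to the image of `f_j` when `d j ≠ 0`. -/
def twoChainMatrix (a b : ℕ) (d : ℕ → ℕ) (ε : κ) : Matrix (Fin a ⊕ Fin b) (Fin a ⊕ Fin b) κ :=
  Matrix.of fun i j => match i, j with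
    | Sum.inl i, Sum.inl j => if (i : ℕ) + 1 = j then 1 else 0
    | Sum.inr i, Sum.inr j => if (i : ℕ) + 1 = j then 1 else 0
    | Sum.inl i, Sum.inr j => if (i : ℕ) + 1 = d j then ε else 0
    | Sum.inr _, Sum.inl _ => 0

lemma twoChainMatrix_mulVec (a b : ℕ) (d : ℕ → ℕ) (ε : κ) :
    (∀ i < a, twoChainMatrix a b d ε *ᵥ chain κ Sum.inl (i + 1) = chain κ Sum.inl i) ∧
    (∀ i < b, twoChainMatrix a b d ε *ᵥ chain κ Sum.inr (i + 1) =
      chain κ Sum.inr i + ε • chain κ Sum.inl (d i)) := by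
  have n1 : ∀ i k, chain κ (Sum.inl : Fin a → Fin a ⊕ Fin b) i (Sum.inr k) = 0 :=
    fun i k => chain_apply_of_ne (by simp) i
  have n2 : ∀ i k, chain κ (Sum.inr : Fin b → Fin a ⊕ Fin b) i (Sum.inl k) = 0 :=
    fun i k => chain_apply_of_ne (by simp) i
  have e1 := fun i k => chain_apply (κ := κ) (Sum.inl_injective (α := Fin a) (β := Fin b)) i k
  have e2 := fun i k => chain_apply (κ := κ) (Sum.inr_injective (α := Fin a) (β := Fin b)) i k
  refine ⟨fun i hi => ?_, fun i hi => ?_⟩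
  all_goals
    rw [chain_succ _ hi, mulVec_single_one]
    funext k
    rcases k with k | k
  · simp [twoChainMatrix, e1]
  · simp [twoChainMatrix, n1]
  · simp [twoChainMatrix, n2, e1]
  · simp [twoChainMatrix, n1, e2]

lemma eq_top_of_single [Fintype ι] {S : Submodule κ (ι → κ)} (h : ∀ i, Pi.single i 1 ∈ S) :
    S = ⊤ := by
  rw [eq_top_iff, ← (Pi.basisFun κ ι).span_eq, Submodule.span_le]
  rintro _ ⟨i, rfl⟩
  rw [Pi.basisFun_apply]
  exact h i

lemma pow_mulVec_chain [Fintype ι] {x : Matrix ι ι κ} {c : ℕ → ι → κ} (h0 : c 0 = 0) {L : ℕ}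
    (h : ∀ i < L, x *ᵥ c (i + 1) = c i) (k : ℕ) : ∀ i ≤ L, (x ^ k) *ᵥ c i = c (i - k) := by
  induction k with
  | zero => simp
  | succ k ih =>
    intro i hi
    rw [pow_succ', ← Matrix.mulVec_mulVec, ih i hi]
    rcases Nat.eq_zero_or_pos (i - k) with h1 | h1
    · rw [h1, h0, Matrix.mulVec_zero, show i - (k + 1) = 0 by omega, h0]
    · have := h (i - k - 1) (by omega)
      rw [show i - k - 1 + 1 = i - k by omega] at this
      rw [this]; rfl

lemma chain_mem {ι : Type} [Fintype ι] {x : Matrix ι ι κ} {S : Submodule κ (ι → κ)}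
    (hS : ∀ v ∈ S, x *ᵥ v ∈ S) {c : ℕ → ι → κ} {L : ℕ}
    (h : ∀ i < L, x *ᵥ c (i + 1) = c i) (hL : c L ∈ S) :
    ∀ i ≤ L, c i ∈ S := by
  intro i hi
  induction hi using Nat.decreasingInduction with
  | self => exact hL
  | of_succ k hk ih => rw [← h k hk]; exact hS _ ih

end Chains

/-! ### Jordan types of chain matrices -/

section ModelTypes

open Matrix

variable {κ : Type*} [Field κ]

lemma eq_top_of_two_chains {a b : ℕ} {S : Submodule κ (Fin a ⊕ Fin b → κ)}
    (h1 : ∀ i ≤ a, chain κ Sum.inl i ∈ S) (h2 : ∀ i ≤ b, chain κ Sum.inr i ∈ S) : S = ⊤ := by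
  refine eq_top_of_single ?_
  rintro (i | i)
  · rw [← chain_succ (κ := κ) (Sum.inl : Fin a → Fin a ⊕ Fin b) i.2]; exact h1 _ i.2
  · rw [← chain_succ (κ := κ) (Sum.inr : Fin b → Fin a ⊕ Fin b) i.2]; exact h2 _ i.2

lemma eq_top_of_three_chains {a t : ℕ} {S : Submodule κ (Fin a ⊕ Fin a ⊕ Fin t → κ)}
    (h1 : ∀ i ≤ a, chain κ Sum.inl i ∈ S) (h2 : ∀ i ≤ a, chain κ (Sum.inr ∘ Sum.inl) i ∈ S)
    (h3 : ∀ i ≤ t, chain κ (Sum.inr ∘ Sum.inr) i ∈ S) : S = ⊤ := by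
  refine eq_top_of_single ?_
  rintro (i | i | i)
  · have := h1 _ i.2
    rwa [chain_succ _ i.2] at this
  · have := h2 _ i.2
    rwa [chain_succ _ i.2] at this
  · have := h3 _ i.2
    rwa [chain_succ _ i.2] at this

lemma rankType_twoChainMatrix_zero (a b : ℕ) (d : ℕ → ℕ) :
    RankType (twoChainMatrix a b d (0 : κ)) {a, b} := by
  obtain ⟨hE, hF⟩ := twoChainMatrix_mulVec a b d (0 : κ)
  simp only [zero_smul, add_zero] at hF
  refine rankType_of_generators (L := [(a, chain κ Sum.inl a), (b, chain κ Sum.inr b)]) ?_ ?_ ?_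
  · simp only [List.forall_mem_cons, List.not_mem_nil, false_imp_iff, implies_true, and_true]
    rw [pow_mulVec_chain rfl hE a a le_rfl, pow_mulVec_chain rfl hF b b le_rfl]
    simp [chain_zero]
  · simp
  · simp only [List.forall_mem_cons, List.not_mem_nil, false_imp_iff, implies_true, and_true]
    exact fun S hS h => eq_top_of_two_chains (chain_mem hS hE h.1) (chain_mem hS hF h.2)

lemma rankType_chainMatrix_zero (a t α β : ℕ) :
    RankType (chainMatrix a t α β (0 : κ)) {a, a, t} := by
  obtain ⟨hE, hF, hU⟩ := chainMatrix_mulVec a t α β (0 : κ)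
  simp only [zero_smul, ite_self, add_zero] at hF hU
  refine rankType_of_generators (L := [(a, chain κ Sum.inl a), (a, chain κ (Sum.inr ∘ Sum.inl) a),
    (t, chain κ (Sum.inr ∘ Sum.inr) t)]) ?_ ?_ ?_
  · simp only [List.forall_mem_cons, List.not_mem_nil, false_imp_iff, implies_true, and_true]
    rw [pow_mulVec_chain rfl hE a a le_rfl, pow_mulVec_chain rfl hF a a le_rfl,
      pow_mulVec_chain rfl hU t t le_rfl]
    simp [chain_zero]
  · simp
  · simp only [List.forall_mem_cons, List.not_mem_nil, false_imp_iff, implies_true, and_true]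
    exact fun S hS h => eq_top_of_three_chains (chain_mem hS hE h.1) (chain_mem hS hF h.2.1)
      (chain_mem hS hU h.2.2)

/-- Here `u_0 ↦ e_0`, so that the `u_i` extend to a chain of length `t + 1`, and the last `f` is
mapped to a vector which involves its top `u_{t-1}`. -/
lemma rankType_chainMatrix_bottom {m t : ℕ} (h : m ≤ t) (ht : 1 ≤ t) :
    RankType (chainMatrix (m + 1) t 0 0 (1 : κ)) {t + 2, m, m} := by
  obtain ⟨hE, hF, hU⟩ := chainMatrix_mulVec (m + 1) t 0 0 (1 : κ)
  set x := chainMatrix (m + 1) t 0 0 (1 : κ)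
  set E := chain κ (Sum.inl : Fin (m + 1) → Fin (m + 1) ⊕ Fin (m + 1) ⊕ Fin t)
  set F := chain κ (Sum.inr ∘ Sum.inl : Fin (m + 1) → Fin (m + 1) ⊕ Fin (m + 1) ⊕ Fin t)
  set U := chain κ (Sum.inr ∘ Sum.inr : Fin t → Fin (m + 1) ⊕ Fin (m + 1) ⊕ Fin t)
  have hF' : ∀ i < m, x *ᵥ F (i + 1) = F i := fun i hi => by
    rw [hF i (by omega), if_neg (by omega), add_zero]
  have hFm : x *ᵥ F (m + 1) = F m + U t := by
    rw [hF m (by omega), if_pos rfl, one_smul, Nat.sub_zero]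
  set c : ℕ → _ := fun i => if i ≤ 1 then E i else U (i - 1) with hc
  have hcx : ∀ i < t + 1, x *ᵥ c (i + 1) = c i := fun i hi => by
    rcases i with _ | _ | i
    · simp only [hc]; rw [if_pos (by omega), if_pos (by omega)]; exact hE 0 (by omega)
    · simp only [hc]; rw [if_neg (by omega), if_pos (by omega), Nat.add_sub_cancel, zero_add]
      rw [hU 0 (by omega), if_pos rfl, one_smul]
      simp [U, chain_zero, E]
    · simp only [hc]; rw [if_neg (by omega), if_neg (by omega)]
      simp only [Nat.add_sub_cancel]
      rw [hU (i + 1) (by omega), if_neg (by omega), add_zero]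
  have hc1 : c 1 = E 1 := rfl
  have hc0 : c 0 = 0 := rfl
  have hct : U t = c (t + 1) := by simp only [hc]; rw [if_neg (by omega)]; rfl
  refine rankType_of_generators (L := [(t + 2, F (m + 1)), (m, F m), (m, E (m + 1) - c (m + 1))])
    ?_ ?_ ?_
  · simp only [List.forall_mem_cons, List.not_mem_nil, false_imp_iff, implies_true, and_true]
    refine ⟨?_, ?_, ?_⟩
    · rw [pow_succ, ← mulVec_mulVec, hFm, mulVec_add, hct,
        pow_mulVec_chain rfl hF' _ _ le_rfl, pow_mulVec_chain hc0 hcx _ _ le_rfl, Nat.sub_self, hc0,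
        show m - (t + 1) = 0 by omega]
      simp [F, chain_zero]
    · rw [pow_mulVec_chain rfl hF' _ _ le_rfl, Nat.sub_self]; rfl
    · rw [mulVec_sub, pow_mulVec_chain rfl hE _ _ le_rfl,
        pow_mulVec_chain hc0 hcx _ _ (by omega), show m + 1 - m = 1 by omega, hc1, sub_self]
  · simp; omega
  · simp only [List.forall_mem_cons, List.not_mem_nil, false_imp_iff, implies_true, and_true]
    rintro S hS ⟨h1, h2, h3⟩
    have hct' : c (t + 1) ∈ S := by
      rw [← hct, show U t = x *ᵥ F (m + 1) - F m by rw [hFm]; abel]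
      exact S.sub_mem (hS _ h1) h2
    have hcS := chain_mem hS hcx hct'
    have hES : E (m + 1) ∈ S := by
      have := S.add_mem h3 (hcS (m + 1) (by omega))
      rwa [sub_add_cancel] at this
    refine eq_top_of_three_chains (chain_mem hS hE hES) (fun i hi => ?_) fun i hi => ?_
    · rcases Nat.lt_or_ge i (m + 1) with h4 | h4
      · exact chain_mem hS hF' h2 i (by omega)
      · rw [show i = m + 1 by omega]; exact h1
    · rcases i with _ | i
      · exact S.zero_mem
      · have := hcS (i + 2) (by omega)
        simp only [hc, if_neg (show ¬ i + 2 ≤ 1 by omega)] at this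
        exact this

/-- Here `f_0 ↦ u_0`, so that the `f_i` extend to a chain of length `a + 1`, and the last `u` is
mapped to a vector which involves the top `e_{a-1}`. -/
lemma rankType_chainMatrix_top {a t : ℕ} (h : t ≤ a) (ht : 1 ≤ t) :
    RankType (chainMatrix a (t + 1) (a - 1) t (1 : κ)) {a + 1, a + 1, t - 1} := by
  obtain ⟨hE, hF, hU⟩ := chainMatrix_mulVec a (t + 1) (a - 1) t (1 : κ)
  set x := chainMatrix a (t + 1) (a - 1) t (1 : κ)
  set E := chain κ (Sum.inl : Fin a → Fin a ⊕ Fin a ⊕ Fin (t + 1))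
  set F := chain κ (Sum.inr ∘ Sum.inl : Fin a → Fin a ⊕ Fin a ⊕ Fin (t + 1))
  set U := chain κ (Sum.inr ∘ Sum.inr : Fin (t + 1) → Fin a ⊕ Fin a ⊕ Fin (t + 1))
  have hU' : ∀ i < t, x *ᵥ U (i + 1) = U i := fun i hi => by
    rw [hU i (by omega), if_neg (by omega), add_zero]
  have hUt : x *ᵥ U (t + 1) = U t + E a := by
    rw [hU t (by omega), if_pos rfl, one_smul, Nat.sub_add_cancel (by omega)]
  set c : ℕ → _ := fun i => if i ≤ 1 then U i else F (i - 1) with hc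
  have hcx : ∀ i < a + 1, x *ᵥ c (i + 1) = c i := fun i hi => by
    rcases i with _ | _ | i
    · simp only [hc]; rw [if_pos (by omega), if_pos (by omega)]; exact hU' 0 (by omega)
    · simp only [hc]; rw [if_neg (by omega), if_pos (by omega), Nat.add_sub_cancel, zero_add]
      rw [hF 0 (by omega), if_pos (by omega), one_smul, Nat.add_sub_cancel_left]
      simp [F, chain_zero, U]
    · simp only [hc]; rw [if_neg (by omega), if_neg (by omega)]
      simp only [Nat.add_sub_cancel]
      rw [hF (i + 1) (by omega), if_neg (by omega), add_zero]
  have hc1 : c 1 = U 1 := rfl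
  have hc0 : c 0 = 0 := rfl
  refine rankType_of_generators (L := [(a + 1, c (a + 1)), (a + 1, U (t + 1)), (t - 1, U t - c t)])
    ?_ ?_ ?_
  · simp only [List.forall_mem_cons, List.not_mem_nil, false_imp_iff, implies_true, and_true]
    refine ⟨?_, ?_, ?_⟩
    · rw [pow_mulVec_chain hc0 hcx _ _ le_rfl, Nat.sub_self, hc0]
    · rw [pow_succ, ← mulVec_mulVec, hUt, mulVec_add, pow_mulVec_chain rfl hE _ _ le_rfl,
        pow_mulVec_chain rfl hU' _ _ le_rfl, Nat.sub_self, show t - a = 0 by omega]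
      simp [E, U, chain_zero]
    · rw [mulVec_sub, pow_mulVec_chain rfl hU' _ _ le_rfl,
        pow_mulVec_chain hc0 hcx _ _ (by omega), show t - (t - 1) = 1 by omega, hc1, sub_self]
  · simp; omega
  · simp only [List.forall_mem_cons, List.not_mem_nil, false_imp_iff, implies_true, and_true]
    rintro S hS ⟨h1, h2, h3⟩
    have hcS := chain_mem hS hcx h1
    have hUS : U t ∈ S := by
      have := S.add_mem h3 (hcS t (by omega))
      rwa [sub_add_cancel] at this
    have hES : E a ∈ S := by
      rw [show E a = x *ᵥ U (t + 1) - U t by rw [hUt]; abel]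
      exact S.sub_mem (hS _ h2) hUS
    refine eq_top_of_three_chains (chain_mem hS hE hES) (fun i hi => ?_) fun i hi => ?_
    · rcases i with _ | i
      · exact S.zero_mem
      · have := hcS (i + 2) (by omega)
        simp only [hc, if_neg (show ¬ i + 2 ≤ 1 by omega)] at this
        exact this
    · rcases Nat.lt_or_ge i (t + 1) with h4 | h4
      · exact chain_mem hS hU' hUS i (by omega)
      · rw [show i = t + 1 by omega]; exact h2

/-- Here `f_0 ↦ e_0`, so that the `f_i` extend to a chain of length `b + 1`. -/
lemma rankType_twoChainMatrix_glue {a b : ℕ} (h : a ≤ b) :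
    RankType (twoChainMatrix (a + 1) b (fun j => if j = 0 then 1 else 0) (1 : κ)) {b + 1, a} := by
  obtain ⟨hE, hF⟩ := twoChainMatrix_mulVec (a + 1) b (fun j => if j = 0 then 1 else 0) (1 : κ)
  simp only [one_smul] at hF
  set x := twoChainMatrix (a + 1) b (fun j => if j = 0 then 1 else 0) (1 : κ)
  set E := chain κ (Sum.inl : Fin (a + 1) → Fin (a + 1) ⊕ Fin b)
  set F := chain κ (Sum.inr : Fin b → Fin (a + 1) ⊕ Fin b)
  set c : ℕ → _ := fun i => if i ≤ 1 then E i else F (i - 1) with hc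
  have hcx : ∀ i < b + 1, x *ᵥ c (i + 1) = c i := fun i hi => by
    rcases i with _ | _ | i
    · simp only [hc]; rw [if_pos (by omega), if_pos (by omega)]; exact hE 0 (by omega)
    · simp only [hc]; rw [if_neg (by omega), if_pos (by omega), Nat.add_sub_cancel, zero_add]
      rw [hF 0 (by omega), if_pos rfl]
      simp [F, chain_zero, E]
    · simp only [hc]; rw [if_neg (by omega), if_neg (by omega)]
      simp only [Nat.add_sub_cancel]
      rw [hF (i + 1) (by omega), if_neg (by omega)]
      simp [E, chain_zero]
  have hc1 : c 1 = E 1 := rfl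
  have hc0 : c 0 = 0 := rfl
  refine rankType_of_generators (L := [(b + 1, c (b + 1)), (a, E (a + 1) - c (a + 1))]) ?_ ?_ ?_
  · simp only [List.forall_mem_cons, List.not_mem_nil, false_imp_iff, implies_true, and_true]
    refine ⟨?_, ?_⟩
    · rw [pow_mulVec_chain hc0 hcx _ _ le_rfl, Nat.sub_self, hc0]
    · rw [mulVec_sub, pow_mulVec_chain rfl hE _ _ le_rfl,
        pow_mulVec_chain hc0 hcx _ _ (by omega), show a + 1 - a = 1 by omega, hc1, sub_self]
  · simp; omega
  · simp only [List.forall_mem_cons, List.not_mem_nil, false_imp_iff, implies_true, and_true]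
    rintro S hS ⟨h1, h2⟩
    have hcS := chain_mem hS hcx h1
    have hES : E (a + 1) ∈ S := by
      have := S.add_mem h2 (hcS (a + 1) (by omega))
      rwa [sub_add_cancel] at this
    refine eq_top_of_two_chains (chain_mem hS hE hES) fun i hi => ?_
    rcases i with _ | i
    · exact S.zero_mem
    · have := hcS (i + 2) (by omega)
      simp only [hc, if_neg (show ¬ i + 2 ≤ 1 by omega)] at this
      exact this

/-- Here `f_0 ↦ e_{k-1}` and `f_o ↦ f_{o-1} + e_{s-1}` for `s = o + k`. The chain of `f_{s-1}`
passes through `f_{o-1} + e_{s-1}` and ends in `2 e_{k-1}, …, 2 e_0`, while `f_{o-1} - e_{s-1}`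
starts a chain of length `o`. -/
lemma rankType_twoChainMatrix_pair (h2 : (2 : κ) ≠ 0) {o k : ℕ} (ho : 1 ≤ o) (hk : 1 ≤ k) :
    RankType (twoChainMatrix (o + k) (o + k)
      (fun j => if j = 0 then k else if j = o then o + k else 0) (1 : κ)) {o + 2 * k, o} := by
  obtain ⟨hE, hF⟩ := twoChainMatrix_mulVec (o + k) (o + k)
    (fun j => if j = 0 then k else if j = o then o + k else 0) (1 : κ)
  simp only [one_smul] at hF
  set x := twoChainMatrix (o + k) (o + k)
    (fun j => if j = 0 then k else if j = o then o + k else 0) (1 : κ)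
  set E := chain κ (Sum.inl : Fin (o + k) → Fin (o + k) ⊕ Fin (o + k))
  set F := chain κ (Sum.inr : Fin (o + k) → Fin (o + k) ⊕ Fin (o + k))
  have hE0 : E 0 = 0 := rfl
  have hF0 : F 0 = 0 := rfl
  set c : ℕ → _ := fun i => if i ≤ k then E i else F (i - k) with hc
  have hcx : ∀ i < o + k, x *ᵥ c (i + 1) = c i := fun i hi => by
    simp only [hc]
    rcases Nat.lt_trichotomy i k with h | h | h
    · rw [if_pos (by omega), if_pos (by omega)]; exact hE i (by omega)
    · rw [if_neg (by omega), if_pos (by omega), show i + 1 - k = 0 + 1 by omega,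
        hF 0 (by omega), if_pos rfl, hF0, zero_add, h]
    · rw [if_neg (by omega), if_neg (by omega), show i + 1 - k = (i - k) + 1 by omega,
        hF (i - k) (by omega), if_neg (by omega), if_neg (by omega), hE0, add_zero]
  have hck : c k = E k := if_pos le_rfl
  have hc0 : c 0 = 0 := if_pos (Nat.zero_le k)
  have hcs : c (o + k) = F o := by
    simp only [hc]; rw [if_neg (by omega), Nat.add_sub_cancel]
  have hFs : ∀ j < k, (x ^ j) *ᵥ F (o + k) = F (o + k - j) := fun j hj => by
    induction j with
    | zero => simp
    | succ j ih =>
      rw [pow_succ', ← mulVec_mulVec, ih (by omega),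
        show o + k - j = (o + k - (j + 1)) + 1 by omega, hF _ (by omega), if_neg (by omega),
        if_neg (by omega), hE0, add_zero]
  have hFo : (x ^ k) *ᵥ F (o + k) = c (o + k) + E (o + k) := by
    obtain ⟨k', rfl⟩ := Nat.exists_eq_add_of_le' hk
    rw [pow_succ', ← mulVec_mulVec, hFs k' (by omega), show o + (k' + 1) - k' = o + 1 by omega,
      hF o (by omega), if_neg (by omega), if_pos rfl, hcs]
  refine rankType_of_generators
    (L := [(o + 2 * k, F (o + k)), (o, c (o + k) - E (o + k))]) ?_ ?_ ?_
  · simp only [List.forall_mem_cons, List.not_mem_nil, false_imp_iff, implies_true, and_true]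
    refine ⟨?_, ?_⟩
    · rw [show o + 2 * k = (o + k) + k by omega, pow_add, ← mulVec_mulVec, hFo, mulVec_add,
        pow_mulVec_chain rfl hE _ _ le_rfl, pow_mulVec_chain hc0 hcx _ _ le_rfl, Nat.sub_self, hc0,
        hE0, add_zero]
    · rw [mulVec_sub, pow_mulVec_chain rfl hE _ _ le_rfl, pow_mulVec_chain hc0 hcx _ _ le_rfl,
        Nat.add_sub_cancel_left, hck, sub_self]
  · simp; omega
  · simp only [List.forall_mem_cons, List.not_mem_nil, false_imp_iff, implies_true, and_true]
    rintro S hS ⟨h3, h4⟩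
    have hpow : ∀ j, (x ^ j) *ᵥ F (o + k) ∈ S := fun j => by
      induction j with
      | zero => simpa using h3
      | succ j ih => rw [pow_succ', ← mulVec_mulVec]; exact hS _ ih
    have h5 := hpow k
    rw [hFo] at h5
    have hcS : c (o + k) ∈ S := by
      have h6 := S.smul_mem (2⁻¹ : κ) (S.add_mem h5 h4)
      rwa [add_add_sub_cancel, ← two_smul κ, smul_smul, inv_mul_cancel₀ h2, one_smul] at h6
    have hES : E (o + k) ∈ S := by
      have := S.sub_mem h5 hcS
      rwa [add_sub_cancel_left] at this
    refine eq_top_of_two_chains (chain_mem hS hE hES) fun i hi => ?_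
    rcases Nat.lt_or_ge o i with h7 | h7
    · have := hpow (o + k - i)
      rwa [hFs _ (by omega), show o + k - (o + k - i) = i by omega] at this
    · rcases Nat.eq_zero_or_pos i with rfl | h8
      · exact S.zero_mem
      · have := chain_mem hS hcx hcS (i + k) (by omega)
        simp only [hc, if_neg (show ¬ i + k ≤ k by omega), Nat.add_sub_cancel] at this
        exact this

end ModelTypes

/-! ### Models for the moves -/

section RealizeMoves

open Matrix

variable {κ : Type*} [Field κ]

lemma sum_eq_of_cols_eq {s t : Multiset ℕ} (h : ∀ k, cols s k = cols t k) : s.sum = t.sum := by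
  have h1 := sum_cols s (s.sum + t.sum) fun a ha => (Multiset.le_sum_of_mem ha).trans (by omega)
  have h2 := sum_cols t (s.sum + t.sum) fun a ha => (Multiset.le_sum_of_mem ha).trans (by omega)
  exact h1.symm.trans ((Finset.sum_congr rfl fun k _ => h k).trans h2)

lemma RankType.congr {n : Type*} [Fintype n] [DecidableEq n] {x : Matrix n n κ} {s t : Multiset ℕ}
    (hx : RankType x s) (h : ∀ k, cols s k = cols t k) : RankType x t := fun k => by
  rw [hx k, h k]

/-- Only the positive parts of `s` and `t` matter. -/
lemma Realizable.congr {s t s' t' : Multiset ℕ} (h : Realizable κ s t)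
    (hs : ∀ k, cols s k = cols s' k) (ht : ∀ k, cols t k = cols t' k) : Realizable κ s' t' := by
  obtain ⟨ι, _, _, B, x, z, wt, M⟩ := h
  exact ⟨ι, _, _, B, x, z, wt, { M with
    rankType := M.rankType.congr hs
    rankType_limit := M.rankType_limit.congr ht
    card_eq := M.card_eq.trans (sum_eq_of_cols_eq hs) }⟩

/-- The hyperbolic double of a pair of chains, the first of weight `1` and the second of weight `0`.
-/
lemma realizable_double_glue {a b : ℕ} (d : ℕ → ℕ) {s : Multiset ℕ}
    (hs : RankType (twoChainMatrix a b d (1 : κ)) s) (hc : a + b = s.sum) :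
    Realizable κ (s + s) ({a, b} + {a, b}) := by
  refine Realizable.double (x := twoChainMatrix a b d (1 : κ)) (z := twoChainMatrix a b d (0 : κ))
    (wt := Sum.elim (fun _ => 1) fun _ => 0) ?_ ?_ hs (rankType_twoChainMatrix_zero a b d) ?_
  · rintro (i | i) (j | j) hij <;> simp [twoChainMatrix] at hij ⊢
  · rintro (i | i) (j | j) <;> simp [twoChainMatrix]
  · simp [hc]

/-- The move of type 1, on two chains of equal length `o + k` which are dual to each other and have
weights `1` and `-1`. -/
lemma realizable_pair (h2 : (2 : κ) ≠ 0) {o k : ℕ} (ho : Odd o) (hk : 1 ≤ k) :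
    Realizable κ {o + 2 * k, o} {o + k, o + k} := by
  set d : ℕ → ℕ := fun j => if j = 0 then k else if j = o then o + k else 0 with hd
  set τ : Fin (o + k) ⊕ Fin (o + k) → Fin (o + k) ⊕ Fin (o + k) :=
    Sum.elim (fun i => Sum.inr i.rev) (fun i => Sum.inl i.rev) with hτ
  set σ : Fin (o + k) ⊕ Fin (o + k) → κ :=
    Sum.elim (fun i => sgn κ i) (fun i => sgn κ (o + k - 1 - i)) with hσ
  obtain ⟨h1, h3, h4⟩ := signedPerm_form (τ := τ) (σ := σ)
    (x := twoChainMatrix (o + k) (o + k) d (1 : κ))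
    (by rintro (i | i) <;> simp [hτ])
    (by
      rintro (i | i)
      · simp only [hτ, hσ, Sum.elim_inl, Sum.elim_inr, Fin.val_rev]
        congr 1; have := i.2; omega
      · simp only [hτ, hσ, Sum.elim_inl, Sum.elim_inr, Fin.val_rev]
        congr 1; omega)
    (by rintro (i | i) <;> exact sgn_mul_self _)
    (by
      obtain ⟨r, rfl⟩ := ho
      rintro (i | i) (j | j) <;>
        simp only [hτ, hσ, hd, Sum.elim_inl, Sum.elim_inr, twoChainMatrix, Matrix.of_apply,
          Fin.val_rev, sgn, mul_zero, add_zero] <;>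
        have hi := i.2 <;> have hj := j.2 <;> split_ifs <;>
        first | (exfalso; omega) | simp)
  refine ⟨_, inferInstance, inferInstance, _, twoChainMatrix (o + k) (o + k) d (1 : κ),
    twoChainMatrix (o + k) (o + k) d (0 : κ), Sum.elim (fun _ => 1) fun _ => -1, h1, h3, h4,
    ?_, ?_, ?_, rankType_twoChainMatrix_pair h2 ho.pos hk, rankType_twoChainMatrix_zero _ _ _, ?_⟩
  · intro i j hij
    have hj : j = τ i := by
      by_contra h
      simp [h] at hij
    subst hj
    rcases i with i | i <;> simp [hτ]
  · rintro (i | i) (j | j) hij <;> simp [twoChainMatrix] at hij ⊢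
  · rintro (i | i) (j | j) <;> simp [twoChainMatrix]
  · simp; omega

lemma realizable_of_basicMove (h2 : (2 : κ) ≠ 0) {s t : Multiset ℕ} (h : BasicMove s t) :
    Realizable κ s t := by
  -- the limit of each model is a sum of chains whose lengths are the parts of `t`, and the additional
  -- entries glue them together to chains whose lengths are the parts of `s`
  rcases h with ⟨m, k, hk⟩ | ⟨n, m, h⟩ | ⟨n, m, hm, h⟩ | ⟨n, m, h⟩
  · exact realizable_pair h2 ⟨m, rfl⟩ hk
  · have h1 := realizable_chainMatrix (κ := κ) (a := m + 1) (t := 2 * n - 1) ⟨n - 1, by omega⟩ 0 0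
      (rankType_chainMatrix_bottom (by omega) (by omega)) (rankType_chainMatrix_zero _ _ _ _)
      (by simp; omega)
    refine h1.congr (fun k => ?_) fun k => ?_
    · rw [show 2 * n - 1 + 2 = 2 * n + 1 by omega]
    · simp only [cols_insert, cols_singleton]; omega
  · have h1 := realizable_chainMatrix (κ := κ) (a := n - 1) (t := 2 * m + 1) ⟨m, rfl⟩ (n - 1 - 1) (2 * m)
      (rankType_chainMatrix_top (by omega) (by omega)) (rankType_chainMatrix_zero _ _ _ _)
      (by simp; omega)
    refine h1.congr (fun k => ?_) fun k => rfl
    rw [show n - 1 + 1 = n by omega]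
  · have h1 := realizable_double_glue (κ := κ) _ (rankType_twoChainMatrix_glue (a := m) (b := n - 1)
      (by omega)) (by simp; omega)
    refine h1.congr (fun k => ?_) fun k => ?_
    · rw [show n - 1 + 1 = n by omega]
      simp only [cols_add, cols_insert, cols_singleton]; omega
    · simp only [cols_add, cols_insert, cols_singleton]; omega

/-- Every multiset in which even numbers have even multiplicity is realized by the constant model, a
sum of single blocks of odd sizes and of pairs of blocks. -/
lemma realizable_self (r : Multiset ℕ) (hr : ∀ k, Even k → Even (r.count k)) :
    Realizable κ r r := by
  induction hc : r.card using Nat.strong_induction_on generalizing r with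
  | _ c ih =>
    rcases r.empty_or_exists_mem with rfl | ⟨a, ha⟩
    · exact Realizable.zero
    obtain ⟨r', rfl⟩ := Multiset.exists_cons_of_mem ha
    rw [Multiset.card_cons] at hc
    rcases Nat.even_or_odd a with hev | hodd
    · have ha' : a ∈ r' := by
        have := hr a hev
        rw [Multiset.count_cons_self, Nat.even_add_one] at this
        refine Multiset.count_ne_zero.1 fun h0 => this ?_
        rw [h0]; exact Even.zero
      obtain ⟨r'', rfl⟩ := Multiset.exists_cons_of_mem ha'
      rw [Multiset.card_cons] at hc
      have h1 := ih r''.card (by omega) r'' (fun k hk => by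
        have := hr k hk
        simp only [Multiset.count_cons] at this
        split_ifs at this
        · rw [Nat.even_add_one, Nat.even_add_one, not_not] at this; exact this
        · exact this) rfl
      have h3 := Realizable.double (κ := κ) (x := twoChainMatrix a 0 (fun _ => 0) (0 : κ))
        (z := twoChainMatrix a 0 (fun _ => 0) (0 : κ)) (wt := fun _ => 0) (by simp) (by simp)
        (rankType_twoChainMatrix_zero a 0 _) (rankType_twoChainMatrix_zero a 0 _) (by simp)
      refine (h3.add h1).congr (fun k => ?_) fun k => ?_ <;>
      · simp only [cols_add, cols_insert, cols_singleton, cols_cons]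
        simp
        omega
    · have h1 := ih r'.card (by omega) r' (fun k hk => by
        have := hr k hk
        rwa [Multiset.count_cons_of_ne] at this
        rintro rfl
        exact (Nat.not_even_iff_odd.2 hodd) hk) rfl
      have h3 := realizable_chainMatrix (κ := κ) (a := 0) (t := a) hodd 0 0
        (s := {0, 0, a}) (by
          have h4 : chainMatrix 0 a 0 0 (1 : κ) = chainMatrix 0 a 0 0 (0 : κ) := by
            ext (i | i | i) (j | j | j)
            · exact i.elim0
            · exact i.elim0
            · exact i.elim0
            · exact i.elim0
            · exact i.elim0
            · exact i.elim0
            · exact j.elim0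
            · exact j.elim0
            · rfl
          rw [h4]
          exact rankType_chainMatrix_zero _ _ _ _)
        (rankType_chainMatrix_zero _ _ _ _) (by simp)
      refine (h3.add h1).congr (fun k => ?_) fun k => ?_ <;>
      · simp only [cols_add, cols_insert, cols_singleton, cols_cons]
        simp
        omega

theorem realizable_of_move (h2 : (2 : κ) ≠ 0) {N : ℕ} {p q : N.Partition} (hp : IsOrthogonal p)
    (h : Move p q) : Realizable κ p.parts q.parts := by
  obtain ⟨s, t, rest, hst, hs, ht⟩ := h
  have h1 := realizable_self (κ := κ) (rest.filter (0 < ·)) fun k hk => by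
    rcases Nat.eq_zero_or_pos k with rfl | hk0
    · simp
    · have h3 := hp k hk
      rw [hs, Multiset.count_filter_of_pos (p := (0 < ·)) hk0, Multiset.count_add] at h3
      rw [Multiset.count_filter_of_pos (p := (0 < ·)) hk0]
      exact (Nat.even_add.1 h3).1 (hst.even_count hk).1
  refine ((realizable_of_basicMove h2 hst).add h1).congr (fun k => ?_) fun k => ?_
  · rw [hs, cols_filter_pos, cols_add, cols_add, cols_filter_pos]
  · rw [ht, cols_filter_pos, cols_add, cols_add, cols_filter_pos]

end RealizeMoves

/-! ### Limits along cocharacters from models -/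

section Realization

open Matrix

variable {κ : Type*} [Field κ]

lemma IsModel.reindex {ι ι' : Type} [Fintype ι] [DecidableEq ι] [Fintype ι'] [DecidableEq ι']
    {B x z : Matrix ι ι κ} {wt : ι → ℤ} {s t : Multiset ℕ} (M : IsModel B x z wt s t)
    (e : ι ≃ ι') : IsModel (B.submatrix e.symm e.symm) (x.submatrix e.symm e.symm)
      (z.submatrix e.symm e.symm) (wt ∘ e.symm) s t where
  transpose_eq := by rw [transpose_submatrix, M.transpose_eq]
  isUnit := M.isUnit.map (Matrix.reindexAlgEquiv κ κ e)
  skew := by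
    rw [transpose_submatrix, submatrix_mul_equiv, submatrix_mul_equiv, M.skew]; rfl
  form_wt i j := M.form_wt _ _
  upper i j := M.upper _ _
  limit i j := M.limit _ _
  rankType := M.rankType.reindex e
  rankType_limit := M.rankType_limit.reindex e
  card_eq := by rw [← Fintype.card_congr e, M.card_eq]

/-- The limit is again skew, because the form only pairs opposite weights. -/
lemma IsModel.skew_limit {ι : Type} [Fintype ι] [DecidableEq ι]
    {B x z : Matrix ι ι κ} {wt : ι → ℤ} {s t : Multiset ℕ} (M : IsModel B x z wt s t) :
    zᵀ * B = -(B * z) := by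
  ext i j
  have h1 := congrFun (congrFun M.skew i) j
  rw [Matrix.neg_apply, Matrix.mul_apply, Matrix.mul_apply] at h1 ⊢
  simp only [transpose_apply] at h1 ⊢
  by_cases h : wt i + wt j = 0
  · refine (Finset.sum_congr rfl fun k _ => ?_).trans
      (h1.trans (congrArg Neg.neg (Finset.sum_congr rfl fun k _ => ?_)))
    · by_cases hB : B k j = 0
      · rw [hB, mul_zero, mul_zero]
      · have := M.form_wt _ _ hB
        rw [M.limit, if_pos (by omega)]
    · by_cases hB : B i k = 0
      · rw [hB, zero_mul, zero_mul]
      · have := M.form_wt _ _ hB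
        rw [M.limit, if_pos (by omega)]
  · rw [Finset.sum_eq_zero, Finset.sum_eq_zero, neg_zero]
    · intro k _
      by_cases hB : B i k = 0
      · rw [hB, zero_mul]
      · have := M.form_wt _ _ hB
        rw [M.limit, if_neg (by omega), mul_zero]
    · intro k _
      by_cases hB : B k j = 0
      · rw [hB, mul_zero]
      · have := M.form_wt _ _ hB
        rw [M.limit, if_neg (by omega), zero_mul]

variable {N : ℕ}

lemma HasRanks.isNilpotent {x : Matrix (Fin N) (Fin N) κ} {p : N.Partition} (h : HasRanks x p) :
    IsNilpotent x := by
  have key : ∀ k, (x ^ k).rank + ∑ j ∈ Finset.range k, cols p.parts j = N := fun k => by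
    induction k with
    | zero => simp
    | succ k ih => rw [Finset.sum_range_succ]; have := h k; omega
  refine ⟨N, (rank_eq_zero_iff _).1 ?_⟩
  have := key N
  rw [sum_cols_parts] at this
  omega

/-- The homomorphism `t ↦ diag (t ^ wt i)`. -/
def diagHom (κ : Type*) [Field κ] (wt : Fin N → ℤ) : κˣ →* GL (Fin N) κ where
  toFun t := ⟨diagonal fun i => ((t ^ wt i : κˣ) : κ), diagonal fun i => ((t ^ (-wt i) : κˣ) : κ),
    by
      rw [diagonal_mul_diagonal, ← diagonal_one]
      congr 1; funext i
      rw [← Units.val_mul, ← _root_.zpow_add, add_neg_cancel, zpow_zero, Units.val_one],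
    by
      rw [diagonal_mul_diagonal, ← diagonal_one]
      congr 1; funext i
      rw [← Units.val_mul, ← _root_.zpow_add, neg_add_cancel, zpow_zero, Units.val_one]⟩
  map_one' := by
    apply Units.ext
    simp
  map_mul' s t := by
    apply Units.ext
    simp only [Units.val_mul, diagonal_mul_diagonal, mul_zpow]

/-- If `g` carries a model to the standard form `Ω`, then the cocharacter `g diag (t ^ wt i) g⁻¹`
of the orthogonal group has limit `g z g⁻¹` on `g x g⁻¹`. -/
lemma IsModel.exists_isLimit {B x z : Matrix (Fin N) (Fin N) κ} {wt : Fin N → ℤ}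
    {s t : Multiset ℕ} (M : IsModel B x z wt s t) (g : GL (Fin N) κ)
    (hg : (g : Matrix (Fin N) (Fin N) κ)ᵀ * Omega κ N * g = B) :
    ∃ l : Cocharacter κ N, IsLimit l (conj g x) (conj g z) := by
  set g' := ((g⁻¹ : GL (Fin N) κ) : Matrix (Fin N) (Fin N) κ) with hg'
  have hgg : (g : Matrix (Fin N) (Fin N) κ) * g' = 1 := by
    rw [hg', ← Units.val_mul, mul_inv_cancel, Units.val_one]
  have hgg' : g' * (g : Matrix (Fin N) (Fin N) κ) = 1 := by
    rw [hg', ← Units.val_mul, inv_mul_cancel, Units.val_one]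
  have hggT : g'ᵀ * (g : Matrix (Fin N) (Fin N) κ)ᵀ = 1 := by
    rw [← transpose_mul, hgg, transpose_one]
  have hD : ∀ t : κˣ, diagonal (fun i => ((t ^ wt i : κˣ) : κ)) * B *
      diagonal (fun i => ((t ^ wt i : κˣ) : κ)) = B := fun t => by
    ext i j
    rw [mul_diagonal, diagonal_mul]
    by_cases hB : B i j = 0
    · rw [hB]; ring
    · rw [mul_right_comm, ← Units.val_mul, ← _root_.zpow_add, M.form_wt i j hB, zpow_zero, Units.val_one,
        one_mul]
  set φ : κˣ →* GL (Fin N) κ := (MulAut.conj g).toMonoidHom.comp (diagHom κ wt) with hφ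
  have hφv : ∀ t, (φ t : Matrix (Fin N) (Fin N) κ) =
      g * diagonal (fun i => ((t ^ wt i : κˣ) : κ)) * g' := fun t => rfl
  have hφi : ∀ t, (((φ t)⁻¹ : GL (Fin N) κ) : Matrix (Fin N) (Fin N) κ) =
      g * diagonal (fun i => ((t ^ (-wt i) : κˣ) : κ)) * g' := fun t => by
    have : (φ t)⁻¹ = g * (diagHom κ wt t)⁻¹ * g⁻¹ := by
      simp [hφ, MulAut.conj_apply, mul_assoc]
    rw [this]; rfl
  have hmem : ∀ t, φ t ∈ orthGroup κ N := fun t => by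
    change (φ t : Matrix (Fin N) (Fin N) κ)ᵀ * Omega κ N * φ t = Omega κ N
    rw [hφv, transpose_mul, transpose_mul, diagonal_transpose]
    set D := diagonal (fun i => ((t ^ wt i : κˣ) : κ)) with hDdef
    calc _ = g'ᵀ * (D * ((g : Matrix (Fin N) (Fin N) κ)ᵀ * Omega κ N * g) * D) * g' := by
          simp only [mul_assoc]
      _ = (g'ᵀ * (g : Matrix (Fin N) (Fin N) κ)ᵀ) * Omega κ N * (g * g') := by
          rw [hg, hD, ← hg]; simp only [mul_assoc]
      _ = Omega κ N := by rw [hggT, hgg, one_mul, mul_one]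
  refine ⟨⟨φ.codRestrict _ hmem, ?_⟩, ?_⟩
  · refine ⟨(g : Matrix (Fin N) (Fin N) κ).map LaurentPolynomial.C *
      diagonal (fun i => LaurentPolynomial.T (wt i)) * g'.map LaurentPolynomial.C, fun t i j => ?_⟩
    change (φ t : Matrix (Fin N) (Fin N) κ) i j = _
    rw [hφv]
    simp only [Matrix.mul_apply, map_sum, map_mul, Matrix.map_apply, Matrix.diagonal_apply,
      apply_ite (LaurentPolynomial.eval₂ (RingHom.id κ) t), map_zero,
      LaurentPolynomial.eval₂_C, LaurentPolynomial.eval₂_T, RingHom.id_apply]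
  · set Y : Matrix (Fin N) (Fin N) κ[X] := Matrix.of fun a b =>
      Polynomial.C (x a b) * Polynomial.X ^ (wt a - wt b).toNat with hY
    refine ⟨(g : Matrix (Fin N) (Fin N) κ).map Polynomial.C * Y * g'.map Polynomial.C, ?_, ?_⟩
    · intro t i j
      change conj (φ t) (conj g x) i j = _
      have h1 : conj (φ t) (conj g x) = g * (diagonal (fun i => ((t ^ wt i : κˣ) : κ)) * x *
          diagonal (fun i => ((t ^ (-wt i) : κˣ) : κ))) * g' := by
        rw [conj, conj, hφv, hφi, ← hg']
        calc _ = g * diagonal (fun i => ((t ^ wt i : κˣ) : κ)) * (g' * g) * x * (g' * g) *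
            diagonal (fun i => ((t ^ (-wt i) : κˣ) : κ)) * g' := by simp only [mul_assoc]
          _ = _ := by rw [hgg']; simp only [mul_assoc, one_mul]
      have h3 : ∀ a b, (diagonal (fun i => ((t ^ wt i : κˣ) : κ)) * x *
          diagonal (fun i => ((t ^ (-wt i) : κˣ) : κ))) a b = (Y a b).eval (t : κ) := by
        intro a b
        rw [mul_diagonal, diagonal_mul, hY, Matrix.of_apply, Polynomial.eval_mul,
          Polynomial.eval_C, Polynomial.eval_pow, Polynomial.eval_X]
        by_cases hx : x a b = 0
        · rw [hx]; ring
        · have h4 := M.upper a b hx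
          rw [mul_right_comm, ← Units.val_mul, ← _root_.zpow_add, mul_comm, ← sub_eq_add_neg]
          congr 1
          conv_lhs => rw [← Int.toNat_of_nonneg (sub_nonneg.2 h4)]
          rw [zpow_natCast, Units.val_pow_eq_pow_val]
      rw [h1]
      simp only [Matrix.mul_apply (M := _ * _) (N := g'), Matrix.mul_apply (M := _ * Y),
        Matrix.mul_apply (M := (g : Matrix (Fin N) (Fin N) κ)),
        Matrix.mul_apply (M := (g : Matrix (Fin N) (Fin N) κ).map _), h3, Matrix.map_apply,
        Polynomial.eval_finsetSum, Polynomial.eval_mul, Polynomial.eval_C]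
    · intro i j
      have h3 : ∀ a b, z a b = (Y a b).eval 0 := by
        intro a b
        rw [M.limit, hY, Matrix.of_apply, Polynomial.eval_mul,
          Polynomial.eval_C, Polynomial.eval_pow, Polynomial.eval_X]
        by_cases hx : x a b = 0
        · rw [hx]; simp
        · have h4 := M.upper a b hx
          split_ifs with h
          · rw [h]; simp
          · rw [zero_pow (by omega), mul_zero]
      rw [conj, ← hg']
      simp only [Matrix.mul_apply, h3, Matrix.map_apply,
        Polynomial.eval_finsetSum, Polynomial.eval_mul, Polynomial.eval_C]

lemma HasRanks.conj {x : Matrix (Fin N) (Fin N) κ} {p : N.Partition} (h : HasRanks x p)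
    (g : GL (Fin N) κ) : HasRanks (conj g x) p := by
  refine h.congr fun k => ?_
  have h1 : OrthAccess.conj g x ^ k = OrthAccess.conj g (x ^ k) := by
    induction k with
    | zero =>
      rw [pow_zero, pow_zero, OrthAccess.conj, mul_one, ← Units.val_mul, mul_inv_cancel,
        Units.val_one]
    | succ k ih =>
      rw [pow_succ, ih, pow_succ, OrthAccess.conj, OrthAccess.conj, OrthAccess.conj]
      simp only [mul_assoc]
      rw [← mul_assoc ((g⁻¹ : GL (Fin N) κ) : Matrix (Fin N) (Fin N) κ), ← Units.val_mul,
        inv_mul_cancel, Units.val_one, one_mul]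
  rw [h1, OrthAccess.conj, Matrix.rank_mul_eq_left_of_isUnit_det _ _
    ((Matrix.isUnit_iff_isUnit_det _).1 (Units.isUnit _)),
    Matrix.rank_mul_eq_right_of_isUnit_det _ _ ((Matrix.isUnit_iff_isUnit_det _).1 g.isUnit)]

/-- A change of basis which carries the form `B` to `Ω` carries nilpotent `B`-skew matrices into the
nilpotent cone. -/
lemma conj_mem_nilCone {B x : Matrix (Fin N) (Fin N) κ} {p : N.Partition} (hx : HasRanks x p)
    (hs : xᵀ * B = -(B * x)) (g : GL (Fin N) κ)
    (hg : (g : Matrix (Fin N) (Fin N) κ)ᵀ * Omega κ N * g = B) : conj g x ∈ nilCone κ N := by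
  refine ⟨?_, (hx.conj g).isNilpotent⟩
  set g' := ((g⁻¹ : GL (Fin N) κ) : Matrix (Fin N) (Fin N) κ) with hg'
  have hgg : (g : Matrix (Fin N) (Fin N) κ) * g' = 1 := by
    rw [hg', ← Units.val_mul, mul_inv_cancel, Units.val_one]
  have hggT : g'ᵀ * (g : Matrix (Fin N) (Fin N) κ)ᵀ = 1 := by
    rw [← transpose_mul, hgg, transpose_one]
  have hO : Omega κ N = g'ᵀ * B * g' := by
    rw [← hg]
    calc Omega κ N = (g'ᵀ * (g : Matrix (Fin N) (Fin N) κ)ᵀ) * Omega κ N * (g * g') := by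
          rw [hggT, hgg, one_mul, mul_one]
      _ = _ := by simp only [mul_assoc]
  rw [conj, ← hg', transpose_mul, transpose_mul]
  have e1 : g'ᵀ * (xᵀ * (g : Matrix (Fin N) (Fin N) κ)ᵀ) * Omega κ N = g'ᵀ * (xᵀ * B) * g' := by
    rw [← hg]
    calc _ = g'ᵀ * (xᵀ * (g : Matrix (Fin N) (Fin N) κ)ᵀ) * Omega κ N * (g * g') := by
          rw [hgg, mul_one]
      _ = _ := by simp only [mul_assoc]
  have e2 : Omega κ N * (g * x * g') = g'ᵀ * (B * x) * g' := by
    rw [← hg]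
    calc _ = (g'ᵀ * (g : Matrix (Fin N) (Fin N) κ)ᵀ) * Omega κ N * (g * x * g') := by
          rw [hggT, one_mul]
      _ = _ := by simp only [mul_assoc]
  rw [e1, e2, hs, mul_neg, neg_mul, neg_add_cancel]

/-- Every move from an orthogonal partition is realized by a limit along a cocharacter. -/
theorem exists_limit_of_move [IsAlgClosed κ] (h2 : (2 : κ) ≠ 0) {p q : N.Partition}
    (hp : IsOrthogonal p) (h : Move p q) : ∃ x z : Matrix (Fin N) (Fin N) κ,
      x ∈ nilCone κ N ∧ z ∈ nilCone κ N ∧ HasRanks x p ∧ HasRanks z q ∧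
      ∃ l : Cocharacter κ N, IsLimit l x z := by
  obtain ⟨ι, _, _, B, x, z, wt, M⟩ := realizable_of_move (κ := κ) h2 hp h
  have M' := M.reindex (Fintype.equivFinOfCardEq (M.card_eq.trans p.parts_sum))
  generalize B.submatrix _ _ = B' at M'
  generalize x.submatrix _ _ = x' at M'
  generalize z.submatrix _ _ = z' at M'
  have hx : HasRanks x' p := M'.rankType
  have hz : HasRanks z' q := M'.rankType_limit
  -- all symmetric invertible forms are equivalent: this is the case `x₁ = x₂ = 0`
  obtain ⟨g, hg, -⟩ := exists_isometry_mul_eq h2 (x₁ := 0) (x₂ := 0) M'.isUnit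
    (IsUnit.of_mul_eq_one _ Omega_mul_self) M'.transpose_eq Omega_transpose (by simp) (by simp) 1
    (by simp)
  exact ⟨conj g x', conj g z', conj_mem_nilCone hx M'.skew g hg,
    conj_mem_nilCone hz M'.skew_limit g hg, hx.conj g, hz.conj g, M'.exists_isLimit g hg⟩

end Realization

/-! ### Weight decomposition of a cocharacter -/

section Weights

open Matrix

variable {κ : Type*} [Field κ] {N : ℕ}

/-- The characters `t ↦ t ^ n` of the multiplicative group of an infinite field are linearly
independent. -/
lemma linearIndependent_zpow [Infinite κ] :
    LinearIndependent κ fun (n : ℤ) (t : κˣ) => ((t ^ n : κˣ) : κ) := by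
  have hinj : Function.Injective fun n : ℤ => (Units.coeHom κ).comp (zpowGroupHom (α := κˣ) n) := by
    intro m n hmn
    by_contra hne
    wlog hlt : n < m generalizing m n
    · exact this hmn.symm (Ne.symm hne) (by omega)
    have h1 : ∀ t : κˣ, t ^ (m - n).toNat = 1 := fun t => by
      have h3 : t ^ m = t ^ n := Units.ext (DFunLike.congr_fun hmn t)
      rw [← zpow_natCast, Int.toNat_of_nonneg (by omega), _root_.zpow_sub, h3, mul_inv_cancel]
    have hk : (m - n).toNat ≠ 0 := by omega
    have : NeZero (m - n).toNat := ⟨hk⟩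
    have h4 : (rootsOfUnity (m - n).toNat κ : Set κˣ) = Set.univ :=
      Set.eq_univ_of_forall fun t => h1 t
    have h5 : Finite (rootsOfUnity (m - n).toNat κ) := inferInstance
    have h6 : (Set.univ : Set κˣ).Finite := by rw [← h4]; exact h5
    have h7 : Finite κˣ := Set.finite_univ_iff.1 h6
    have h8 : Finite κ := Finite.of_surjective (fun o : Option κˣ => o.elim (0 : κ) fun u => u)
      fun a => by
        by_cases ha : a = 0
        · exact ⟨none, ha.symm⟩
        · exact ⟨some (Units.mk0 a ha), rfl⟩
    exact not_finite κ
  exact (linearIndependent_monoidHom κˣ κ).comp _ hinj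

/-- Matrix-valued Laurent polynomials which agree on `κˣ` have the same coefficients. -/
lemma eq_of_sum_zpow_smul_eq [Infinite κ] {A B : ℤ → Matrix (Fin N) (Fin N) κ} {S T : Finset ℤ}
    (hA : ∀ n ∉ S, A n = 0) (hB : ∀ n ∉ T, B n = 0)
    (h : ∀ t : κˣ, ∑ n ∈ S, ((t ^ n : κˣ) : κ) • A n = ∑ n ∈ T, ((t ^ n : κˣ) : κ) • B n) (n : ℤ) :
    A n = B n := by
  classical
  ext i j
  have h1 := linearIndependent_iff'.1 (linearIndependent_zpow (κ := κ)) (S ∪ T)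
    (fun n => A n i j - B n i j) (by
      funext t
      have e1 : ∑ n ∈ S ∪ T, ((t ^ n : κˣ) : κ) • A n = ∑ n ∈ S, ((t ^ n : κˣ) : κ) • A n :=
        (Finset.sum_subset Finset.subset_union_left fun n _ hn => by rw [hA n hn, smul_zero]).symm
      have e2 : ∑ n ∈ S ∪ T, ((t ^ n : κˣ) : κ) • B n = ∑ n ∈ T, ((t ^ n : κˣ) : κ) • B n :=
        (Finset.sum_subset Finset.subset_union_right fun n _ hn => by rw [hB n hn, smul_zero]).symm
      have h3 := congrFun (congrFun ((e1.trans (h t)).trans e2.symm) i) j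
      simp only [Matrix.sum_apply, Matrix.smul_apply, smul_eq_mul] at h3
      simp only [Finset.sum_apply, Pi.smul_apply, smul_eq_mul, sub_mul, Finset.sum_sub_distrib,
        Pi.zero_apply, sub_eq_zero]
      simpa only [mul_comm] using h3)
  by_cases hn : n ∈ S ∪ T
  · exact sub_eq_zero.1 (h1 n hn)
  · rw [Finset.mem_union, not_or] at hn
    rw [hA n hn.1, hB n hn.2]

lemma exists_finsupp_eval₂ (p : κ[T;T⁻¹]) : ∃ c : ℤ →₀ κ, ∀ t : κˣ,
    LaurentPolynomial.eval₂ (RingHom.id κ) t p = c.sum fun n a => ((t ^ n : κˣ) : κ) * a := by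
  induction p using LaurentPolynomial.induction_on' with
  | add p q hp hq =>
    obtain ⟨c, hc⟩ := hp
    obtain ⟨d, hd⟩ := hq
    refine ⟨c + d, fun t => ?_⟩
    rw [map_add, hc, hd, Finsupp.sum_add_index'] <;> simp [mul_add]
  | C_mul_T n a =>
    refine ⟨Finsupp.single n a, fun t => ?_⟩
    rw [LaurentPolynomial.eval₂_C_mul_T, Finsupp.sum_single_index] <;> simp [mul_comm]

/-- A cocharacter is a Laurent polynomial with matrix coefficients. Its support is contained in a
finite set which may be taken symmetric. -/
lemma Cocharacter.exists_coeff (l : Cocharacter κ N) :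
    ∃ (P : ℤ → Matrix (Fin N) (Fin N) κ) (S : Finset ℤ), (∀ n ∉ S, P n = 0) ∧
      (∀ n, n ∈ S → -n ∈ S) ∧
      ∀ t, ((l.toHom t : GL (Fin N) κ) : Matrix (Fin N) (Fin N) κ) =
        ∑ n ∈ S, ((t ^ n : κˣ) : κ) • P n := by
  classical
  obtain ⟨L, hL⟩ := l.regular
  choose c hc using fun i j => exists_finsupp_eval₂ (L i j)
  set U : Finset ℤ := Finset.univ.biUnion fun i => Finset.univ.biUnion fun j => (c i j).support
  have hU : ∀ i j, (c i j).support ⊆ U ∪ U.image Neg.neg := fun i j n hn =>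
    Finset.mem_union_left _ (Finset.mem_biUnion.2 ⟨i, Finset.mem_univ _,
      Finset.mem_biUnion.2 ⟨j, Finset.mem_univ _, hn⟩⟩)
  refine ⟨fun n => Matrix.of fun i j => c i j n, U ∪ U.image Neg.neg, ?_, ?_, ?_⟩
  · intro n hn
    ext i j
    exact Finsupp.notMem_support_iff.1 fun h => hn (hU i j h)
  · intro n hn
    rcases Finset.mem_union.1 hn with h | h
    · exact Finset.mem_union_right _ (Finset.mem_image_of_mem _ h)
    · obtain ⟨m, hm, rfl⟩ := Finset.mem_image.1 h
      rw [neg_neg]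
      exact Finset.mem_union_left _ hm
  · intro t
    ext i j
    rw [hL, hc, Finsupp.sum_of_support_subset _ (hU i j) _ (by simp)]
    simp [Matrix.sum_apply]

lemma adj_sum {α : Type*} (S : Finset α) (f : α → Matrix (Fin N) (Fin N) κ) :
    adj (∑ a ∈ S, f a) = ∑ a ∈ S, adj (f a) := by
  simp only [adj, transpose_sum, Finset.mul_sum, Finset.sum_mul]

lemma adj_smul (c : κ) (A : Matrix (Fin N) (Fin N) κ) : adj (c • A) = c • adj A := by
  simp [adj]

/-- A cocharacter for which the limit `z` of `x` exists decomposes the space into weight spaces; the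
existence of the limit says that `x` has no components of negative weight, and its value says that
`z` is the component of weight zero. -/
theorem exists_grading_of_isLimit [Infinite κ] {l : Cocharacter κ N}
    {x z : Matrix (Fin N) (Fin N) κ} (h : IsLimit l x z) :
    ∃ (P : ℤ → Matrix (Fin N) (Fin N) κ) (S : Finset ℤ), Grading x z P S := by
  classical
  obtain ⟨P, S, hS, hneg, hP⟩ := l.exists_coeff
  set φ : κˣ → Matrix (Fin N) (Fin N) κ :=
    fun t => ((l.toHom t : GL (Fin N) κ) : Matrix (Fin N) (Fin N) κ) with hφ
  have hφS : ∀ t, φ t = ∑ n ∈ S, ((t ^ n : κˣ) : κ) • P n := hP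
  have hmul : ∀ s t, φ (s * t) = φ s * φ t := fun s t => by simp [hφ]
  have hone : φ 1 = 1 := by simp [hφ]
  have hinv : ∀ t, φ t * φ t⁻¹ = 1 := fun t => by rw [← hmul, mul_inv_cancel, hone]
  have hinv' : ∀ t, φ t⁻¹ * φ t = 1 := fun t => by rw [← hmul, inv_mul_cancel, hone]
  have hφP : ∀ s n, φ s * P n = ((s ^ n : κˣ) : κ) • P n := fun s =>
    eq_of_sum_zpow_smul_eq (S := S) (T := S) (fun n hn => by rw [hS n hn, mul_zero])
      (fun n hn => by rw [hS n hn, smul_zero]) fun t => by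
        have h1 := hmul s t
        rw [hφS t, hφS (s * t), Finset.mul_sum] at h1
        simp only [mul_smul_comm] at h1
        rw [← h1]
        refine Finset.sum_congr rfl fun n _ => ?_
        rw [smul_smul, mul_zpow, Units.val_mul, mul_comm]
  have hPP : ∀ m n, P m * P n = if m = n then P m else 0 := fun m n => by
    have := eq_of_sum_zpow_smul_eq (S := S) (T := {n}) (A := fun m => P m * P n)
      (B := fun m => if m = n then P m else 0) (fun m hm => by rw [hS m hm, zero_mul])
      (fun m hm => if_neg (by simpa using hm)) (fun t => by
        have h1 := hφP t n
        rw [hφS, Finset.sum_mul] at h1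
        simp only [smul_mul_assoc] at h1
        rw [h1, Finset.sum_singleton, if_pos rfl]) m
    exact this
  have hsum : ∑ n ∈ S, P n = 1 := by
    rw [← hone, hφS]
    simp
  have hadj : ∀ n, adj (P n) = P (-n) := by
    refine eq_of_sum_zpow_smul_eq (S := S) (T := S) (fun n hn => by rw [hS n hn, adj_zero])
      (fun n hn => hS _ fun h' => hn (by simpa using hneg _ h')) fun t => ?_
    have h1 : adj (φ t) = φ t⁻¹ := by
      have h3 : (φ t)ᵀ * Omega κ N * φ t = Omega κ N := (l.toHom t).2
      calc adj (φ t) = Omega κ N * (φ t)ᵀ * Omega κ N * (φ t * φ t⁻¹) := by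
            rw [hinv, mul_one, adj]
        _ = Omega κ N * ((φ t)ᵀ * Omega κ N * φ t) * φ t⁻¹ := by simp only [mul_assoc]
        _ = φ t⁻¹ := by rw [h3, Omega_mul_self, one_mul]
    rw [hφS, hφS, adj_sum] at h1
    simp only [adj_smul] at h1
    rw [h1]
    refine Finset.sum_nbij' Neg.neg Neg.neg (fun n hn => hneg n hn) (fun n hn => hneg n hn)
      (fun n _ => neg_neg n) (fun n _ => neg_neg n) fun n _ => ?_
    rw [neg_neg, _root_.inv_zpow']
  obtain ⟨Q, hQ, hz⟩ := h
  obtain ⟨K, hK⟩ : ∃ K, ∀ i j, (Q i j).natDegree < K := by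
    refine ⟨(∑ i, ∑ j, (Q i j).natDegree) + 1, fun i j => Nat.lt_succ_of_le ?_⟩
    exact (Finset.single_le_sum (f := fun j => (Q i j).natDegree) (fun _ _ => Nat.zero_le _)
      (Finset.mem_univ j)).trans (Finset.single_le_sum
        (f := fun i => ∑ j, (Q i j).natDegree) (fun _ _ => Nat.zero_le _) (Finset.mem_univ i))
  set q : ℕ → Matrix (Fin N) (Fin N) κ := fun k => Matrix.of fun i j => (Q i j).coeff k with hq
  have hqK : ∀ k, K ≤ k → q k = 0 := fun k hk => by
    ext i j
    exact Polynomial.coeff_eq_zero_of_natDegree_lt ((hK i j).trans_le hk)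
  have hzq : z = q 0 := by
    ext i j
    rw [hz, ← Polynomial.coeff_zero_eq_eval_zero]; rfl
  have hlim : ∀ t, φ t * x = (∑ k ∈ Finset.range K, ((t ^ (k : ℤ) : κˣ) : κ) • q k) * φ t :=
    fun t => by
      have h1 : conj (l.toHom t : GL (Fin N) κ) x =
          ∑ k ∈ Finset.range K, ((t ^ (k : ℤ) : κˣ) : κ) • q k := by
        ext i j
        rw [hQ, Polynomial.eval_eq_sum_range' (hK i j), Matrix.sum_apply]
        refine Finset.sum_congr rfl fun k _ => ?_
        simp [hq, mul_comm]
      have h3 : conj (l.toHom t : GL (Fin N) κ) x = φ t * x * φ t⁻¹ := by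
        simp [conj, hφ]
      rw [← h1, h3, mul_assoc, hinv', mul_one]
  -- comparison of the coefficients of `φ t * x * P n`
  have hcomp : ∀ n m, P m * x * P n = if n ≤ m then q (m - n).toNat * P n else 0 := fun n => by
    refine eq_of_sum_zpow_smul_eq (S := S)
      (T := (Finset.range K).map ⟨fun k : ℕ => n + (k : ℤ), fun a b hab => by simpa using hab⟩)
      (fun m hm => by rw [hS m hm, zero_mul, zero_mul]) (fun m hm => ?_) fun t => ?_
    · split_ifs with hnm
      · rw [hqK, zero_mul]
        by_contra hlt
        refine hm (Finset.mem_map.2 ⟨(m - n).toNat, Finset.mem_range.2 (by omega), ?_⟩)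
        change n + (((m - n).toNat : ℕ) : ℤ) = m
        omega
      · rfl
    · have h1 : φ t * x * P n = (∑ m ∈ S, ((t ^ m : κˣ) : κ) • (P m * x * P n)) := by
        rw [hφS, Finset.sum_mul, Finset.sum_mul]
        simp only [smul_mul_assoc]
      rw [← h1, hlim, mul_assoc, hφP, Finset.sum_map, Finset.sum_mul]
      refine Finset.sum_congr rfl fun k _ => ?_
      change _ = ((t ^ (n + (k : ℤ)) : κˣ) : κ) •
        (if n ≤ n + (k : ℤ) then q (n + (k : ℤ) - n).toNat * P n else 0)
      rw [if_pos (by omega), show (n + (k : ℤ) - n).toNat = k by omega, smul_mul_smul_comm,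
        _root_.zpow_add, Units.val_mul, mul_comm]
  have hzP : ∀ n, P n * x * P n = z * P n := fun n => by
    rw [hcomp, if_pos le_rfl, sub_self, hzq]; rfl
  have hPz : ∀ n, P n * z = P n * x * P n := fun n => by
    have h1 : P n * z = ∑ m ∈ S, P n * (z * P m) := by
      rw [← Finset.mul_sum, ← Finset.mul_sum, hsum, mul_one]
    have h3 : ∀ m, P n * (z * P m) = if m = n then P n * x * P n else 0 := fun m => by
      rw [← hzP, ← mul_assoc, ← mul_assoc, hPP]
      by_cases hm : m = n
      · subst hm; rw [if_pos rfl, if_pos rfl]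
      · rw [if_neg (Ne.symm hm), if_neg hm, zero_mul, zero_mul]
    rw [h1, Finset.sum_congr rfl fun m _ => h3 m, Finset.sum_ite_eq']
    split_ifs with hn
    · rfl
    · rw [hS n hn, mul_zero]
  exact ⟨P, S, hPP, hsum, hS, hadj, fun m n hmn => by rw [hcomp, if_neg (by omega)],
    fun n => (hPz n).symm, fun n => by rw [hPz, hzP]⟩

end Weights

/-! ### Dominance and the move of type 5 -/

section Dominance

/-- The sum of the excesses `a - j` of the elements of `s` over `j`. -/
def excess (s : Multiset ℕ) (j : ℕ) : ℕ := (s.map (· - j)).sum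

lemma excess_add (s t : Multiset ℕ) (j : ℕ) : excess (s + t) j = excess s j + excess t j := by
  simp [excess]

lemma excess_filter_pos (s : Multiset ℕ) (j : ℕ) : excess (s.filter (0 < ·)) j = excess s j := by
  induction s using Multiset.induction with
  | empty => simp
  | cons a s ih =>
    rw [Multiset.filter_cons, excess_add, ih]
    split_ifs with h
    · simp [excess]
    · simp [excess, show a = 0 by omega]

lemma BasicMove.excess_le {s t : Multiset ℕ} (h : BasicMove s t) (j : ℕ) :
    excess t j ≤ excess s j := by
  cases h <;> simp [excess] <;> omega

lemma Move.excess_le {N : ℕ} {p q : N.Partition} (h : Move p q) (j : ℕ) :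
    excess q.parts j ≤ excess p.parts j := by
  obtain ⟨s, t, rest, hm, hp, hq⟩ := h
  rw [hp, hq, excess_filter_pos, excess_filter_pos, excess_add, excess_add]
  have := hm.excess_le j
  omega

lemma sum_take_le (L : List ℕ) (k j : ℕ) : (L.take k).sum ≤ excess L j + k * j := by
  induction L generalizing k with
  | nil => simp
  | cons a L ih =>
    rcases k with _ | k
    · simp
    · have h1 := ih k
      have h2 : excess (a :: L : List ℕ) j = (a - j) + excess L j := by simp [excess]
      rw [List.take_succ_cons, List.sum_cons, h2, add_mul, one_mul]
      omega

lemma exists_sum_take_eq (L : List ℕ) (hL : L.Pairwise (· ≥ ·)) (k : ℕ) :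
    ∃ j, (L.take k).sum = excess L j + k * j := by
  induction L generalizing k with
  | nil => exact ⟨0, by simp [excess]⟩
  | cons a L ih =>
    rw [List.pairwise_cons] at hL
    rcases k with _ | k
    · refine ⟨a, ?_⟩
      have h1 : excess (a :: L : List ℕ) a = 0 := by
        rw [excess, Multiset.sum_eq_zero_iff]
        intro b hb
        obtain ⟨c, hc, rfl⟩ := Multiset.mem_map.1 hb
        rcases List.mem_cons.1 (Multiset.mem_coe.1 hc) with rfl | hc
        · exact Nat.sub_self _
        · exact Nat.sub_eq_zero_of_le (hL.1 c hc)
      simp [h1]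
    · obtain ⟨j, hj⟩ := ih hL.2 k
      have h2 : ∀ j, excess (a :: L : List ℕ) j = (a - j) + excess L j := fun j => by
        simp [excess]
      rw [List.take_succ_cons, List.sum_cons]
      rcases Nat.le_total j a with hja | hja
      · refine ⟨j, ?_⟩
        rw [h2, add_mul, one_mul]; omega
      · -- all elements are at most `a ≤ j`
        refine ⟨a, ?_⟩
        have h3 : ∀ j, a ≤ j → excess L j = 0 := fun j hj => by
          rw [excess, Multiset.sum_eq_zero_iff]
          intro b hb
          obtain ⟨c, hc, rfl⟩ := Multiset.mem_map.1 hb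
          exact Nat.sub_eq_zero_of_le ((hL.1 c (Multiset.mem_coe.1 hc)).trans hj)
        have h4 := sum_take_le L k a
        have h5 : k * a ≤ k * j := Nat.mul_le_mul_left _ hja
        rw [h3 j hja] at hj
        rw [h3 a le_rfl] at h4
        rw [h2, h3 a le_rfl, add_mul, one_mul]
        omega

/-- The sum of the `k` largest elements of `s` is the minimum over `j` of `excess s j + k * j`. -/
lemma dominates_of_excess_le {N : ℕ} {p q : N.Partition}
    (h : ∀ j, excess q.parts j ≤ excess p.parts j) : Dominates p q := fun k => by
  obtain ⟨j, hj⟩ := exists_sum_take_eq (p.parts.sort (· ≥ ·)) (Multiset.pairwise_sort _ _) k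
  have h1 := sum_take_le (q.parts.sort (· ≥ ·)) k j
  rw [Multiset.sort_eq] at hj h1
  have := h j
  omega

lemma dominates_of_reflTransGen {N : ℕ} {p q : N.Partition} (h : Relation.ReflTransGen Move p q) :
    Dominates p q := by
  refine dominates_of_excess_le ?_
  induction h with
  | refl => exact fun j => le_rfl
  | tail _ h ih => exact fun j => (h.excess_le j).trans (ih j)

lemma eq_or_sumSq_lt {N : ℕ} {p q : N.Partition} (h : Relation.ReflTransGen Move p q) :
    p = q ∨ sumSq q.parts < sumSq p.parts := by
  induction h with
  | refl => exact Or.inl rfl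
  | tail _ h ih =>
    right
    rcases ih with rfl | ih
    · exact h.sumSq_lt
    · exact h.sumSq_lt.trans ih

/-- A move of type 5 is not at the same time one of type 1–4: it raises the columns of index `2m+1`
and `2m+2` by one, lowers those of index `2n-1` and `2n` by one, and between them it leaves a gap.
-/
lemma Move5.not_move {N : ℕ} {p q : N.Partition} (h5 : Move5 p q) : ¬ Move p q := by
  intro h
  obtain ⟨s, t, hst, hcols⟩ := h.cols_add
  obtain ⟨n, m, rest, hnm, hp, hq⟩ := h5
  have key : ∀ k, ((k = 2 * m + 1 ∨ k = 2 * m + 2) ∧ cols t k = cols s k + 1) ∨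
      ((k = 2 * n - 1 ∨ k = 2 * n) ∧ cols s k = cols t k + 1) ∨
      (k ≠ 2 * m + 1 ∧ k ≠ 2 * m + 2 ∧ k ≠ 2 * n - 1 ∧ k ≠ 2 * n ∧ cols s k = cols t k) := fun k => by
    have h1 := hcols k
    rw [hp, hq, cols_add, cols_add] at h1
    simp only [cols_insert (2 * n - 1), cols_insert (2 * n + 1), cols_singleton] at h1
    generalize cols s k = u at *
    generalize cols t k = v at *
    generalize cols rest k = w at *
    split_ifs at h1 <;> omega
  rcases hst with ⟨a, b, hb⟩ | ⟨a, b, hb⟩ | ⟨a, b, hb, hb'⟩ | ⟨a, b, hb⟩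
  · have e1 := key (2 * m + 2)
    have e2 := key (2 * m + 3)
    have e3 := key (2 * n - 1)
    simp only [cols_insert, cols_singleton] at e1 e2 e3
    have f1 : 2 * m + 2 < 2 * a + 1 + b := by
      by_contra hf; split_ifs at e1 <;> omega
    have f0 : 2 * a + 1 ≤ 2 * m + 2 := by
      by_contra hf; split_ifs at e1 <;> omega
    have f2 : 2 * a + 1 + 2 * b ≤ 2 * m + 3 := by
      clear e1 e3
      by_contra hf; split_ifs at e2 <;> omega
    clear e1 e2
    split_ifs at e3 <;> omega
  · have e4 := key b
    have e5 := key (2 * a)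
    simp only [cols_insert, cols_singleton] at e4 e5
    have f1 : b = 2 * a - 1 := by
      clear e5
      by_contra hf; split_ifs at e4 <;> omega
    subst f1
    split_ifs at e4 <;> first | omega | (split_ifs at e5 <;> omega)
  · have e4 := key (a - 1)
    have e5 := key (2 * b - 1)
    simp only [cols_insert, cols_singleton] at e4 e5
    have f1 : a = 2 * b + 1 := by
      clear e5
      by_contra hf; split_ifs at e4 <;> omega
    subst f1
    split_ifs at e4 <;> first | omega | (split_ifs at e5 <;> omega)
  · have e4 := key b
    simp only [cols_insert, cols_singleton] at e4
    split_ifs at e4 <;> omega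

/-- Between adjacent partitions a sequence of moves has only one member, since moves descend in the
dominance order. -/
lemma not_reflTransGen_of_move5 {N : ℕ} {p q : N.Partition} (h5 : Move5 p q) (ha : Adjacent p q) :
    ¬ Relation.ReflTransGen Move p q := by
  obtain ⟨hp, -, hne, -, hmin⟩ := ha
  intro h
  rcases h.cases_head with rfl | ⟨r, hpr, hrq⟩
  · exact hne rfl
  rcases hmin r (hpr.isOrthogonal hp) (dominates_of_reflTransGen (.single hpr))
    (dominates_of_reflTransGen hrq) with rfl | rfl
  · exact hpr.sumSq_lt.false
  · exact h5.not_move hpr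

end Dominance

/-! ### Accessibility of orbits -/

section Accessibility

open Matrix

variable {κ : Type*} [Field κ] {N : ℕ}

lemma conj_mul (g h : GL (Fin N) κ) (x : Matrix (Fin N) (Fin N) κ) :
    conj (g * h) x = conj g (conj h x) := by
  simp only [conj, _root_.mul_inv_rev, Units.val_mul, mul_assoc]

lemma conj_one (x : Matrix (Fin N) (Fin N) κ) : conj 1 x = x := by simp [conj]

lemma orbit_eq_of_mem {x y : Matrix (Fin N) (Fin N) κ} (h : y ∈ orbit x) : orbit x = orbit y := by
  obtain ⟨g, hg, rfl⟩ := h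
  ext z
  constructor
  · rintro ⟨k, hk, rfl⟩
    exact ⟨k * g⁻¹, mul_mem hk (inv_mem hg), by rw [← conj_mul, inv_mul_cancel_right]⟩
  · rintro ⟨k, hk, rfl⟩
    exact ⟨k * g, mul_mem hk hg, by rw [conj_mul]⟩

/-- A limit along `l` is carried by `g` to a limit along `g l g⁻¹`. -/
lemma IsLimit.exists_conj {l : Cocharacter κ N} {x z : Matrix (Fin N) (Fin N) κ} (h : IsLimit l x z)
    {g : GL (Fin N) κ} (hg : g ∈ orthGroup κ N) :
    ∃ l' : Cocharacter κ N, IsLimit l' (conj g x) (conj g z) := by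
  set g' := ((g⁻¹ : GL (Fin N) κ) : Matrix (Fin N) (Fin N) κ) with hg'
  obtain ⟨P, hP⟩ := l.regular
  obtain ⟨Q, hQ, hz⟩ := h
  refine ⟨⟨(MulAut.conj (⟨g, hg⟩ : orthGroup κ N)).toMonoidHom.comp l.toHom,
    (g : Matrix (Fin N) (Fin N) κ).map LaurentPolynomial.C * P * g'.map LaurentPolynomial.C,
    fun t i j => ?_⟩, (g : Matrix (Fin N) (Fin N) κ).map Polynomial.C * Q * g'.map Polynomial.C,
    fun t i j => ?_, fun i j => ?_⟩
  · change ((g : Matrix (Fin N) (Fin N) κ) * ((l.toHom t : GL (Fin N) κ) : Matrix (Fin N) (Fin N) κ) *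
      g') i j = _
    simp only [Matrix.mul_apply, map_sum, map_mul, Matrix.map_apply, hP,
      LaurentPolynomial.eval₂_C, RingHom.id_apply]
  · change conj (g * (l.toHom t : GL (Fin N) κ) * g⁻¹) (conj g x) i j = _
    rw [← conj_mul, inv_mul_cancel_right, conj_mul, conj, ← hg']
    simp only [Matrix.mul_apply, hQ, Matrix.map_apply, Polynomial.eval_finsetSum,
      Polynomial.eval_mul, Polynomial.eval_C]
  · rw [conj, ← hg']
    simp only [Matrix.mul_apply, hz, Matrix.map_apply, Polynomial.eval_finsetSum,
      Polynomial.eval_mul, Polynomial.eval_C]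

/-- The trivial cocharacter has limit `x` on `x`. -/
lemma oneAccessible_of_mem_orbit {x y : nilCone κ N}
    (h : (x : Matrix (Fin N) (Fin N) κ) ∈ orbit (y : Matrix (Fin N) (Fin N) κ)) :
    OneAccessible x y := by
  refine ⟨⟨1, 1, fun t i j => ?_⟩, x, h, (x : Matrix (Fin N) (Fin N) κ).map Polynomial.C,
    fun t i j => ?_, fun i j => ?_⟩
  · simp [Matrix.one_apply, apply_ite (LaurentPolynomial.eval₂ (RingHom.id κ) t)]
  · change conj 1 _ i j = _
    rw [conj_one]
    simp
  · simp

/-- A limit along a cocharacter lowers the partition by moves of type 1–4. -/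
lemma reflTransGen_move_of_oneAccessible [Infinite κ] (h2 : (2 : κ) ≠ 0) {x y : nilCone κ N}
    {p q : N.Partition} (hp : HasRanks (x : Matrix (Fin N) (Fin N) κ) p)
    (hq : HasRanks (y : Matrix (Fin N) (Fin N) κ) q) (h : OneAccessible x y) :
    Relation.ReflTransGen Move p q := by
  obtain ⟨l, _, ⟨g, hg, rfl⟩, hlim⟩ := h
  obtain ⟨P, S, G⟩ := exists_grading_of_isLimit hlim
  have hx := mem_nilCone_iff.1 x.2
  have hz := mem_nilCone_iff.1
    (conj_mem_nilCone hq (eq_neg_of_add_eq_zero_left y.2.1) g hg)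
  exact G.reflTransGen_move h2 hx.1 hx.2 hz.1 hz.2 hp (hq.conj g)

lemma reflTransGen_move_of_accessible [Infinite κ] (h2 : (2 : κ) ≠ 0) {x y : nilCone κ N}
    {p q : N.Partition} (hp : HasRanks (x : Matrix (Fin N) (Fin N) κ) p)
    (hq : HasRanks (y : Matrix (Fin N) (Fin N) κ) q) (h : Accessible x y) :
    Relation.ReflTransGen Move p q := by
  induction h generalizing q with
  | refl => rw [hp.unique hq]
  | @tail y z _ h ih =>
    obtain ⟨r, hr⟩ := exists_hasRanks y.2.2
    exact (ih hr).trans (reflTransGen_move_of_oneAccessible h2 hr hq h)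

/-- Each move is realized by a limit in the model orbits, which is carried to the given element by
the orthogonal group. -/
lemma accessible_of_reflTransGen_move [IsAlgClosed κ] (h2 : (2 : κ) ≠ 0) {x y : nilCone κ N}
    {p q : N.Partition} (hp : HasRanks (x : Matrix (Fin N) (Fin N) κ) p)
    (hq : HasRanks (y : Matrix (Fin N) (Fin N) κ) q) (h : Relation.ReflTransGen Move p q) :
    Accessible x y := by
  induction h using Relation.ReflTransGen.head_induction_on generalizing x with
  | refl =>
    have hxy := mem_orbit_of_rank_eq h2 y.2 x.2 fun k => hq.rank_eq hp k
    exact .single (oneAccessible_of_mem_orbit hxy)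
  | @head p r hpr _ ih =>
    obtain ⟨x₀, z₀, hx₀, hz₀, hp₀, hr₀, l, hl⟩ :=
      exists_limit_of_move h2 (hp.isOrthogonal h2 (mem_nilCone_iff.1 x.2).1) hpr
    obtain ⟨g, hg, hxg⟩ := mem_orbit_of_rank_eq h2 hx₀ x.2 fun k => hp₀.rank_eq hp k
    obtain ⟨l', hl'⟩ := hl.exists_conj hg
    rw [← hxg] at hl'
    have hz : conj g z₀ ∈ orbit z₀ := ⟨g, hg, rfl⟩
    have h1 : OneAccessible x ⟨z₀, hz₀⟩ := ⟨l', conj g z₀, hz, hl'⟩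
    exact Relation.ReflTransGen.head h1 (ih (x := ⟨z₀, hz₀⟩) hr₀)

end Accessibility

end OrthAccess

theorem mainTheorem3 {κ : Type*} [Field κ] [IsAlgClosed κ] (hchar : (2 : κ) ≠ 0) (N : ℕ) :
    -- accessibility is a partial order on the nilpotent orbits
    ((∀ x : OrthAccess.nilCone κ N, OrthAccess.Accessible x x) ∧
      (∀ x y z : OrthAccess.nilCone κ N, OrthAccess.Accessible x y →
        OrthAccess.Accessible y z → OrthAccess.Accessible x z) ∧
      (∀ x y : OrthAccess.nilCone κ N, OrthAccess.Accessible x y → OrthAccess.Accessible y x →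
        OrthAccess.orbit (x : Matrix (Fin N) (Fin N) κ) = OrthAccess.orbit y)) ∧
    -- it is generated by the moves of type 1–4
    (∀ (x y : OrthAccess.nilCone κ N) (p q : N.Partition),
      OrthAccess.HasJordanType (x : Matrix (Fin N) (Fin N) κ) p →
      OrthAccess.HasJordanType (y : Matrix (Fin N) (Fin N) κ) q →
      (OrthAccess.Accessible x y ↔ Relation.ReflTransGen OrthAccess.Move p q)) ∧
    -- the move of type 5 between adjacent partitions is impossible via cocharacters
    (∀ (x y : OrthAccess.nilCone κ N) (p q : N.Partition),
      OrthAccess.HasJordanType (x : Matrix (Fin N) (Fin N) κ) p →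
      OrthAccess.HasJordanType (y : Matrix (Fin N) (Fin N) κ) q →
      OrthAccess.Move5 p q → OrthAccess.Adjacent p q → ¬ OrthAccess.Accessible x y) := by
  have : Infinite κ := IsAlgClosed.instInfinite
  refine ⟨⟨fun x => .refl, fun x y z => .trans, fun x y hxy hyx => ?_⟩, fun x y p q hp hq => ?_,
    fun x y p q hp hq h5 ha h => ?_⟩
  · obtain ⟨p, hp⟩ := OrthAccess.exists_hasRanks x.2.2
    obtain ⟨q, hq⟩ := OrthAccess.exists_hasRanks y.2.2
    have h1 := OrthAccess.reflTransGen_move_of_accessible hchar hp hq hxy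
    have h2 := OrthAccess.reflTransGen_move_of_accessible hchar hq hp hyx
    -- every move decreases the sum of the squares of the parts
    have hpq : p = q := by
      rcases OrthAccess.eq_or_sumSq_lt h1 with h | h
      · exact h
      · rcases OrthAccess.eq_or_sumSq_lt h2 with h' | h'
        · exact h'.symm
        · omega
    subst hpq
    exact OrthAccess.orbit_eq_of_mem
      (OrthAccess.mem_orbit_of_rank_eq hchar x.2 y.2 (hp.rank_eq hq))
  · exact ⟨OrthAccess.reflTransGen_move_of_accessible hchar hp.hasRanks hq.hasRanks,
      OrthAccess.accessible_of_reflTransGen_move hchar hp.hasRanks hq.hasRanks⟩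
  · exact OrthAccess.not_reflTransGen_of_move5 h5 ha
      (OrthAccess.reflTransGen_move_of_accessible hchar hp.hasRanks hq.hasRanks h)
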